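/- **Setting.** An MDP has a finite state set $S$, a finite action set $A$, transition probabilities $\mathbf P(s,\alpha,s')\ge 0$ with $\sum_{s'}\mathbf P(s,\alpha,s')\in\{0,1\}$ ($\alpha$ is enabled in $s$, $\alpha\in A(s)$, if the sum is $1$; $A(s)\neq\emptyset$ for all $s$), a labeling $L$ by sets of atomic propositions and costs $g\ge 0$. A strategy $C$ selects an enabled action after every finite run; $\Pr_s^{\mathcal M,C}$ is the induced probability measure on runs from $s$. Let $S_{\mathrm{sur}}$ be the set of states labeled with a surveillance proposition $\pi_{\mathrm{sur}}$. For a run $\rho=s_0s_1\ldots$ let $\sharp_n(\rho)=1+|\{i\le n: s_i\in S_{\mathrm{sur}}\}|$ and $g_n(\rho)=\sum_{i=0}^n g(s_i,C(s_0\ldots s_i))$. The ACPC and ACPS values are $$V_{\mathcal M,C}(s)=\limsup_{n\to\infty}E_s^{\mathcal M,C}\Big(\frac{g_n}{\sharp_n}\Big),\qquad J_{\mathcal M,C}(s)=\limsup_{n\to\infty}E_s^{\mathcal M,C}\Big(\frac{g_n}{n+1}\Big)\qquad(\in[0,\infty]).$$ A partial stationary strategy is a partial function $\zeta$ from states to actions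 with $\zeta(s)\in A(s)$ where defined; runs under $\zeta$ end where $\zeta$ is undefined. A finite-memory strategy is a tuple $(\mathrm{Mode},\mathsf{act},\Delta,\mathsf{start})$: it starts from $s_0$ in mode $\mathsf{start}(s_0)$, on entering a state $s$ its mode $m$ becomes $\Delta(m,s)$, and in mode $m$ and state $s$ it applies $\mathsf{act}(m,s)$. Let $\mathcal M$ be an MDP, $\pi_{\mathrm{sur}}$ an atomic proposition and $\mathcal A=(Q,2^{\mathrm{AP}},\delta,q_0,Acc)$ a deterministic Rabin automaton such that $\pi_{\mathrm{sur}}$ occurs infinitely often in every accepted word (for instance an automaton for an LTL formula $\varphi\wedge\mathbf G\mathbf F\,\pi_{\mathrm{sur}}$). Let $\mathcal P$ be their product (states $S\times Q$; from $(s,q)$ the automaton moves to $\delta(q,L(s))$; a state $(s,q)$ is a surveillance state iff $\pi_{\mathrm{sur}}\in L(s)$). An end component of $\mathcal P$ consists of a non-empty set of states and of non-empty sets $A_{\mathcal N}(v)$ of enabled actions that do not leave this set, such that it is strongly connected; it is accepting with respect to $(B,G)\in Acc$ if none of its states has its automaton component in $B$ and some state has it in $G$; it is a maximal accepting end component (MAEC)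 if it is accepting and is not properly contained in an end component that is accepting with respect to a same pair. Let $\mathcal N$ be an MAEC of $\mathcal P$, with states $S_{\mathcal N}$, having a state $(s,q)$ such that $q$ is reachable from $q_0$ in $\mathcal A$. Regard $\mathcal N$ as an MDP, and let $S_{\mathcal N_{\mathrm{sur}}}$ be its set of surveillance states. **Algorithm 1.** Start with the states $S_X=S_{\mathcal N}$, the actions $\mathbf A_X(v)=\{\{(v,\alpha)\}:\alpha\in A_{\mathcal N}(v)\}$ (partial stationary strategies), and the probabilities $\mathbf P_X$ and costs $g_X$ of $\mathcal N$. As long as possible, choose $v\in S_X\setminus S_{\mathcal N_{\mathrm{sur}}}$ in any order and eliminate it: for every $u\in S_X\setminus\{v\}$, keep the actions $\zeta_{old}\in\mathbf A_X(u)$ with $\mathbf P_X(u,\zeta_{old},v)=0$, and replace those with $\mathbf P_X(u,\zeta_{old},v)>0$ by all unions $\zeta_{new}=\zeta_{old}\cup\zeta$ with $\zeta\in\mathbf A_X(v)$, $\mathbf P_X(v,\zeta,v)<1$, such that $\zeta_{old}$ and $\zeta$ agree wherever both are defined, with $$\mathbf P_X(u,\zeta_{new},w)=\mathbf P_X(u,\zeta_{old},w)+\mathbf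 P_X(u,\zeta_{old},v)\frac{\mathbf P_X(v,\zeta,w)}{1-\mathbf P_X(v,\zeta,v)},\qquad g_X(u,\zeta_{new})=g_X(u,\zeta_{old})+\mathbf P_X(u,\zeta_{old},v)\frac{g_X(v,\zeta)}{1-\mathbf P_X(v,\zeta,v)};$$ then remove $v$. **Proposition.** The set $S_{\mathcal N_{\mathrm{sur}}}$ is non-empty, the algorithm has an output, and each of its outputs is an MDP $\mathcal N_{\mathrm{sur}}$ with state set $S_{\mathcal N_{\mathrm{sur}}}$ (labels inherited from $\mathcal N$), actions $\mathbf A_{\mathrm{sur}}$, probabilities $\mathbf P_{\mathrm{sur}}$ and costs $g_{\mathrm{sur}}$, such that: 1. For all $v\in S_{\mathcal N_{\mathrm{sur}}}$, every $\zeta\in\mathbf A_{\mathrm{sur}}(v)$ is a partial stationary strategy of $\mathcal N$ that is defined at $v$; for all $v'\in S_{\mathcal N_{\mathrm{sur}}}$, $\mathbf P_{\mathrm{sur}}(v,\zeta,v')=\Pr_v^{\mathcal N,\zeta}(\mathbf X(\neg S_{\mathcal N_{\mathrm{sur}}}\,\mathbf U\,v'))$, the probability that the next surveillance state visited from $v$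 under $\zeta$ is $v'$; and $g_{\mathrm{sur}}(v,\zeta)$ is the expected cumulative cost under $\zeta$ from $v$ until the next visit to $S_{\mathcal N_{\mathrm{sur}}}$. 2. There is a real $V^*=V^*_{\mathcal N_{\mathrm{sur}}}\ge 0$ that, from every state $v$ of $\mathcal N_{\mathrm{sur}}$, is the minimum (attained) of $V_{\mathcal N_{\mathrm{sur}},C}(v)$ over all strategies $C$. 3. For all $C$ and $v$, $V_{\mathcal N_{\mathrm{sur}},C}(v)=J_{\mathcal N_{\mathrm{sur}},C}(v)$. So $V^*$ is also the minimum ACPS value of $\mathcal N_{\mathrm{sur}}$ from every state. A stationary strategy minimizing $J_{\mathcal N_{\mathrm{sur}},\cdot}(v)$ for all $v$ exists, and each such strategy attains the ACPC value $V^*$ from every state. 4. $V^*_{\mathcal N}=V^*$: from every state $s$ of $\mathcal N$, $V^*$ is the minimum (attained) of $V_{\mathcal N,C}(s)$ over the strategies $C$ of $\mathcal N$ that from $s$ almost surely visit $S_{\mathcal N_{\mathrm{sur}}}$ infinitely often. If every end component of $\mathcal N$ without surveillance states has an action of positive cost, then $V^*$ is even the minimum of $V_{\mathcal N,C}(s)$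 over all strategies $C$ of $\mathcal N$. 5. Every stationary strategy $D$ as in 3 lifts to a finite-memory strategy of $\mathcal N$ that, from every state of $\mathcal N$, almost surely visits $S_{\mathcal N_{\mathrm{sur}}}$ infinitely often and attains $V^*_{\mathcal N}$. Its modes are $S_{\mathcal N_{\mathrm{sur}}}\cup\{init\}$, with $\mathsf{start}(v)=v$ and $\Delta(m,v)=v$ for $v\in S_{\mathcal N_{\mathrm{sur}}}$, $\Delta(m,v)=m$ for $v\notin S_{\mathcal N_{\mathrm{sur}}}$, and $\mathsf{act}(m,v)=(D(m))(v)$ for $m\in S_{\mathcal N_{\mathrm{sur}}}$ wherever $D(m)$ is defined at $v$. -/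

import Mathlib

open MeasureTheory ProbabilityTheory Filter
open scoped ENNReal NNReal

namespace ACPC

/-- A Markov decision process with finite state space `S`, actions `A` and atomic propositions `AP`.
For every state and action the transition probabilities sum to `1` (the action is enabled) or
to `0`, and every state has an enabled action. -/
structure MDP (S A AP : Type*) [Fintype S] where
  P : S → A → S → ℝ
  P_nonneg : ∀ s a s', 0 ≤ P s a s'
  P_sum : ∀ s a, ∑ s', P s a s' = 0 ∨ ∑ s', P s a s' = 1
  exists_enabled : ∀ s, ∃ a, ∑ s', P s a s' = 1
  L : S → Set AP
  g : S → A → ℝ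
  g_nonneg : ∀ s a, 0 ≤ g s a

/-! ### Probability measures on runs -/

section Law

variable {T : Type*} [Finite T] [MeasurableSpace T] [MeasurableSingletonClass T]

/-- The transition kernels, from histories `s₀ … sₙ` to the next state, of a process whose next
state has law `step n (s₀ … sₙ)`. -/
noncomputable def stepKernel (step : (n : ℕ) → (Finset.Iic n → T) → PMF T) (n : ℕ) :
    Kernel (Finset.Iic n → T) T where
  toFun h := (step n h).toMeasure
  measurable' := measurable_of_countable _

instance (step : (n : ℕ) → (Finset.Iic n → T) → PMF T) (n : ℕ) :
    IsMarkovKernel (stepKernel step n) :=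
  ⟨fun h => by
    change IsProbabilityMeasure (step n h).toMeasure
    infer_instance⟩

/-- The law on `ℕ → T` of the process started at `t` whose next state, after the history
`s₀ … sₙ`, has law `step n (s₀ … sₙ)`. -/
noncomputable def pathLaw (step : (n : ℕ) → (Finset.Iic n → T) → PMF T) (t : T) :
    Measure (ℕ → T) :=
  Kernel.traj (X := fun _ => T) (stepKernel step) 0 (fun _ => t)

end Law

/-- The last state of a history `s₀ … sₙ`. -/
def last {T : Type*} {n : ℕ} (h : Finset.Iic n → T) : T := h ⟨n, Finset.mem_Iic.2 le_rfl⟩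

instance {S : Type*} : MeasurableSpace (Option S) := ⊤

instance {S : Type*} : MeasurableSingletonClass (Option S) := ⟨fun _ => trivial⟩

namespace MDP

variable {S A AP : Type*} [Fintype S]

/-- The set `A(s)` of actions enabled in `s`. -/
def enabled (M : MDP S A AP) (s : S) : Set A := {a | ∑ s', M.P s a s' = 1}

/-- The law of the next state when an enabled action is applied. -/
noncomputable def next (M : MDP S A AP) (s : S) (a : A) (h : a ∈ M.enabled s) : PMF S :=
  PMF.ofFintype (fun s' => ENNReal.ofReal (M.P s a s')) (by
    rw [← ENNReal.ofReal_sum_of_nonneg (fun s' _ => M.P_nonneg s a s')]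
    have h' : ∑ s', M.P s a s' = 1 := h
    rw [h', ENNReal.ofReal_one])

/-- The states whose label contains the proposition `π`. -/
noncomputable def sur (M : MDP S A AP) (π : AP) : Finset S :=
  open Classical in Finset.univ.filter fun s => π ∈ M.L s

/-! ### Strategies -/

/-- A (deterministic, history dependent) control strategy. It selects an enabled action after every
history `s₀ … sₙ`; its values on histories that are not finite runs play no role. -/
structure Strategy (M : MDP S A AP) where
  act : (n : ℕ) → (Finset.Iic n → S) → A
  mem : ∀ n h, act n h ∈ M.enabled (last h)

/-- A stationary (memoryless) strategy. -/
structure Stationary (M : MDP S A AP) where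
  act : S → A
  mem : ∀ s, act s ∈ M.enabled s

/-- A stationary strategy as a control strategy. -/
def Stationary.toStrategy {M : MDP S A AP} (D : M.Stationary) : M.Strategy where
  act _ h := D.act (last h)
  mem _ h := D.mem (last h)

/-- A finite-memory strategy with set of modes `Mode` (finite wherever it is used): `start s₀` is
the mode in the starting state `s₀`, and whenever a state `s` is entered the mode `m` is updated
to `Δ m s`; the action applied in the mode `m` and the state `s` is `act m s`. -/
structure FiniteMemory (M : MDP S A AP) (Mode : Type*) where
  start : S → Mode
  Δ : Mode → S → Mode
  act : Mode → S → A
  mem : ∀ m s, act m s ∈ M.enabled s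

/-- The mode reached after the history `s₀ … sₙ`. -/
def FiniteMemory.mode {M : MDP S A AP} {Mode : Type*} (F : M.FiniteMemory Mode) :
    (n : ℕ) → (Finset.Iic n → S) → Mode
  | 0, h => F.start (last h)
  | n + 1, h =>
    F.Δ (F.mode n fun i => h ⟨i.1, Finset.mem_Iic.2 ((Finset.mem_Iic.1 i.2).trans n.le_succ)⟩)
      (last h)

/-- A finite-memory strategy as a control strategy. -/
def FiniteMemory.toStrategy {M : MDP S A AP} {Mode : Type*} (F : M.FiniteMemory Mode) :
    M.Strategy where
  act n h := F.act (F.mode n h) (last h)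
  mem n h := F.mem (F.mode n h) (last h)

/-! ### Costs -/

/-- The cumulative cost `∑_{i ≤ n} g(sᵢ, C(s₀ … sᵢ))` in the first stages of a run. -/
noncomputable def cost (M : MDP S A AP) (C : M.Strategy) (n : ℕ) (ρ : ℕ → S) : ℝ :=
  ∑ i ∈ Finset.range (n + 1), M.g (ρ i) (C.act i fun j => ρ j)

/-- The number of surveillance cycles completed in `s₀ … sₙ`, plus one. -/
noncomputable def cycles (M : MDP S A AP) (π : AP) (n : ℕ) (ρ : ℕ → S) : ℕ :=
  open Classical in ((Finset.range (n + 1)).filter fun i => ρ i ∈ M.sur π).card + 1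

section

variable [MeasurableSpace S] [MeasurableSingletonClass S]

/-- The probability measure `Pr_s^{M,C}` on the runs of `M` under `C` from `s`. -/
noncomputable def law (M : MDP S A AP) (C : M.Strategy) (s : S) : Measure (ℕ → S) :=
  pathLaw (fun n h => M.next (last h) (C.act n h) (C.mem n h)) s

/-- The average expected cumulative cost per surveillance cycle `V_{M,C}(s)`. -/
noncomputable def acpc (M : MDP S A AP) (π : AP) (C : M.Strategy) (s : S) : ℝ≥0∞ :=
  limsup (fun n => ∫⁻ ρ, ENNReal.ofReal (M.cost C n ρ / M.cycles π n ρ) ∂(M.law C s)) atTop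

/-- The average expected cost per stage under `C` from `s`. -/
noncomputable def acps (M : MDP S A AP) (C : M.Strategy) (s : S) : ℝ≥0∞ :=
  limsup (fun n : ℕ => ∫⁻ ρ, ENNReal.ofReal (M.cost C n ρ / ((n : ℝ) + 1)) ∂(M.law C s)) atTop

/-- Under `C` from `s`, surveillance states are almost surely visited infinitely often. -/
def Surveils (M : MDP S A AP) (π : AP) (C : M.Strategy) (s : S) : Prop :=
  ∀ᵐ ρ ∂(M.law C s), ∃ᶠ n in atTop, ρ n ∈ M.sur π

end

/-! ### Partial stationary strategies -/

/-- `ζ` is a partial stationary strategy: wherever it is defined, it selects an enabled action. -/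
def IsPartialStationary (M : MDP S A AP) (ζ : S → Option A) : Prop :=
  ∀ s a, ζ s = some a → a ∈ M.enabled s

/-- One step of `M` under `ζ`. The value `none` means that the run has ended, which happens after
a state where `ζ` does not select an action. -/
noncomputable def partialNext (M : MDP S A AP) (ζ : S → Option A) : Option S → PMF (Option S)
  | none => PMF.pure none
  | some s =>
    open Classical in
    if h : ∃ a, ζ s = some a ∧ a ∈ M.enabled s then
      (M.next s h.choose h.choose_spec.2).map some
    else PMF.pure none

/-- The probability measure `Pr_s^{M,ζ}` on the finite or infinite runs of `M` under the partial
stationary strategy `ζ` from `s`; a finite run is continued by `none` forever. -/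
noncomputable def partialLaw (M : MDP S A AP) (ζ : S → Option A) (s : S) :
    Measure (ℕ → Option S) :=
  pathLaw (fun _ h => M.partialNext ζ (last h)) (some s)

/-- The probability of `X (¬ S_sur U v')` under `ζ` from `v`: after the start, the first
surveillance state that is visited is `v'` (for `v' ∈ S_sur`). -/
noncomputable def nextSurProb (M : MDP S A AP) (π : AP) (ζ : S → Option A) (v v' : S) : ℝ≥0∞ :=
  M.partialLaw ζ v
    {ρ | ∃ k, 1 ≤ k ∧ ρ k = some v' ∧ ∀ j, 1 ≤ j → j < k → ∀ s ∈ M.sur π, ρ j ≠ some s}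

/-- The cost of the stage that `ζ` plays in `x` (zero if the run has ended). -/
noncomputable def partialStageCost (M : MDP S A AP) (ζ : S → Option A) (x : Option S) : ℝ≥0∞ :=
  match x with
  | none => 0
  | some s =>
    match ζ s with
    | none => 0
    | some a => ENNReal.ofReal (M.g s a)

/-- The expected cumulative cost under `ζ` from `v` until, after the start, a surveillance state is
reached: the stages `i` with no surveillance state among the positions `1, …, i` are counted. -/
noncomputable def cycleCost (M : MDP S A AP) (π : AP) (ζ : S → Option A) (v : S) : ℝ≥0∞ :=
  ∫⁻ ρ, ∑' i, Set.indicator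
    {ρ : ℕ → Option S | ∀ j, 1 ≤ j → j ≤ i → ∀ s ∈ M.sur π, ρ j ≠ some s}
    (fun ρ => M.partialStageCost ζ (ρ i)) ρ ∂(M.partialLaw ζ v)

end MDP

/-! ### End components -/

/-- A set of states and, for every state, a set of actions. -/
@[ext] structure Sub (S A : Type*) where
  states : Finset S
  act : S → Set A

namespace Sub

variable {S A AP : Type*} [Fintype S]

/-- `N` is an end component of `M`. -/
structure IsEC (M : MDP S A AP) (N : Sub S A) : Prop where
  nonempty : N.states.Nonempty
  act_of_notMem : ∀ s, s ∉ N.states → N.act s = ∅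
  act_nonempty : ∀ s ∈ N.states, (N.act s).Nonempty
  act_enabled : ∀ s, N.act s ⊆ M.enabled s
  closed : ∀ s ∈ N.states, ∀ a ∈ N.act s, ∀ s', 0 < M.P s a s' → s' ∈ N.states
  connected : ∀ s ∈ N.states, ∀ s' ∈ N.states,
    Relation.ReflTransGen (fun x y => ∃ a ∈ N.act x, 0 < M.P x a y) s s'

open Classical in
/-- An end component, viewed as an MDP on its own states. -/
noncomputable def toMDP {M : MDP S A AP} {N : Sub S A} (hN : N.IsEC M) : MDP N.states A AP where
  P s a s' := if a ∈ N.act s then M.P s a s' else 0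
  P_nonneg s a s' := by
    split_ifs
    · exact M.P_nonneg _ _ _
    · exact le_rfl
  P_sum s a := by
    by_cases h : a ∈ N.act s
    · right
      simp only [h, if_true]
      exact aux hN s a h
    · left
      simp [h]
  exists_enabled s := by
    obtain ⟨a, ha⟩ := hN.act_nonempty s s.2
    refine ⟨a, ?_⟩
    simp only [ha, if_true]
    exact aux hN s a ha
  L s := M.L s
  g s a := M.g s a
  g_nonneg s a := M.g_nonneg s a
where
  aux {M : MDP S A AP} {N : Sub S A} (hN : N.IsEC M) (s : N.states) (a : A) (h : a ∈ N.act s) :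
      ∑ s' : N.states, M.P s a s' = 1 := by
    have h1 : ∑ s', M.P s a s' = 1 := hN.act_enabled s h
    rw [← h1, Finset.sum_coe_sort N.states (fun s' => M.P s a s')]
    refine Finset.sum_subset (Finset.subset_univ _) fun s' _ hs' => ?_
    by_contra hne
    exact hs' (hN.closed s s.2 a h s' (lt_of_le_of_ne (M.P_nonneg _ _ _) (Ne.symm hne)))

end Sub

/-! ### Rabin automata, products and accepting end components -/

/-- A deterministic Rabin automaton over the alphabet of sets of atomic propositions. -/
structure DRA (AP Q : Type*) where
  δ : Q → Set AP → Q
  q₀ : Q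
  Acc : Set (Set Q × Set Q)

namespace DRA

variable {AP Q : Type*}

/-- The run induced by a word. -/
def run (R : DRA AP Q) (w : ℕ → Set AP) : ℕ → Q
  | 0 => R.q₀
  | n + 1 => R.δ (R.run w n) (w n)

/-- The word `w` induces an accepting run: for some pair `(B, G)`, every state of `B` is visited
finitely often and some state of `G` is visited infinitely often. -/
def Accepts (R : DRA AP Q) (w : ℕ → Set AP) : Prop :=
  ∃ p ∈ R.Acc, (∀ b ∈ p.1, ¬ ∃ᶠ n in atTop, R.run w n = b) ∧
    ∃ q ∈ p.2, ∃ᶠ n in atTop, R.run w n = q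

end DRA

section Product

variable {S A AP Q : Type*} [Fintype S] [Fintype Q]

open Classical in
/-- The product of an MDP and a Rabin automaton. A state `(s, q)` is labelled with the atomic
proposition `some q`, and also with the surveillance proposition `none` if `π` holds in `s`. -/
noncomputable def MDP.product (M : MDP S A AP) (R : DRA AP Q) (π : AP) :
    MDP (S × Q) A (Option Q) where
  P x a y := if y.2 = R.δ x.2 (M.L x.1) then M.P x.1 a y.1 else 0
  P_nonneg x a y := by
    split_ifs
    · exact M.P_nonneg _ _ _
    · exact le_rfl
  P_sum x a := by
    rw [aux]
    exact M.P_sum x.1 a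
  exists_enabled x := by
    obtain ⟨a, ha⟩ := M.exists_enabled x.1
    refine ⟨a, ?_⟩
    rw [aux]
    exact ha
  L x := {l | l = some x.2 ∨ (l = none ∧ π ∈ M.L x.1)}
  g x a := M.g x.1 a
  g_nonneg x a := M.g_nonneg x.1 a
where
  aux (x : S × Q) (a : A) :
      ∑ y : S × Q, (if y.2 = R.δ x.2 (M.L x.1) then M.P x.1 a y.1 else 0) =
        ∑ s', M.P x.1 a s' := by
    rw [Fintype.sum_prod_type]
    simp

/-- `N` is an end component of the product that is accepting with respect to the pair `p`. -/
def IsAECFor (M : MDP S A AP) (R : DRA AP Q) (π : AP) (p : Set Q × Set Q)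
    (N : Sub (S × Q) A) : Prop :=
  N.IsEC (M.product R π) ∧ p ∈ R.Acc ∧ (∀ x ∈ N.states, x.2 ∉ p.1) ∧ ∃ x ∈ N.states, x.2 ∈ p.2

/-- `N` is a maximal accepting end component of the product: it is accepting, and no different
end component that contains it is accepting with respect to a pair for which `N` is accepting. -/
def IsMAEC (M : MDP S A AP) (R : DRA AP Q) (π : AP) (N : Sub (S × Q) A) : Prop :=
  (∃ p, IsAECFor M R π p N) ∧
    ¬ ∃ N' : Sub (S × Q) A, N' ≠ N ∧ N.states ⊆ N'.states ∧ (∀ x, N.act x ⊆ N'.act x) ∧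
      ∃ p, IsAECFor M R π p N ∧ IsAECFor M R π p N'

theorem IsMAEC.isEC {M : MDP S A AP} {R : DRA AP Q} {π : AP} {N : Sub (S × Q) A}
    (h : IsMAEC M R π N) : N.IsEC (M.product R π) :=
  h.1.choose_spec.1

end Product

/-! ### The reduction algorithm -/

/-- The auxiliary MDP `X` of the algorithm: its states, the actions of every state (which are
partial stationary strategies), the transition probabilities and the costs. Only the values of
`act` at states of `X`, and of `P` and `g` at actions of these states, are meaningful. -/
structure Aux (S A : Type*) where
  states : Finset S
  act : S → Set (S → Option A)
  P : S → (S → Option A) → S → ℝ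
  g : S → (S → Option A) → ℝ

/-- `ζ` and `ζ'` agree wherever both are defined. -/
def Compatible {S A : Type*} (ζ ζ' : S → Option A) : Prop :=
  ∀ s a b, ζ s = some a → ζ' s = some b → a = b

/-- The union of two (compatible) partial stationary strategies. -/
def merge {S A : Type*} (ζ ζ' : S → Option A) : S → Option A := fun s => (ζ s).or (ζ' s)

namespace Aux

variable {S A AP : Type*}

open Classical in
/-- The initial auxiliary MDP: an action `a` of a state `v` becomes `{(v, a)}`. -/
noncomputable def init [Fintype S] (M : MDP S A AP) : Aux S A where
  states := Finset.univ
  act v := {ζ | ∃ a ∈ M.enabled v, ζ = fun u => if u = v then some a else none}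
  P v ζ v' := match ζ v with
    | none => 0
    | some a => M.P v a v'
  g v ζ := match ζ v with
    | none => 0
    | some a => M.g v a

/-- When `v` is eliminated from `X`, the state `u` gets the action `ξ` with transition
probabilities `p` and cost `c`: either `ξ` is an action of `u` that does not lead to `v`, which is
kept, or it is the union of an action of `u` that leads to `v` and a compatible action of `v` that
does not stay in `v` surely. -/
def Outcome (X : Aux S A) (v u : S) (ξ : S → Option A) (p : S → ℝ) (c : ℝ) : Prop :=
  (ξ ∈ X.act u ∧ ¬ 0 < X.P u ξ v ∧ p = X.P u ξ ∧ c = X.g u ξ) ∨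
  ∃ ζold ∈ X.act u, ∃ ζ ∈ X.act v,
    0 < X.P u ζold v ∧ X.P v ζ v < 1 ∧ Compatible ζold ζ ∧ ξ = merge ζold ζ ∧
    (∀ w, p w = X.P u ζold w + X.P u ζold v * (X.P v ζ w / (1 - X.P v ζ v))) ∧
    c = X.g u ζold + X.P u ζold v * (X.g v ζ / (1 - X.P v ζ v))

/-- `X'` results from `X` by eliminating the state `v`. -/
structure Elim (X : Aux S A) (v : S) (X' : Aux S A) : Prop where
  mem : v ∈ X.states
  states : ∀ u, u ∈ X'.states ↔ u ∈ X.states ∧ u ≠ v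
  act : ∀ u ∈ X'.states, ∀ ξ, ξ ∈ X'.act u ↔ ∃ p c, X.Outcome v u ξ p c
  val : ∀ u ∈ X'.states, ∀ ξ ∈ X'.act u, X.Outcome v u ξ (X'.P u ξ) (X'.g u ξ)

/-- `X` is an output of the reduction algorithm on `M`: it is obtained from the initial auxiliary
MDP by eliminating all the states that are not surveillance states, in any order. -/
def IsOutput [Fintype S] (M : MDP S A AP) (π : AP) (X : Aux S A) : Prop :=
  Relation.ReflTransGen (fun Y Y' => ∃ v, v ∉ M.sur π ∧ Y.Elim v Y') (init M) X ∧
    X.states = M.sur π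

/-- `Msur` is the MDP on the surveillance states of `M` whose enabled actions, transition
probabilities and costs are those of `X`, and whose labels are those of `M`. -/
structure Yields [Fintype S] (M : MDP S A AP) (π : AP) (X : Aux S A)
    (Msur : MDP (M.sur π) (S → Option A) AP) : Prop where
  enabled : ∀ v : M.sur π, Msur.enabled v = X.act v
  P : ∀ v : M.sur π, ∀ ζ ∈ X.act v, ∀ v' : M.sur π, Msur.P v ζ v' = X.P v ζ v'
  g : ∀ v : M.sur π, ∀ ζ ∈ X.act v, Msur.g v ζ = X.g v ζ
  L : ∀ v : M.sur π, Msur.L v = M.L v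

end Aux

/-- `F` unwraps the stationary strategy `D` of the reduced MDP. Its modes are the surveillance
states and an initial mode `none`; in a surveillance state `v` the mode becomes `v`, elsewhere it
is kept, and in the mode `m` the partial stationary strategy `D(m)` is followed wherever it is
defined. -/
structure Unwraps {S A AP : Type*} [Fintype S] (M : MDP S A AP) (π : AP)
    (Msur : MDP (M.sur π) (S → Option A) AP) (D : Msur.Stationary)
    (F : M.FiniteMemory (Option (M.sur π))) : Prop where
  start : ∀ v : M.sur π, F.start v = some v
  Δ_sur : ∀ m, ∀ v : M.sur π, F.Δ m v = some v
  Δ_else : ∀ m, ∀ v, v ∉ M.sur π → F.Δ m v = m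
  act : ∀ (m : M.sur π) (v : S) (a : A), D.act m v = some a → F.act (some m) v = a

end ACPC

/-!
The theorem is proved for an arbitrary communicating MDP `M` with at least one surveillance state
(`exists_reduction`). An end component is communicating, and an accepting one with a reachable
automaton state has a surveillance state because some path through it completes an accepted word
(`exists_sur_of_isAECFor`).

*The value.* The number `V` comes from the optimality equation (`MDP.exists_optimal`). It is the
largest number for which some `h` satisfies
`h s + V · 1_sur(s) ≤ g(s, a) + ∑ y, P(s, a, y) h(y)` for all enabled actions, and for a suitable
`h` there is a stationary strategy `D` of `M` that reaches the surveillance states and along which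
this is an equality. Existence is a compactness argument, since communication bounds the oscillation
of `h`.

*From inequalities to `E[gₙ / ♯ₙ]`.* Since the expectation of a quotient is required, additive
martingales do not suffice. For small `lam`, the products of `1 - lam h` (or of `1 + lam H`, for a
solution `H` of the opposite inequality along one strategy) with `exp` of `lam` times
`V ♯ₙ - (1 + ε) gₙ` (or `(1 - ε) gₙ - V ♯ₙ`) are supermartingales, so that these differences have
bounded exponential moments. This makes `V` a lower bound for the ACPC values of all strategies
under which `♯ₙ + gₙ` tends to infinity in probability (`MDP.le_acpc`), and an upper bound for the
value of a surveilling strategy with a potential `H` that may depend on a finite-memory mode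
(`MDP.acpc_le`). If every end component without surveillance states has an action of positive cost,
the first condition holds for every strategy (`MDP.tendsto_visits_total_lt`).

*The reduction.* The invariant `Aux.Inv` of the algorithm expresses that the probabilities and costs
of the auxiliary MDP are hitting probabilities and expected costs. It states this without any
measure, by testing against subharmonic functions (`Valid`), in a form that is preserved by unions
of partial strategies, and it records that every state keeps an action contained in `D`. At the end,
Dynkin's formula turns it into the description of the probabilities and costs of the reduced MDP
(`Valid.nextSurProb_eq`, `Valid.cycleCost_eq`), and testing with `h` itself shows that `h` solves
the optimality equation of the reduced MDP with the same `V`.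

*Optimal strategies.* In the reduced MDP every state is a surveillance state, so the ACPC and ACPS
values agree. If a stationary strategy is optimal, its average cost is `V` from every state, and so
it has a Poisson equation with the constant `V` (`MDP.Stationary.exists_poisson`). Its solution,
extended to each cycle by the expected remaining cost, is a potential for the unwrapped strategy
(`MDP.unwrap`), which therefore attains `V` in `M` (`MDP.unwrap_acpc_le`).
-/

namespace ACPC

/-! ### The law of a process -/

section Law

variable {T : Type*} [Fintype T] [MeasurableSpace T] [MeasurableSingletonClass T]
  (step : (n : ℕ) → (Finset.Iic n → T) → PMF T) (t : T)

instance : IsProbabilityMeasure (pathLaw step t) := by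
  unfold pathLaw; infer_instance

theorem measurable_of_history {β : Type*} [MeasurableSpace β] {n : ℕ}
    (F : (Finset.Iic n → T) → β) : Measurable fun ρ : ℕ → T => F fun j => ρ j :=
  (measurable_of_countable F).comp (measurable_pi_lambda _ fun _ => measurable_pi_apply _)

/-- One-step conditioning. The next state, given the history, is integrated out. -/
theorem lintegral_pathLaw_succ (n : ℕ) (Φ : (Finset.Iic n → T) → T → ℝ≥0∞) :
    ∫⁻ ρ, Φ (fun j => ρ j) (ρ (n + 1)) ∂pathLaw step t =
      ∫⁻ ρ, ∑ y, step n (fun j => ρ j) y * Φ (fun j => ρ j) y ∂pathLaw step t := by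
  have key := Kernel.partialTraj_compProd_eq_map_traj (κ := stepKernel step) (X := fun _ => T)
    (Nat.zero_le n) (x₀ := fun _ => t)
  have hmeas : Measurable fun p : (Finset.Iic n → T) × T => Φ p.1 p.2 := measurable_of_countable _
  have h1 : ∫⁻ ρ, Φ (fun j => ρ j) (ρ (n + 1)) ∂pathLaw step t =
      ∫⁻ p, Φ p.1 p.2 ∂((pathLaw step t).map
        fun x : ℕ → T => (Preorder.frestrictLe n x, x (n + 1))) := by
    rw [lintegral_map hmeas (by fun_prop)]; rfl
  have h2 : ∀ F : (Finset.Iic n → T) → ℝ≥0∞, ∫⁻ ρ, F (fun j => ρ j) ∂pathLaw step t =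
      ∫⁻ h, F h ∂(Kernel.partialTraj (X := fun _ => T) (stepKernel step) 0 n (fun _ => t)) := by
    intro F
    rw [← Kernel.traj_map_frestrictLe_apply,
      lintegral_map (measurable_of_countable _) (by fun_prop)]
    rfl
  rw [h1]
  unfold pathLaw at *
  rw [← key, Measure.lintegral_compProd hmeas, h2 fun h => ∑ y, step n h y * Φ h y]
  refine lintegral_congr fun h => ?_
  change ∫⁻ y, Φ h y ∂(step n h).toMeasure = _
  rw [lintegral_fintype]
  refine Finset.sum_congr rfl fun y _ => ?_
  rw [PMF.toMeasure_apply_singleton _ _ (measurableSet_singleton y), mul_comm]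

theorem lintegral_pathLaw_zero (Φ : T → ℝ≥0∞) :
    ∫⁻ ρ, Φ (ρ 0) ∂pathLaw step t = Φ t := by
  have h1 : ∫⁻ ρ, Φ (ρ 0) ∂pathLaw step t =
      ∫⁻ h, Φ (h ⟨0, by simp⟩)
        ∂(Kernel.partialTraj (X := fun _ => T) (stepKernel step) 0 0 (fun _ => t)) := by
    rw [← Kernel.traj_map_frestrictLe_apply,
      lintegral_map (measurable_of_countable _) (by fun_prop)]
    rfl
  rw [h1, Kernel.partialTraj_self, Kernel.id_apply, lintegral_dirac' _ (measurable_of_countable _)]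

end Law

/-! ### First return times -/

section FirstPassage

variable {T : Type*} (B : Set T)

open Classical in
/-- The indicator of the event that `B` is not visited at the times `1, …, n`. -/
noncomputable def avoid (n : ℕ) (h : Finset.Iic n → T) : ℝ≥0∞ :=
  if ∀ j : Finset.Iic n, 1 ≤ j.1 → h j ∉ B then 1 else 0

/-- For a function that vanishes on `B`, the last time need not avoid `B`. -/
theorem avoid_succ (n : ℕ) (ρ : ℕ → T) {f : T → ℝ≥0∞} (hf : ∀ x ∈ B, f x = 0) :
    avoid B (n + 1) (fun j => ρ j) * f (ρ (n + 1)) = avoid B n (fun j => ρ j) * f (ρ (n + 1)) := by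
  unfold avoid
  by_cases h : ρ (n + 1) ∈ B
  · simp [hf _ h]
  · congr 2
    refine propext ⟨fun H j hj => H ⟨j.1, ?_⟩ hj, fun H j hj => ?_⟩
    · have := Finset.mem_Iic.1 j.2
      exact Finset.mem_Iic.2 (by lia)
    · rcases (Finset.mem_Iic.1 j.2).lt_or_eq with hlt | heq
      · exact H ⟨j.1, Finset.mem_Iic.2 (by lia)⟩ hj
      · change ρ j.1 ∉ B
        rwa [heq]

variable [Fintype T] [MeasurableSpace T] [MeasurableSingletonClass T] (κ : T → PMF T) (t : T)

/-- Dynkin's formula up to the first return to `B`, for a solution `f` of the equation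
`f = r + κ f` off `B` that vanishes on `B`. -/
theorem dynkin {r f : T → ℝ≥0∞} (hB : ∀ x ∈ B, f x = 0)
    (hf : ∀ x ∉ B, f x = r x + ∑ y, κ x y * f y) (n : ℕ) :
    r t + ∑ y, κ t y * f y =
      ∑ i ∈ Finset.range (n + 1),
        ∫⁻ ρ, avoid B i (fun j => ρ j) * r (ρ i) ∂pathLaw (fun _ h => κ (last h)) t +
      ∫⁻ ρ, avoid B (n + 1) (fun j => ρ j) * f (ρ (n + 1)) ∂pathLaw (fun _ h => κ (last h)) t := by
  have hstep : ∀ n, ∫⁻ ρ, avoid B (n + 1) (fun j => ρ j) * f (ρ (n + 1))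
        ∂pathLaw (fun _ h => κ (last h)) t =
      ∫⁻ ρ, avoid B n (fun j => ρ j) * ∑ y, κ (ρ n) y * f y
        ∂pathLaw (fun _ h => κ (last h)) t := by
    intro n
    simp_rw [avoid_succ B n _ hB]
    rw [lintegral_pathLaw_succ (fun _ h => κ (last h)) t n (fun h y => avoid B n h * f y)]
    refine lintegral_congr fun ρ => ?_
    rw [Finset.mul_sum]
    refine Finset.sum_congr rfl fun y _ => ?_
    change κ (ρ n) y * _ = _
    ring
  induction n with
  | zero =>
    have h1 : ∀ ρ : ℕ → T, avoid B 0 (fun j => ρ j) = 1 := by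
      intro ρ
      unfold avoid
      rw [if_pos]
      intro j hj
      have := Finset.mem_Iic.1 j.2
      lia
    rw [hstep]
    simp only [h1, one_mul, zero_add, Finset.sum_range_one]
    rw [lintegral_pathLaw_zero _ _ r,
      lintegral_pathLaw_zero _ _ (fun x => ∑ y, κ x y * f y)]
  | succ n ih =>
    rw [ih, Finset.sum_range_succ _ (n + 1), add_assoc, hstep (n + 1), ← lintegral_add_left]
    · congr 1
      refine lintegral_congr fun ρ => ?_
      rw [← mul_add]
      unfold avoid
      split_ifs with h
      · rw [hf (ρ (n + 1)) (h ⟨n + 1, Finset.mem_Iic.2 le_rfl⟩ (by simp))]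
      · simp
    · exact measurable_of_history (fun h : Finset.Iic (n + 1) → T => avoid B (n + 1) h * r (last h))

/-- The expected sum of `r` until the first return to `B`. The finite solution `ℓ` of the equation
`ℓ = e + κ ℓ`, where `e ≥ 1` on the support of `f`, shows that the expected time spent in this
support is finite, so that the remainder in Dynkin's formula vanishes in the limit. -/
theorem tsum_dynkin {r f ℓ e : T → ℝ≥0∞} (hB : ∀ x ∈ B, f x = 0)
    (hf : ∀ x ∉ B, f x = r x + ∑ y, κ x y * f y) (hfe : ∀ x, f x ≠ 0 → 1 ≤ e x)
    (hfin : ∀ x, f x ≠ ∞)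
    (hBℓ : ∀ x ∈ B, ℓ x = 0) (hℓ : ∀ x ∉ B, ℓ x = e x + ∑ y, κ x y * ℓ y) (hℓfin : ∀ x, ℓ x ≠ ∞)
    (het : e t ≠ ∞) :
    ∑' i, ∫⁻ ρ, avoid B i (fun j => ρ j) * r (ρ i) ∂pathLaw (fun _ h => κ (last h)) t =
      r t + ∑ y, κ t y * f y := by
  set μ := pathLaw (fun _ h => κ (last h)) t
  obtain ⟨c, hc, hfc⟩ : ∃ c : ℝ≥0∞, c ≠ ∞ ∧ ∀ x, f x ≤ c := by
    refine ⟨∑ x, f x, ENNReal.sum_ne_top.2 fun x _ => hfin x, fun x => ?_⟩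
    exact Finset.single_le_sum (fun _ _ => bot_le) (Finset.mem_univ x)
  have hle : ∀ n, ∑ i ∈ Finset.range n, ∫⁻ ρ, avoid B i (fun j => ρ j) * e (ρ i) ∂μ ≤
      e t + ∑ y, κ t y * ℓ y := fun n => by
    rw [dynkin B κ t hBℓ hℓ n, Finset.sum_range_succ]
    exact le_add_right le_self_add
  have hsum : ∑' i, ∫⁻ ρ, avoid B i (fun j => ρ j) * e (ρ i) ∂μ ≠ ∞ := by
    refine ne_top_of_le_ne_top ?_ (ENNReal.tsum_le_of_sum_range_le hle)
    exact ENNReal.add_ne_top.2 ⟨het, ENNReal.sum_ne_top.2 fun y _ =>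
      ENNReal.mul_ne_top (PMF.apply_ne_top _ _) (hℓfin y)⟩
  have hlim := ENNReal.tendsto_atTop_zero_of_tsum_ne_top hsum
  have hb : Tendsto (fun n => ∫⁻ ρ, avoid B (n + 1) (fun j => ρ j) * f (ρ (n + 1)) ∂μ) atTop
      (nhds 0) := by
    have h1 := (ENNReal.Tendsto.const_mul (a := c) hlim (Or.inr hc)).comp (tendsto_add_atTop_nat 1)
    rw [mul_zero] at h1
    refine tendsto_of_tendsto_of_tendsto_of_le_of_le tendsto_const_nhds h1 (fun _ => bot_le) ?_
    intro n
    simp only [Function.comp]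
    rw [← lintegral_const_mul]
    · refine lintegral_mono fun ρ => ?_
      rw [mul_left_comm]
      gcongr
      by_cases h0 : f (ρ (n + 1)) = 0
      · simp [h0]
      · calc _ ≤ c * 1 := by rw [mul_one]; exact hfc _
          _ ≤ _ := by gcongr; exact hfe _ h0
    · exact measurable_of_history
        (fun h : Finset.Iic (n + 1) → T => avoid B (n + 1) h * e (last h))
  have h2 := (ENNReal.tendsto_nat_tsum fun i =>
    ∫⁻ ρ, avoid B i (fun j => ρ j) * r (ρ i) ∂μ).comp (tendsto_add_atTop_nat 1)
  have h3 := h2.add hb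
  rw [add_zero] at h3
  refine tendsto_nhds_unique h3 (tendsto_const_nhds.congr fun n => ?_)
  exact dynkin B κ t hB hf n

end FirstPassage

/-! ### Expectations along runs -/

/-- The run that follows `ρ` up to the time `n` and stays in `ρ n` from then on. A function of runs
depends on the history up to `n` only if it does not distinguish `ρ` from `freeze n ρ`. -/
def freeze {T : Type*} (n : ℕ) (ρ : ℕ → T) : ℕ → T := fun j => ρ (min j n)

section Freeze

variable {T : Type*}

theorem freeze_apply {n i : ℕ} (h : i ≤ n) (ρ : ℕ → T) : freeze n ρ i = ρ i := by
  simp [freeze, h]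

theorem freeze_restrict {n i : ℕ} (h : i ≤ n) (ρ : ℕ → T) :
    (fun j : Finset.Iic i => freeze n ρ j) = fun j : Finset.Iic i => ρ j :=
  funext fun j => freeze_apply ((Finset.mem_Iic.1 j.2).trans h) ρ

theorem measurable_of_freeze [Finite T] [MeasurableSpace T] [MeasurableSingletonClass T]
    {β : Type*} [MeasurableSpace β] (n : ℕ) {F : (ℕ → T) → β} (hF : ∀ ρ, F (freeze n ρ) = F ρ) :
    Measurable F := by
  have := Fintype.ofFinite T
  have h : F = fun ρ => (fun h : Finset.Iic n → T =>
      F fun j => h ⟨min j n, Finset.mem_Iic.2 (min_le_right _ _)⟩) (fun j => ρ j) :=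
    funext fun ρ => (hF ρ).symm
  rw [h]
  exact measurable_of_history (n := n) fun h : Finset.Iic n → T =>
      F fun j => h ⟨min j n, Finset.mem_Iic.2 (min_le_right _ _)⟩

end Freeze

namespace MDP

variable {S A AP : Type*} [Fintype S] (M : MDP S A AP)

variable {M} in
theorem mem_sur {π : AP} {s : S} : s ∈ M.sur π ↔ π ∈ M.L s := by simp [sur]

/-- The expected value of `f` after the action `a` in the state `s`. -/
noncomputable def mean (s : S) (a : A) (f : S → ℝ) : ℝ := ∑ y, M.P s a y * f y

open Classical in
/-- The indicator of the surveillance states. -/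
noncomputable def ind (π : AP) (s : S) : ℝ := if s ∈ M.sur π then 1 else 0

theorem ind_of_mem {π : AP} {s : S} (h : s ∈ M.sur π) : M.ind π s = 1 := by simp [ind, h]

theorem ind_of_notMem {π : AP} {s : S} (h : s ∉ M.sur π) : M.ind π s = 0 := by simp [ind, h]

theorem ind_nonneg (π : AP) (s : S) : 0 ≤ M.ind π s := by
  unfold ind; split_ifs <;> norm_num

theorem mean_const {s : S} {a : A} (h : a ∈ M.enabled s) (c : ℝ) : M.mean s a (fun _ => c) = c := by
  have h' : ∑ y, M.P s a y = 1 := h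
  rw [mean, ← Finset.sum_mul, h', one_mul]

theorem mean_add (s : S) (a : A) (f f' : S → ℝ) :
    M.mean s a (fun y => f y + f' y) = M.mean s a f + M.mean s a f' := by
  simp [mean, mul_add, Finset.sum_add_distrib]

theorem mean_mul (s : S) (a : A) (c : ℝ) (f : S → ℝ) :
    M.mean s a (fun y => c * f y) = c * M.mean s a f := by
  simp only [mean, Finset.mul_sum]
  exact Finset.sum_congr rfl fun y _ => by ring

theorem mean_neg (s : S) (a : A) (f : S → ℝ) :
    M.mean s a (fun y => - f y) = - M.mean s a f := by
  simp [mean]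

theorem mean_mono (s : S) (a : A) {f f' : S → ℝ} (h : ∀ y, f y ≤ f' y) :
    M.mean s a f ≤ M.mean s a f' :=
  Finset.sum_le_sum fun y _ => mul_le_mul_of_nonneg_left (h y) (M.P_nonneg _ _ _)

theorem mean_congr {s : S} {a : A} {f f' : S → ℝ} (h : ∀ y, 0 < M.P s a y → f y = f' y) :
    M.mean s a f = M.mean s a f' :=
  Finset.sum_congr rfl fun y _ => by
    rcases (M.P_nonneg s a y).eq_or_lt with h0 | h0
    · rw [← h0]; simp
    · rw [h y h0]

theorem mean_nonneg (s : S) (a : A) {f : S → ℝ} (h : ∀ y, 0 ≤ f y) : 0 ≤ M.mean s a f :=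
  Finset.sum_nonneg fun y _ => mul_nonneg (M.P_nonneg _ _ _) (h y)

/-- The sum of the stage costs `γ` at the times `0, …, n - 1`. -/
noncomputable def total {M : MDP S A AP} (γ : S → A → ℝ) (C : M.Strategy) (n : ℕ) (ρ : ℕ → S) :
    ℝ :=
  ∑ i ∈ Finset.range n, γ (ρ i) (C.act i fun j => ρ j)

/-- The number of visits to surveillance states at the times `0, …, n - 1`. -/
noncomputable def visits (π : AP) (n : ℕ) (ρ : ℕ → S) : ℝ := ∑ i ∈ Finset.range n, M.ind π (ρ i)

variable {M}

theorem cost_eq_total (C : M.Strategy) (n : ℕ) (ρ : ℕ → S) :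
    M.cost C n ρ = total M.g C (n + 1) ρ := rfl

theorem cycles_eq_visits (π : AP) (n : ℕ) (ρ : ℕ → S) :
    (M.cycles π n ρ : ℝ) = M.visits π (n + 1) ρ + 1 := by
  classical
  simp only [cycles, visits, ind]
  rw [Finset.card_filter]
  push_cast
  congr 1

theorem visits_nonneg (π : AP) (n : ℕ) (ρ : ℕ → S) : 0 ≤ M.visits π n ρ :=
  Finset.sum_nonneg fun _ _ => M.ind_nonneg _ _

theorem total_freeze (γ : S → A → ℝ) (C : M.Strategy) {n k : ℕ} (h : n ≤ k + 1) (ρ : ℕ → S) :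
    total γ C n (freeze k ρ) = total γ C n ρ :=
  Finset.sum_congr rfl fun i hi => by
    have := Finset.mem_range.1 hi
    rw [freeze_restrict (by lia), freeze_apply (by lia)]

theorem visits_freeze (π : AP) {n k : ℕ} (h : n ≤ k + 1) (ρ : ℕ → S) :
    M.visits π n (freeze k ρ) = M.visits π n ρ :=
  Finset.sum_congr rfl fun i hi => by
    have := Finset.mem_range.1 hi
    rw [freeze_apply (by lia)]

section

variable [MeasurableSpace S] [MeasurableSingletonClass S]

instance (C : M.Strategy) (s : S) : IsProbabilityMeasure (M.law C s) := by
  unfold law; infer_instance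

theorem measurable_total (γ : S → A → ℝ) (C : M.Strategy) (n : ℕ) :
    Measurable (total γ C n) :=
  measurable_of_freeze n fun ρ => total_freeze γ C n.le_succ ρ

theorem measurable_visits (π : AP) (n : ℕ) : Measurable (M.visits π n) :=
  measurable_of_freeze n fun ρ => visits_freeze π n.le_succ ρ

/-- One-step conditioning for functions `Φ ρ` that depend on the history up to `n` only. -/
theorem lintegral_law_succ (C : M.Strategy) (s : S) (n : ℕ) {Φ : (ℕ → S) → S → ℝ}
    (hΦ : ∀ ρ y, 0 ≤ Φ ρ y) (hfr : ∀ ρ, Φ (freeze n ρ) = Φ ρ) :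
    ∫⁻ ρ, ENNReal.ofReal (Φ ρ (ρ (n + 1))) ∂M.law C s =
      ∫⁻ ρ, ENNReal.ofReal (M.mean (ρ n) (C.act n fun j => ρ j) (Φ ρ)) ∂M.law C s := by
  have h := lintegral_pathLaw_succ (fun n h => M.next (last h) (C.act n h) (C.mem n h)) s n
    (fun h y => ENNReal.ofReal
      (Φ (fun j => h ⟨min j n, Finset.mem_Iic.2 (min_le_right _ _)⟩) y))
  have hfr' : ∀ ρ : ℕ → S, Φ (fun j => ρ (min j n)) = Φ ρ := hfr
  simp only [hfr'] at h
  unfold law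
  rw [h]
  refine lintegral_congr fun ρ => ?_
  rw [mean, ENNReal.ofReal_sum_of_nonneg fun y _ => mul_nonneg (M.P_nonneg _ _ _) (hΦ _ _)]
  refine Finset.sum_congr rfl fun y _ => ?_
  rw [ENNReal.ofReal_mul (M.P_nonneg _ _ _)]
  rfl

theorem lintegral_law_zero (C : M.Strategy) (s : S) (Φ : S → ℝ≥0∞) :
    ∫⁻ ρ, Φ (ρ 0) ∂M.law C s = Φ s :=
  lintegral_pathLaw_zero _ _ _

/-! ### Exponential moments -/

/-- A multiplicative supermartingale. The strategy carries a mode `m`, updated by `Δ`, on which the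
potential `u` may depend. -/
theorem lintegral_exp_le {X : Type*} {C : M.Strategy} {m : ∀ n, (Finset.Iic n → S) → X}
    {Δ : X → S → X}
    (hm : ∀ n (ρ : ℕ → S), m (n + 1) (fun j => ρ j) = Δ (m n fun j => ρ j) (ρ (n + 1)))
    {u : X → S → ℝ} (hu : ∀ x s, 0 ≤ u x s) {c : ℝ} (hc : ∀ x s, u x s ≤ c)
    {r : ∀ n, (Finset.Iic n → S) → ℝ}
    (hstep : ∀ n h, M.mean (last h) (C.act n h) (fun y => u (Δ (m n h) y) y) * Real.exp (r n h) ≤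
      u (m n h) (last h)) (s : S) (n : ℕ) :
    ∫⁻ ρ, ENNReal.ofReal (u (m n fun j => ρ j) (ρ n) *
      Real.exp (∑ i ∈ Finset.range n, r i fun j => ρ j)) ∂M.law C s ≤ ENNReal.ofReal c := by
  induction n with
  | zero =>
    calc _ ≤ ∫⁻ ρ, ENNReal.ofReal c ∂M.law C s :=
          lintegral_mono fun ρ => ENNReal.ofReal_le_ofReal (by simpa using hc _ _)
      _ = _ := by simp
  | succ n ih =>
    refine le_trans ?_ ih
    simp only [hm]
    rw [lintegral_law_succ C s n (Φ := fun ρ y => u (Δ (m n fun j => ρ j) y) y *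
      Real.exp (∑ i ∈ Finset.range (n + 1), r i fun j => ρ j))]
    · refine lintegral_mono fun ρ => ENNReal.ofReal_le_ofReal ?_
      have h1 := hstep n (fun j => ρ j)
      have h2 : M.mean (ρ n) (C.act n fun j => ρ j) (fun y => u (Δ (m n fun j => ρ j) y) y *
          Real.exp (∑ i ∈ Finset.range (n + 1), r i fun j => ρ j)) =
          M.mean (ρ n) (C.act n fun j => ρ j) (fun y => u (Δ (m n fun j => ρ j) y) y) *
            Real.exp (r n fun j => ρ j) * Real.exp (∑ i ∈ Finset.range n, r i fun j => ρ j) := by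
        rw [Finset.sum_range_succ, add_comm, Real.exp_add, mul_assoc, mean, mean, Finset.sum_mul]
        exact Finset.sum_congr rfl fun y _ => by ring
      rw [h2]
      exact mul_le_mul_of_nonneg_right h1 (Real.exp_pos _).le
    · exact fun ρ y => mul_nonneg (hu _ _) (Real.exp_pos _).le
    · intro ρ
      have h1 : ∑ i ∈ Finset.range (n + 1), r i (fun j => freeze n ρ j) =
          ∑ i ∈ Finset.range (n + 1), r i (fun j => ρ j) :=
        Finset.sum_congr rfl fun i hi => by
          rw [freeze_restrict (Finset.mem_range_succ_iff.1 hi)]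
      funext y
      simp only [h1, freeze_restrict le_rfl]

/-- If `h` is a subsolution of the optimality equation with value `V`, then `1 - lam h` is a
potential for which `V ♯ₙ - (1 + ε) gₙ` has a bounded exponential moment under every strategy. -/
theorem exists_exp_moment_lower {π : AP} {γ : S → A → ℝ} (hγ : ∀ s a, 0 ≤ γ s a) {V : ℝ}
    (hV : 0 ≤ V) {h : S → ℝ} (h0 : ∀ s, 0 ≤ h s)
    (hh : ∀ s, ∀ a ∈ M.enabled s, h s + V * M.ind π s ≤ γ s a + M.mean s a h)
    {ε : ℝ} (hε : 0 < ε) :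
    ∃ lam > 0, ∃ c, ∀ (C : M.Strategy) (s : S) (n : ℕ),
      ∫⁻ ρ, ENNReal.ofReal (Real.exp
        (lam * (V * M.visits π n ρ - (1 + ε) * total γ C n ρ))) ∂M.law C s ≤ ENNReal.ofReal c := by
  obtain ⟨K, hK0, hK⟩ : ∃ K : ℝ, 0 ≤ K ∧ ∀ s, h s ≤ K :=
    ⟨∑ s, h s, Finset.sum_nonneg fun s _ => h0 s, fun s =>
      Finset.single_le_sum (fun s _ => h0 s) (Finset.mem_univ s)⟩
  -- `lam` is chosen so that `(1 - lam K) (1 + ε) ≥ 1`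
  set lam : ℝ := ε / ((1 + ε) * (K + 1)) with hlam
  have hlam0 : 0 < lam := by positivity
  have hlamK : 1 ≤ (1 - lam * K) * (1 + ε) := by
    have h1 : lam * (K + 1) * (1 + ε) = ε := by rw [hlam]; field_simp
    nlinarith
  refine ⟨lam, hlam0, 1 + ε, fun C s n => ?_⟩
  set u : Unit → S → ℝ := fun _ s => (1 - lam * h s) * (1 + ε) with hu
  have hu1 : ∀ x s, 1 ≤ u x s := fun _ s => hlamK.trans (by
    simp only [hu]; gcongr; exact hK s)
  have hu2 : ∀ x s, u x s ≤ 1 + ε := fun _ s => by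
    have := mul_nonneg hlam0.le (h0 s)
    simp only [hu]
    nlinarith
  have key := lintegral_exp_le (M := M) (C := C) (m := fun _ _ => ()) (Δ := fun _ _ => ())
    (fun _ _ => rfl) (u := u) (fun x s => zero_le_one.trans (hu1 x s)) hu2
    (r := fun n h => lam * (V * M.ind π (last h) - (1 + ε) * γ (last h) (C.act n h))) (by
      intro n k
      have h1 := hh (last k) _ (C.mem n k)
      have h2 : M.mean (last k) (C.act n k) (fun y => u () y) =
          (1 - lam * M.mean (last k) (C.act n k) h) * (1 + ε) := by
        have : (fun y => u () y) = fun y => (1 + ε) + (-(lam * (1 + ε))) * h y := by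
          funext y; simp only [hu]; ring
        rw [this, mean_add, mean_mul, mean_const _ (C.mem n k)]
        ring
      rw [h2]
      set x := lam * (V * M.ind π (last k) - (1 + ε) * γ (last k) (C.act n k)) with hx
      have h3 : u () (last k) * (1 - x) ≤ u () (last k) * Real.exp (-x) :=
        mul_le_mul_of_nonneg_left (by linarith [Real.add_one_le_exp (-x)])
          (zero_le_one.trans (hu1 () _))
      have h4 : (1 - lam * M.mean (last k) (C.act n k) h) * (1 + ε) ≤ u () (last k) * (1 - x) := by
        have ha := mul_le_mul_of_nonneg_right (hu1 () (last k)) (hγ (last k) (C.act n k))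
        have hb := mul_le_mul_of_nonneg_right (hu2 () (last k))
          (mul_nonneg hV (M.ind_nonneg π (last k)))
        have hc : lam * (1 + ε) * (h (last k) + V * M.ind π (last k)) ≤
            lam * (1 + ε) * (γ (last k) (C.act n k) + M.mean (last k) (C.act n k) h) :=
          mul_le_mul_of_nonneg_left h1 (by positivity)
        have hd := mul_le_mul_of_nonneg_left hb hlam0.le
        have he := mul_le_mul_of_nonneg_left ha (mul_nonneg hlam0.le (by linarith : 0 ≤ 1 + ε))
        have hf : u () (last k) = (1 - lam * h (last k)) * (1 + ε) := rfl
        rw [hx]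
        nlinarith
      calc _ ≤ u () (last k) * Real.exp (-x) * Real.exp x :=
            mul_le_mul_of_nonneg_right (h4.trans h3) (Real.exp_pos _).le
        _ = _ := by rw [mul_assoc, ← Real.exp_add]; simp) s n
  refine le_trans (lintegral_mono fun ρ => ENNReal.ofReal_le_ofReal ?_) key
  have h5 : ∑ i ∈ Finset.range n, lam * (V * M.ind π (last fun j : Finset.Iic i => ρ j) -
      (1 + ε) * γ (last fun j : Finset.Iic i => ρ j) (C.act i fun j => ρ j)) =
      lam * (V * M.visits π n ρ - (1 + ε) * total γ C n ρ) := by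
    rw [← Finset.mul_sum, Finset.sum_sub_distrib, ← Finset.mul_sum, ← Finset.mul_sum]
    rfl
  rw [h5]
  exact le_mul_of_one_le_left (Real.exp_pos _).le (hu1 () _)

/-- If `H` is a supersolution of the evaluation equation of a strategy with value `V`, then
`1 + lam H` is a potential for which `(1 - ε) gₙ - V ♯ₙ` has a bounded exponential moment. -/
theorem exists_exp_moment_upper {π : AP} {γ : S → A → ℝ} (hγ : ∀ s a, 0 ≤ γ s a) {V : ℝ}
    (hV : 0 ≤ V) {X : Type*} {C : M.Strategy} {m : ∀ n, (Finset.Iic n → S) → X} {Δ : X → S → X}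
    (hm : ∀ n (ρ : ℕ → S), m (n + 1) (fun j => ρ j) = Δ (m n fun j => ρ j) (ρ (n + 1)))
    {H : X → S → ℝ} (H0 : ∀ x s, 0 ≤ H x s) {K : ℝ} (hK : ∀ x s, H x s ≤ K)
    (hH : ∀ n h, γ (last h) (C.act n h) + M.mean (last h) (C.act n h) (fun y => H (Δ (m n h) y) y) ≤
      H (m n h) (last h) + V * M.ind π (last h))
    {ε : ℝ} (hε : 0 < ε) (hε1 : ε < 1) :
    ∃ lam > 0, ∃ c, ∀ (s : S) (n : ℕ),
      ∫⁻ ρ, ENNReal.ofReal (Real.exp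
        (lam * ((1 - ε) * total γ C n ρ - V * M.visits π n ρ))) ∂M.law C s ≤ ENNReal.ofReal c := by
  rcases isEmpty_or_nonempty S with hS | ⟨⟨s₀⟩⟩
  · exact ⟨1, one_pos, 0, fun s => hS.elim s⟩
  have hK0 : 0 ≤ K := (H0 (m 0 fun _ => s₀) s₀).trans (hK _ _)
  -- `lam` is chosen so that `(1 + lam K) (1 - ε) ≤ 1`
  set lam : ℝ := ε / (K + 1) with hlam
  have hlam0 : 0 < lam := by positivity
  have hlamK : (1 + lam * K) * (1 - ε) ≤ 1 := by
    have h1 : lam * (K + 1) = ε := by rw [hlam]; field_simp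
    nlinarith
  refine ⟨lam, hlam0, 1 + lam * K, fun s n => ?_⟩
  set u : X → S → ℝ := fun x s => 1 + lam * H x s with hu
  have hu1 : ∀ x s, 1 ≤ u x s := fun x s => by
    have := mul_nonneg hlam0.le (H0 x s)
    simp only [hu]; linarith
  have hu2 : ∀ x s, u x s ≤ 1 + lam * K := fun x s => by
    have := mul_le_mul_of_nonneg_left (hK x s) hlam0.le
    simp only [hu]; linarith
  have key := lintegral_exp_le (M := M) (C := C) hm (u := u)
    (fun x s => zero_le_one.trans (hu1 x s)) hu2
    (r := fun n h => lam * ((1 - ε) * γ (last h) (C.act n h) - V * M.ind π (last h))) (by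
      intro n k
      have h1 := mul_le_mul_of_nonneg_left (hH n k) hlam0.le
      have h2 : M.mean (last k) (C.act n k) (fun y => u (Δ (m n k) y) y) =
          1 + lam * M.mean (last k) (C.act n k) (fun y => H (Δ (m n k) y) y) := by
        simp only [hu]
        rw [mean_add, mean_mul, mean_const _ (C.mem n k)]
      rw [h2]
      set x := lam * ((1 - ε) * γ (last k) (C.act n k) - V * M.ind π (last k)) with hx
      set U := u (m n k) (last k) with hU
      have h3 : U * (1 - x) ≤ U * Real.exp (-x) :=
        mul_le_mul_of_nonneg_left (by linarith [Real.add_one_le_exp (-x)])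
          (zero_le_one.trans (hu1 _ _))
      have h4 : 1 + lam * M.mean (last k) (C.act n k) (fun y => H (Δ (m n k) y) y) ≤
          U * (1 - x) := by
        have ha : U * (1 - ε) ≤ 1 :=
          (mul_le_mul_of_nonneg_right (hu2 _ _) (by linarith)).trans hlamK
        have ha' := mul_le_mul_of_nonneg_right ha (hγ (last k) (C.act n k))
        have hb := mul_le_mul_of_nonneg_right (hu1 (m n k) (last k))
          (mul_nonneg hV (M.ind_nonneg π (last k)))
        have hd := mul_le_mul_of_nonneg_left hb hlam0.le
        have he := mul_le_mul_of_nonneg_left ha' hlam0.le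
        have hf : U = 1 + lam * H (m n k) (last k) := rfl
        rw [← hU] at hd
        rw [hx]
        nlinarith
      calc _ ≤ U * Real.exp (-x) * Real.exp x :=
            mul_le_mul_of_nonneg_right (h4.trans h3) (Real.exp_pos _).le
        _ = _ := by rw [mul_assoc, ← Real.exp_add]; simp) s n
  refine le_trans (lintegral_mono fun ρ => ENNReal.ofReal_le_ofReal ?_) key
  have h5 : ∑ i ∈ Finset.range n, lam * ((1 - ε) * γ (last fun j : Finset.Iic i => ρ j)
      (C.act i fun j => ρ j) - V * M.ind π (last fun j : Finset.Iic i => ρ j)) =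
      lam * ((1 - ε) * total γ C n ρ - V * M.visits π n ρ) := by
    rw [← Finset.mul_sum, Finset.sum_sub_distrib, ← Finset.mul_sum, ← Finset.mul_sum]
    rfl
  rw [h5]
  exact le_mul_of_one_le_left (Real.exp_pos _).le (hu1 _ _)

end

end MDP

/-! ### Bounds for the ACPC value -/

/-- Chernoff's bound, for a sequence of variables with a common bound on an exponential moment. -/
theorem exists_forall_measure_ge_le {Ω ι : Type*} [MeasurableSpace Ω] {μ : Measure Ω}
    {X : ι → Ω → ℝ} (hX : ∀ n, Measurable (X n)) {lam c : ℝ} (hlam : 0 < lam)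
    (h : ∀ n, ∫⁻ ω, ENNReal.ofReal (Real.exp (lam * X n ω)) ∂μ ≤ ENNReal.ofReal c)
    {δ : ℝ≥0∞} (hδ : 0 < δ) : ∃ K : ℝ, ∀ n, μ {ω | K ≤ X n ω} ≤ δ := by
  have hb : ∀ K n, μ {ω | K ≤ X n ω} ≤ ENNReal.ofReal (c * Real.exp (-(lam * K))) := by
    intro K n
    have h1 := mul_meas_ge_le_lintegral₀ (μ := μ)
      (f := fun ω => ENNReal.ofReal (Real.exp (lam * X n ω)))
      (by have := hX n; fun_prop) (ENNReal.ofReal (Real.exp (lam * K)))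
    have h2 : {ω | K ≤ X n ω} ⊆
        {ω | ENNReal.ofReal (Real.exp (lam * K)) ≤ ENNReal.ofReal (Real.exp (lam * X n ω))} := by
      intro ω hω
      exact ENNReal.ofReal_le_ofReal (Real.exp_le_exp.2 (mul_le_mul_of_nonneg_left hω hlam.le))
    have h3 := (mul_le_mul_right (measure_mono h2) _).trans (h1.trans (h n))
    have h4 : μ {ω | K ≤ X n ω} = ENNReal.ofReal (Real.exp (-(lam * K))) *
        (ENNReal.ofReal (Real.exp (lam * K)) * μ {ω | K ≤ X n ω}) := by
      rw [← mul_assoc, ← ENNReal.ofReal_mul (Real.exp_pos _).le, ← Real.exp_add]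
      simp
    rw [h4, mul_comm c, ENNReal.ofReal_mul (Real.exp_pos _).le]
    exact mul_le_mul_right h3 _
  have hlim : Tendsto (fun K : ℝ => ENNReal.ofReal (c * Real.exp (-(lam * K)))) atTop (nhds 0) := by
    rw [← ENNReal.ofReal_zero, ← mul_zero c]
    refine ENNReal.tendsto_ofReal (Tendsto.const_mul c ?_)
    exact Real.tendsto_exp_neg_atTop_nhds_zero.comp (tendsto_id.const_mul_atTop hlam)
  obtain ⟨K, hK⟩ := ((ENNReal.tendsto_nhds_zero.1 hlim) δ hδ).exists
  exact ⟨K, fun n => (hb K n).trans hK⟩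

namespace MDP

variable {S A AP : Type*} [Fintype S] {M : MDP S A AP} {π : AP}

theorem visits_mono (ρ : ℕ → S) : Monotone fun n => M.visits π n ρ := fun _ _ h =>
  Finset.sum_le_sum_of_subset_of_nonneg (Finset.range_mono h) fun _ _ _ => M.ind_nonneg _ _

theorem visits_succ (n : ℕ) (ρ : ℕ → S) :
    M.visits π (n + 1) ρ = M.visits π n ρ + M.ind π (ρ n) := Finset.sum_range_succ _ _

theorem exists_le_visits {ρ : ℕ → S} (h : ∃ᶠ n in atTop, ρ n ∈ M.sur π) (m : ℕ) :
    ∃ n, (m : ℝ) ≤ M.visits π n ρ := by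
  induction m with
  | zero => exact ⟨0, by simp [visits]⟩
  | succ m ih =>
    obtain ⟨n, hn⟩ := ih
    obtain ⟨k, hk, hkB⟩ := frequently_atTop.1 h n
    refine ⟨k + 1, ?_⟩
    rw [visits_succ, ind_of_mem _ hkB]
    push_cast
    linarith [visits_mono (M := M) (π := π) ρ hk]

theorem exists_visits_le {ρ : ℕ → S} (h : ¬ ∃ᶠ n in atTop, ρ n ∈ M.sur π) :
    ∃ m : ℕ, ∀ n, M.visits π n ρ < m := by
  obtain ⟨N, hN⟩ := eventually_atTop.1 (not_frequently.1 h)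
  have h1 : ∀ n, M.visits π n ρ ≤ M.visits π N ρ := by
    intro n
    rcases le_total n N with hn | hn
    · exact visits_mono ρ hn
    · induction n, hn using Nat.le_induction with
      | base => exact le_rfl
      | succ n hn ih =>
        rw [visits_succ, ind_of_notMem _ (hN n hn), add_zero]
        exact ih
  obtain ⟨m, hm⟩ := exists_nat_gt (M.visits π N ρ)
  exact ⟨m, fun n => (h1 n).trans_lt hm⟩

section

variable [MeasurableSpace S] [MeasurableSingletonClass S]

theorem measurableSet_visits_lt (n : ℕ) (m : ℝ) :
    MeasurableSet {ρ : ℕ → S | M.visits π n ρ < m} :=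
  measurableSet_lt (measurable_visits π n) measurable_const

theorem Surveils.tendsto {C : M.Strategy} {s : S} (h : M.Surveils π C s) (m : ℝ) :
    Tendsto (fun n => M.law C s {ρ | M.visits π n ρ < m}) atTop (nhds 0) := by
  have h1 := tendsto_measure_iInter_atTop (μ := M.law C s)
    (s := fun n => {ρ : ℕ → S | M.visits π n ρ < m})
    (fun n => (measurableSet_visits_lt n m).nullMeasurableSet)
    (fun n k hnk ρ hρ => (visits_mono ρ hnk).trans_lt hρ) ⟨0, measure_ne_top _ _⟩
  have h2 : M.law C s (⋂ n, {ρ | M.visits π n ρ < m}) = 0 := by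
    refine measure_mono_null (fun ρ hρ => ?_) h
    intro hfreq
    obtain ⟨k, hk⟩ := exists_nat_ge m
    obtain ⟨n, hn⟩ := exists_le_visits hfreq k
    have h3 : M.visits π n ρ < m := Set.mem_iInter.1 hρ n
    linarith
  rw [h2] at h1
  exact h1

theorem surveils_of_tendsto {C : M.Strategy} {s : S}
    (h : ∀ m : ℝ, Tendsto (fun n => M.law C s {ρ | M.visits π n ρ < m}) atTop (nhds 0)) :
    M.Surveils π C s := by
  have h1 : ∀ m : ℕ, M.law C s {ρ | ∀ n, M.visits π n ρ < m} = 0 := fun m =>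
    le_antisymm (ge_of_tendsto' (h m) fun n => measure_mono fun ρ hρ => hρ n) bot_le
  have h2 := measure_iUnion_null h1
  refine measure_mono_null (fun ρ hρ => ?_) h2
  obtain ⟨m, hm⟩ := exists_visits_le (M := M) (π := π) hρ
  exact Set.mem_iUnion.2 ⟨m, hm⟩

/-- The value of a subsolution of the optimality equation is a lower bound for the ACPC value of
every strategy under which the number of cycles or the cost diverges in probability. -/
theorem le_acpc {V : ℝ} (hV : 0 ≤ V) {h : S → ℝ} (h0 : ∀ s, 0 ≤ h s)
    (hh : ∀ s, ∀ a ∈ M.enabled s, h s + V * M.ind π s ≤ M.g s a + M.mean s a h)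
    {C : M.Strategy} {s : S}
    (hesc : ∀ m L : ℝ, Tendsto
      (fun n => M.law C s {ρ | M.visits π n ρ < m ∧ total M.g C n ρ < L}) atTop (nhds 0)) :
    ENNReal.ofReal V ≤ M.acpc π C s := by
  have key : ∀ x : ℝ, 0 < x → x < V → ENNReal.ofReal x ≤ M.acpc π C s := by
    intro x hx0 hxV
    set E : ℕ → Set (ℕ → S) := fun n => {ρ | total M.g C n ρ < x * (M.visits π n ρ + 1)} with hE
    have hEmeas : ∀ n, MeasurableSet (E n) := fun n =>
      measurableSet_lt (measurable_total _ _ _)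
        (((measurable_visits π n).add measurable_const).const_mul x)
    have hElim : Tendsto (fun n => M.law C s (E n)) atTop (nhds 0) := by
      -- `ε` leaves the gap `κ = V - (1 + ε) x > 0`
      set ε : ℝ := (V - x) / (2 * x) with hε
      have hε0 : 0 < ε := div_pos (by linarith) (by linarith)
      set κ : ℝ := (V - x) / 2 with hκ
      have hκ0 : 0 < κ := by rw [hκ]; linarith
      have hκε : (1 + ε) * x = V - κ := by rw [hε, hκ]; field_simp; ring
      obtain ⟨lam, hlam, c, hc⟩ := exists_exp_moment_lower (M := M) M.g_nonneg hV h0 hh hε0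
      rw [ENNReal.tendsto_nhds_zero]
      intro δ hδ
      have hδ2 : 0 < δ / 2 := ENNReal.half_pos hδ.ne'
      obtain ⟨K, hK⟩ := exists_forall_measure_ge_le (μ := M.law C s)
        (X := fun n ρ => V * M.visits π n ρ - (1 + ε) * total M.g C n ρ)
        (fun n => ((measurable_visits π n).const_mul V).sub
          ((measurable_total M.g C n).const_mul _)) hlam (fun n => hc C s n) hδ2
      set m : ℝ := (K + V) / κ with hm
      have hm' : κ * m = K + V := by rw [hm]; field_simp
      filter_upwards [ENNReal.tendsto_nhds_zero.1 (hesc (m - 1) (x * m)) (δ / 2) hδ2] with n hn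
      calc M.law C s (E n)
          ≤ M.law C s ({ρ | K ≤ V * M.visits π n ρ - (1 + ε) * total M.g C n ρ} ∪
              {ρ | M.visits π n ρ < m - 1 ∧ total M.g C n ρ < x * m}) := by
            refine measure_mono fun ρ hρ => ?_
            have hρ' : total M.g C n ρ < x * (M.visits π n ρ + 1) := hρ
            by_cases hv : M.visits π n ρ < m - 1
            · right
              exact ⟨hv, hρ'.trans_le (mul_le_mul_of_nonneg_left (by linarith) hx0.le)⟩
            · left
              have h1 := mul_le_mul_of_nonneg_left (not_lt.1 hv) hκ0.le
              have h2 := mul_lt_mul_of_pos_left hρ' (by linarith : (0 : ℝ) < 1 + ε)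
              rw [← mul_assoc, hκε] at h2
              simp only [Set.mem_ofPred_eq]
              nlinarith
        _ ≤ δ / 2 + δ / 2 := (measure_union_le _ _).trans (add_le_add (hK n) hn)
        _ = δ := ENNReal.add_halves δ
    have hlow : ∀ n, ENNReal.ofReal x * (1 - M.law C s (E (n + 1))) ≤
        ∫⁻ ρ, ENNReal.ofReal (M.cost C n ρ / M.cycles π n ρ) ∂M.law C s := by
      intro n
      have hf : Measurable fun ρ => ENNReal.ofReal (M.cost C n ρ / M.cycles π n ρ) := by
        simp only [cost_eq_total, cycles_eq_visits]
        exact ENNReal.measurable_ofReal.comp ((measurable_total _ _ _).div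
          ((measurable_visits π _).add measurable_const))
      refine le_trans ?_ (mul_meas_ge_le_lintegral₀ hf.aemeasurable (ENNReal.ofReal x))
      gcongr
      rw [← prob_compl_eq_one_sub (hEmeas _)]
      refine measure_mono fun ρ hρ => ENNReal.ofReal_le_ofReal ?_
      have := M.visits_nonneg π (n + 1) ρ
      rw [cost_eq_total, cycles_eq_visits, le_div_iff₀ (by linarith)]
      exact not_lt.1 hρ
    have hlim : Tendsto (fun n => ENNReal.ofReal x * (1 - M.law C s (E (n + 1)))) atTop
        (nhds (ENNReal.ofReal x)) := by
      have h1 := ENNReal.Tendsto.const_mul (a := ENNReal.ofReal x)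
        (ENNReal.Tendsto.sub (tendsto_const_nhds (x := (1 : ℝ≥0∞)))
          (hElim.comp (tendsto_add_atTop_nat 1)) (Or.inl ENNReal.one_ne_top))
        (Or.inr ENNReal.ofReal_ne_top)
      simpa using h1
    rw [← hlim.limsup_eq]
    exact limsup_le_limsup (Eventually.of_forall hlow)
  refine le_of_forall_lt fun c hc => ?_
  obtain ⟨d, hcd, hdV⟩ := ENNReal.lt_iff_exists_real_btwn.1 hc |>.imp fun d h => h.2
  have hd0 : 0 < d := ENNReal.ofReal_pos.1 (bot_le.trans_lt hcd)
  exact hcd.trans_le (key d hd0 ((ENNReal.ofReal_lt_ofReal_iff_of_nonneg hd0.le).1 hdV))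

/-- This is dominated convergence: `♯ₙ` tends to infinity and `1 / ♯ₙ ≤ 1`. -/
theorem tendsto_inv_cycles {C : M.Strategy} {s : S} (hsur : M.Surveils π C s) :
    Tendsto (fun n => ∫⁻ ρ, ENNReal.ofReal ((M.visits π n ρ + 1)⁻¹) ∂M.law C s) atTop
      (nhds 0) := by
  rw [ENNReal.tendsto_nhds_zero]
  intro δ hδ
  have hδ2 : 0 < δ / 2 := ENNReal.half_pos hδ.ne'
  obtain ⟨k, hk⟩ := ENNReal.exists_inv_nat_lt hδ2.ne'
  filter_upwards [ENNReal.tendsto_nhds_zero.1 (hsur.tendsto k) (δ / 2) hδ2] with n hn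
  have hk0 : k ≠ 0 := by rintro rfl; simp at hk
  calc _ ≤ ∫⁻ ρ, (k : ℝ≥0∞)⁻¹ + ({ρ | M.visits π n ρ < k} : Set (ℕ → S)).indicator 1 ρ
        ∂M.law C s := by
        refine lintegral_mono fun ρ => ?_
        have hv := M.visits_nonneg π n ρ
        by_cases hlt : M.visits π n ρ < k
        · rw [Set.indicator_of_mem (by exact hlt)]
          refine le_add_left ?_
          rw [Pi.one_apply, ← ENNReal.ofReal_one]
          exact ENNReal.ofReal_le_ofReal (inv_le_one_of_one_le₀ (by linarith))
        · refine le_add_right ?_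
          rw [← ENNReal.ofReal_natCast k, ← ENNReal.ofReal_inv_of_pos (by positivity)]
          refine ENNReal.ofReal_le_ofReal (inv_anti₀ (by positivity) ?_)
          linarith [not_lt.1 hlt]
    _ = (k : ℝ≥0∞)⁻¹ + M.law C s {ρ | M.visits π n ρ < k} := by
        rw [lintegral_add_left measurable_const, lintegral_indicator_one
          (measurableSet_visits_lt n k)]
        simp
    _ ≤ δ / 2 + δ / 2 := add_le_add hk.le hn
    _ = δ := ENNReal.add_halves δ

/-- The value of a supersolution of the evaluation equation of a surveilling strategy is an upper
bound for its ACPC value. -/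
theorem acpc_le {V : ℝ} (hV : 0 ≤ V) {X : Type*} {C : M.Strategy}
    {m : ∀ n, (Finset.Iic n → S) → X} {Δ : X → S → X}
    (hm : ∀ n (ρ : ℕ → S), m (n + 1) (fun j => ρ j) = Δ (m n fun j => ρ j) (ρ (n + 1)))
    {H : X → S → ℝ} (H0 : ∀ x s, 0 ≤ H x s) {K : ℝ} (hK : ∀ x s, H x s ≤ K)
    (hH : ∀ n h, M.g (last h) (C.act n h) +
      M.mean (last h) (C.act n h) (fun y => H (Δ (m n h) y) y) ≤
      H (m n h) (last h) + V * M.ind π (last h)) {s : S} (hsur : M.Surveils π C s) :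
    M.acpc π C s ≤ ENNReal.ofReal V := by
  have key : ∀ x : ℝ, V < x → M.acpc π C s ≤ ENNReal.ofReal x := by
    intro x hx
    set y : ℝ := (V + x) / 2 with hy
    have hVy : V < y := by linarith
    have hyx : y < x := by linarith
    have hy0 : 0 < y := by linarith
    -- `ε` and then `η` are such that `V / (1 - ε) ≤ y` and `η c / (lam² (1 - ε)) ≤ x - y`
    set ε : ℝ := (y - V) / (2 * y) with hε
    have hε0 : 0 < ε := div_pos (by linarith) (by linarith)
    have hε1 : ε < 1 := by rw [hε, div_lt_one (by linarith)]; linarith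
    obtain ⟨lam, hlam, c, hc⟩ := exists_exp_moment_upper (M := M) M.g_nonneg hV hm H0 hK hH hε0 hε1
    set η : ℝ := (x - y) * lam ^ 2 * (1 - ε) / (|c| + 1) with hη
    have hη0 : 0 < η := by
      have : 0 < 1 - ε := by linarith
      have : 0 < x - y := by linarith
      positivity
    set b : ℝ := η / (lam ^ 2 * (1 - ε)) with hb
    have hb0 : 0 ≤ b := by
      have : 0 < 1 - ε := by linarith
      positivity
    have hbc : b * c ≤ x - y := by
      have h1 : b * (|c| + 1) = x - y := by
        have : 1 - ε ≠ 0 := by linarith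
        rw [hb, hη]; field_simp
      have := le_abs_self c
      nlinarith
    set d : ℝ := 1 / (2 * η * (1 - ε)) with hd
    have hd0 : 0 ≤ d := by
      have : 0 < 1 - ε := by linarith
      positivity
    have hpt : ∀ n ρ, M.cost C n ρ / M.cycles π n ρ ≤
        y + b * Real.exp (lam * ((1 - ε) * total M.g C (n + 1) ρ - V * M.visits π (n + 1) ρ)) +
          d * (M.visits π (n + 1) ρ + 1)⁻¹ := by
      intro n ρ
      rw [cost_eq_total, cycles_eq_visits]
      set N := M.visits π (n + 1) ρ
      set G := total M.g C (n + 1) ρ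
      have hN : 0 ≤ N := M.visits_nonneg π _ ρ
      set Y := (1 - ε) * G - V * N with hY
      set q := (N + 1)⁻¹ with hq
      have hq0 : 0 < q := by positivity
      have hq1 : q ≤ 1 := inv_le_one_of_one_le₀ (by linarith)
      have hNq : N * q ≤ 1 := by rw [hq, ← div_eq_mul_inv, div_le_one (by linarith)]; linarith
      have hYq : Y * q ≤ η / lam ^ 2 * Real.exp (lam * Y) + 1 / (2 * η) * q := by
        rcases le_or_gt Y 0 with hY0 | hY0
        · have : Y * q ≤ 0 := mul_nonpos_of_nonpos_of_nonneg hY0 hq0.le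
          have : 0 ≤ η / lam ^ 2 * Real.exp (lam * Y) + 1 / (2 * η) * q := by positivity
          linarith
        · have h1 := Real.quadratic_le_exp_of_nonneg (mul_pos hlam hY0).le
          have h2 : (lam * Y) ^ 2 / 2 ≤ Real.exp (lam * Y) := by
            have := mul_pos hlam hY0; linarith
          have h3 : η / lam ^ 2 * ((lam * Y) ^ 2 / 2) ≤ η / lam ^ 2 * Real.exp (lam * Y) :=
            mul_le_mul_of_nonneg_left h2 (by positivity)
          have h4 : η / lam ^ 2 * ((lam * Y) ^ 2 / 2) = η * Y ^ 2 / 2 := by field_simp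
          have h5 : Y * q ≤ η * Y ^ 2 / 2 + 1 / (2 * η) * (q * q) := by
            have h6 : η * Y ^ 2 / 2 + 1 / (2 * η) * (q * q) - Y * q =
                (η * Y - q) ^ 2 / (2 * η) := by field_simp; ring
            have : 0 ≤ (η * Y - q) ^ 2 / (2 * η) := by positivity
            linarith
          have h7 : 1 / (2 * η) * (q * q) ≤ 1 / (2 * η) * q :=
            mul_le_mul_of_nonneg_left (mul_le_of_le_one_left hq0.le hq1) (by positivity)
          linarith
      have h8 : (1 - ε) * (G * q) ≤ V + η / lam ^ 2 * Real.exp (lam * Y) + 1 / (2 * η) * q := by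
        have : (1 - ε) * (G * q) = Y * q + V * (N * q) := by rw [hY]; ring
        have := mul_le_mul_of_nonneg_left hNq hV
        linarith
      have h9 : V ≤ (1 - ε) * y := by
        have h10 : (1 - ε) * y = (y + V) / 2 := by rw [hε]; field_simp; ring
        linarith
      have h11 : (1 - ε) * (y + b * Real.exp (lam * Y) + d * q) =
          (1 - ε) * y + η / lam ^ 2 * Real.exp (lam * Y) + 1 / (2 * η) * q := by
        have : 1 - ε ≠ 0 := by linarith
        rw [hb, hd]; field_simp
      rw [div_eq_mul_inv]
      refine le_of_mul_le_mul_left ?_ (by linarith : 0 < 1 - ε)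
      rw [h11]
      linarith
    have hup : ∀ n, ∫⁻ ρ, ENNReal.ofReal (M.cost C n ρ / M.cycles π n ρ) ∂M.law C s ≤
        ENNReal.ofReal y + ENNReal.ofReal b * ENNReal.ofReal c + ENNReal.ofReal d *
          ∫⁻ ρ, ENNReal.ofReal ((M.visits π (n + 1) ρ + 1)⁻¹) ∂M.law C s := by
      intro n
      have hm1 : Measurable fun ρ => ENNReal.ofReal (Real.exp
          (lam * ((1 - ε) * total M.g C (n + 1) ρ - V * M.visits π (n + 1) ρ))) := by
        have := measurable_total M.g C (n + 1)
        have := measurable_visits (M := M) π (n + 1)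
        fun_prop
      have hm2 : Measurable fun ρ => ENNReal.ofReal ((M.visits π (n + 1) ρ + 1)⁻¹) := by
        have := measurable_visits (M := M) π (n + 1)
        fun_prop
      calc _ ≤ ∫⁻ ρ, ENNReal.ofReal y + ENNReal.ofReal b * ENNReal.ofReal (Real.exp
            (lam * ((1 - ε) * total M.g C (n + 1) ρ - V * M.visits π (n + 1) ρ))) +
            ENNReal.ofReal d * ENNReal.ofReal ((M.visits π (n + 1) ρ + 1)⁻¹) ∂M.law C s := by
            refine lintegral_mono fun ρ => (ENNReal.ofReal_le_ofReal (hpt n ρ)).trans ?_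
            rw [← ENNReal.ofReal_mul hb0, ← ENNReal.ofReal_mul hd0]
            exact ENNReal.ofReal_add_le.trans (by gcongr; exact ENNReal.ofReal_add_le)
        _ = ENNReal.ofReal y + ENNReal.ofReal b * ∫⁻ ρ, ENNReal.ofReal (Real.exp
            (lam * ((1 - ε) * total M.g C (n + 1) ρ - V * M.visits π (n + 1) ρ))) ∂M.law C s +
            ENNReal.ofReal d *
              ∫⁻ ρ, ENNReal.ofReal ((M.visits π (n + 1) ρ + 1)⁻¹) ∂M.law C s := by
            rw [lintegral_add_right _ (hm2.const_mul _), lintegral_add_left measurable_const,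
              lintegral_const_mul _ hm1, lintegral_const_mul _ hm2]
            simp
        _ ≤ _ := by gcongr; exact hc s (n + 1)
    have hlim : Tendsto (fun n => ENNReal.ofReal y + ENNReal.ofReal b * ENNReal.ofReal c +
        ENNReal.ofReal d * ∫⁻ ρ, ENNReal.ofReal ((M.visits π (n + 1) ρ + 1)⁻¹) ∂M.law C s) atTop
        (nhds (ENNReal.ofReal y + ENNReal.ofReal b * ENNReal.ofReal c)) := by
      have h1 := ENNReal.Tendsto.const_mul (a := ENNReal.ofReal d)
        ((tendsto_inv_cycles hsur).comp (tendsto_add_atTop_nat 1)) (Or.inr ENNReal.ofReal_ne_top)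
      simpa using h1.const_add (ENNReal.ofReal y + ENNReal.ofReal b * ENNReal.ofReal c)
    refine (limsup_le_limsup (Eventually.of_forall hup)).trans ?_
    rw [hlim.limsup_eq, ← ENNReal.ofReal_mul hb0]
    calc _ ≤ ENNReal.ofReal y + ENNReal.ofReal (x - y) := by gcongr
      _ = ENNReal.ofReal x := by
        rw [← ENNReal.ofReal_add hy0.le (by linarith)]; congr 1; ring
  refine le_of_forall_gt fun c hc => ?_
  obtain ⟨d, hVd, hdc⟩ := ENNReal.lt_iff_exists_real_btwn.1 hc |>.imp fun d h => h.2
  exact (key d ((ENNReal.ofReal_lt_ofReal_iff_of_nonneg hV).1 hVd)).trans_lt hdc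

/-- A strategy surveils if the expected return times to the surveillance states are bounded, as
witnessed by a supersolution `H` of the equation for these times. -/
theorem surveils_of_bound {V : ℝ} (hV : 0 ≤ V) {X : Type*} {C : M.Strategy}
    {m : ∀ n, (Finset.Iic n → S) → X} {Δ : X → S → X}
    (hm : ∀ n (ρ : ℕ → S), m (n + 1) (fun j => ρ j) = Δ (m n fun j => ρ j) (ρ (n + 1)))
    {H : X → S → ℝ} (H0 : ∀ x s, 0 ≤ H x s) {K : ℝ} (hK : ∀ x s, H x s ≤ K)
    (hH : ∀ n h, 1 + M.mean (last h) (C.act n h) (fun y => H (Δ (m n h) y) y) ≤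
      H (m n h) (last h) + V * M.ind π (last h)) (s : S) : M.Surveils π C s := by
  obtain ⟨lam, hlam, c, hc⟩ := exists_exp_moment_upper (M := M) (γ := fun _ _ => 1)
    (fun _ _ => zero_le_one) hV hm H0 hK hH (ε := 1 / 2) (by norm_num) (by norm_num)
  refine surveils_of_tendsto fun k => ?_
  rw [ENNReal.tendsto_nhds_zero]
  intro δ hδ
  obtain ⟨L, hL⟩ := exists_forall_measure_ge_le (μ := M.law C s)
    (X := fun n ρ => (1 - 1 / 2) * total (M := M) (fun _ _ => 1) C n ρ - V * M.visits π n ρ)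
    (fun n => ((measurable_total _ C n).const_mul _).sub ((measurable_visits π n).const_mul V))
    hlam (fun n => hc s n) hδ
  obtain ⟨n₀, hn₀⟩ := exists_nat_ge (2 * (L + V * k))
  filter_upwards [eventually_ge_atTop n₀] with n hn
  refine (measure_mono fun ρ hρ => ?_).trans (hL n)
  have h1 : total (M := M) (fun _ _ => (1 : ℝ)) C n ρ = n := by simp [total]
  have h2 := mul_le_mul_of_nonneg_left (le_of_lt (show M.visits π n ρ < k from hρ)) hV
  have h3 : (n₀ : ℝ) ≤ n := by exact_mod_cast hn
  simp only [Set.mem_ofPred_eq, h1]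
  linarith

end

end MDP

/-! ### Chains with an absorbing set -/

/-- If a set `Z` is reachable from everywhere along `r`, there is a rank that decreases along some
step from every point outside `Z`. -/
theorem exists_rank {T : Type*} {r : T → T → Prop} {Z : Set T}
    (h : ∀ x, ∃ z ∈ Z, Relation.ReflTransGen r x z) :
    ∃ d : T → ℕ, ∀ x, x ∉ Z → ∃ y, r x y ∧ d y < d x := by
  let L : ℕ → Set T := fun n => n.rec Z fun _ W => {x | ∃ y, r x y ∧ y ∈ W}
  have hL : ∀ x, ∃ n, x ∈ L n := by
    intro x
    obtain ⟨z, hz, hxz⟩ := h x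
    induction hxz using Relation.ReflTransGen.head_induction_on with
    | refl => exact ⟨0, hz⟩
    | head hab _ ih =>
      obtain ⟨n, hn⟩ := ih
      exact ⟨n + 1, _, hab, hn⟩
  refine ⟨fun x => sInf {n | x ∈ L n}, fun x hx => ?_⟩
  have h1 : x ∈ L (sInf {n | x ∈ L n}) := Nat.sInf_mem (hL x)
  rcases h2 : sInf {n | x ∈ L n} with _ | n
  · rw [h2] at h1; exact absurd h1 hx
  · rw [h2] at h1
    obtain ⟨y, hxy, hy⟩ := h1
    refine ⟨y, hxy, ?_⟩
    have h3 : sInf {n | y ∈ L n} ≤ n := Nat.sInf_le hy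
    simp only [h2]
    lia

section Chain

variable {T : Type*} [Fintype T] {K : T → T → ℝ} {G : Set T}

/-- Maximum principle: a function that is subharmonic on a set of transient states is
dominated by its values outside. -/
theorem nonpos_of_subharmonic (hK : ∀ x y, 0 ≤ K x y) (hK1 : ∀ x ∈ G, ∑ y, K x y = 1)
    (hG : ∀ x, ∃ z ∈ Gᶜ, Relation.ReflTransGen (fun x y => 0 < K x y) x z)
    {f : T → ℝ} (hf : ∀ x ∈ G, f x ≤ ∑ y, K x y * f y) (hf0 : ∀ x ∉ G, f x ≤ 0) (x : T) :
    f x ≤ 0 := by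
  obtain ⟨d, hd⟩ := exists_rank hG
  have : Nonempty T := ⟨x⟩
  obtain ⟨x₀, hx₀⟩ := Finite.exists_max f
  refine (hx₀ x).trans (not_lt.1 fun hpos => ?_)
  have key : ∀ n y, d y ≤ n → f y ≠ f x₀ := by
    intro n
    induction n with
    | zero =>
      intro y hy hfy
      by_cases hyG : y ∈ G
      · obtain ⟨z, -, hz⟩ := hd y (not_not.2 hyG)
        lia
      · have := hf0 y hyG
        linarith
    | succ n ih =>
      intro y hy hfy
      by_cases hyG : y ∈ G
      · obtain ⟨z, hyz, hz⟩ := hd y (not_not.2 hyG)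
        have h1 : f z < f x₀ := lt_of_le_of_ne (hx₀ z) (ih z (by lia))
        have h2 : ∑ w, K y w * f w < ∑ w, K y w * f x₀ :=
          Finset.sum_lt_sum (fun w _ => mul_le_mul_of_nonneg_left (hx₀ w) (hK _ _))
            ⟨z, Finset.mem_univ z, mul_lt_mul_of_pos_left h1 hyz⟩
        rw [← Finset.sum_mul, hK1 y hyG, one_mul] at h2
        have := hf y hyG
        linarith
      · have := hf0 y hyG
        linarith
  exact key _ x₀ le_rfl rfl

/-- On a set of transient states, the equation `f = r + K f` has a solution with prescribed values
outside. -/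
theorem exists_harmonic (hK : ∀ x y, 0 ≤ K x y) (hK1 : ∀ x ∈ G, ∑ y, K x y = 1)
    (hG : ∀ x, ∃ z ∈ Gᶜ, Relation.ReflTransGen (fun x y => 0 < K x y) x z) (r : T → ℝ) :
    ∃ f : T → ℝ, (∀ x ∈ G, f x = r x + ∑ y, K x y * f y) ∧ ∀ x ∉ G, f x = r x := by
  classical
  let A : (T → ℝ) →ₗ[ℝ] (T → ℝ) :=
    { toFun := fun f x => if x ∈ G then f x - ∑ y, K x y * f y else f x
      map_add' := fun f f' => by
        funext x
        simp only [Pi.add_apply]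
        split_ifs
        · simp only [mul_add, Finset.sum_add_distrib]; ring
        · rfl
      map_smul' := fun c f => by
        funext x
        simp only [Pi.smul_apply, smul_eq_mul, RingHom.id_apply]
        split_ifs
        · rw [mul_sub, Finset.mul_sum]
          congr 1
          exact Finset.sum_congr rfl fun y _ => by ring
        · rfl }
  have hA : ∀ f x, A f x = if x ∈ G then f x - ∑ y, K x y * f y else f x := fun _ _ => rfl
  have hneg : ∀ f, A f = 0 → ∀ x, f x ≤ 0 := by
    intro f hf x
    refine nonpos_of_subharmonic hK hK1 hG (f := f) (fun x hx => ?_) (fun x hx => ?_) x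
    · have := congrFun hf x
      rw [hA, if_pos hx, Pi.zero_apply] at this
      linarith
    · have := congrFun hf x
      rw [hA, if_neg hx, Pi.zero_apply] at this
      linarith
  have hinj : Function.Injective A := by
    rw [← LinearMap.ker_eq_bot, LinearMap.ker_eq_bot']
    intro f hf
    funext x
    refine le_antisymm (hneg f hf x) ?_
    have := hneg (-f) (by rw [map_neg, hf, neg_zero]) x
    simpa using this
  obtain ⟨f, hf⟩ := (LinearMap.injective_iff_surjective.1 hinj) r
  refine ⟨f, fun x hx => ?_, fun x hx => ?_⟩
  · have := congrFun hf x
    rw [hA, if_pos hx] at this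
    linarith
  · have := congrFun hf x
    rwa [hA, if_neg hx] at this

theorem nonneg_of_superharmonic (hK : ∀ x y, 0 ≤ K x y) (hK1 : ∀ x ∈ G, ∑ y, K x y = 1)
    (hG : ∀ x, ∃ z ∈ Gᶜ, Relation.ReflTransGen (fun x y => 0 < K x y) x z)
    {f : T → ℝ} (hf : ∀ x ∈ G, ∑ y, K x y * f y ≤ f x) (hf0 : ∀ x ∉ G, 0 ≤ f x) (x : T) :
    0 ≤ f x := by
  have := nonpos_of_subharmonic hK hK1 hG (f := fun x => - f x) (fun x hx => by
    simpa using hf x hx) (fun x hx => by simpa using hf0 x hx) x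
  linarith

end Chain

/-! ### The optimality equation -/

namespace MDP

variable {S A AP : Type*} [Fintype S] (M : MDP S A AP)

/-- From every state, the stationary strategy `D` reaches a surveillance state with positive
probability. -/
def Stationary.Reaches {M : MDP S A AP} (D : M.Stationary) (π : AP) : Prop :=
  ∀ x, ∃ z ∈ M.sur π, Relation.ReflTransGen (fun x y => 0 < M.P x (D.act x) y) x z

/-- The states of `M` communicate. -/
def Communicating : Prop :=
  ∀ s s', Relation.ReflTransGen (fun x y => ∃ a ∈ M.enabled x, 0 < M.P x a y) s s'

/-- `h` is a subsolution of the optimality equation of the ACPC problem with value `V`. -/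
def IsSub (π : AP) (V : ℝ) (h : S → ℝ) : Prop :=
  ∀ s, ∀ a ∈ M.enabled s, h s + V * M.ind π s ≤ M.g s a + M.mean s a h

variable {M} {π : AP}

theorem isClosed_isSub [Finite A] : IsClosed {p : ℝ × (S → ℝ) | M.IsSub π p.1 p.2} := by
  simp only [IsSub, mean, Set.ofPred_forall]
  refine isClosed_iInter fun s => isClosed_iInter fun a => isClosed_iInter fun _ => ?_
  exact isClosed_le (by fun_prop) (by fun_prop)

theorem IsSub.add_const {V : ℝ} {h : S → ℝ} (hh : M.IsSub π V h) (c : ℝ) :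
    M.IsSub π V fun s => h s + c := by
  intro s a ha
  have := hh s a ha
  rw [mean_add, mean_const _ ha]
  linarith

theorem mean_sub_le {s : S} {a : A} (ha : a ∈ M.enabled s) {f : S → ℝ} {c : ℝ} (hf : ∀ y, f y ≤ c)
    (y : S) : M.mean s a f ≤ c - M.P s a y * (c - f y) := by
  have h1 : M.mean s a (fun y => c - f y) = c - M.mean s a f := by
    simp only [sub_eq_add_neg]
    rw [mean_add, mean_neg, mean_const _ ha]
  have h2 : M.P s a y * (c - f y) ≤ M.mean s a (fun y => c - f y) :=
    Finset.single_le_sum (f := fun y => M.P s a y * (c - f y))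
      (fun y _ => mul_nonneg (M.P_nonneg _ _ _) (by linarith [hf y])) (Finset.mem_univ y)
  linarith

/-- In a communicating MDP the oscillation of subsolutions is bounded. -/
theorem exists_osc_bound [Nonempty S] (hM : M.Communicating) :
    ∃ c : ℝ, ∀ V h, 0 ≤ V → M.IsSub π V h → ∀ s s', h s - h s' ≤ c := by
  have key : ∀ s s', ∃ c : ℝ, ∀ V h, 0 ≤ V → M.IsSub π V h → (∀ x, h x ≤ h s) →
      h s - h s' ≤ c := by
    intro s s'
    induction hM s s' with
    | refl => exact ⟨0, fun V h _ _ _ => by simp⟩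
    | @tail y z _ hyz ih =>
      obtain ⟨c, hc⟩ := ih
      obtain ⟨a, ha, hp⟩ := hyz
      refine ⟨(c + M.g y a) / M.P y a z, fun V h hV hh hmax => ?_⟩
      have h1 := hh y a ha
      have h2 := mean_sub_le ha hmax z
      have h3 := hc V h hV hh hmax
      have h4 := mul_nonneg hV (M.ind_nonneg π y)
      rw [le_div_iff₀ hp]
      linarith
  choose c hc using key
  obtain ⟨p, hp⟩ := Finite.exists_max fun p : S × S => c p.1 p.2
  refine ⟨c p.1 p.2, fun V h hV hh s s' => ?_⟩
  obtain ⟨x, hx⟩ := Finite.exists_max h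
  have h1 := hc x s' V h hV hh hx
  have h2 := hp (x, s')
  have h3 := hx s
  simp only at h2
  linarith

/-- The optimality equation of the ACPC problem of a communicating MDP: there is a
subsolution that is an equality along a stationary strategy reaching the surveillance states. The
value is the largest one that admits subsolutions. If every surveillance state were strict in some
optimal subsolution, the average of these would be strict at all of them, and the value could be
raised; so some `b` is never strict. Among the optimal subsolutions vanishing in `b` take one with
the largest sum: if `b` could not be reached from `U` by steps that are equalities, the
subsolution could be raised on `U`. -/
theorem exists_optimal [Finite A] (hM : M.Communicating) (hB : (M.sur π).Nonempty) :
    ∃ V : ℝ, 0 ≤ V ∧ ∃ h : S → ℝ, (∀ s, 0 ≤ h s) ∧ M.IsSub π V h ∧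
      ∃ D : M.Stationary, D.Reaches π ∧
        ∀ s, h s + V * M.ind π s = M.g s (D.act s) + M.mean s (D.act s) h := by
  classical
  obtain ⟨b₀, hb₀⟩ := hB
  have : Nonempty S := ⟨b₀⟩
  obtain ⟨c, hc⟩ := exists_osc_bound (π := π) hM
  have hc0 : 0 ≤ c := by
    have := hc 0 (fun _ => 0) le_rfl (fun s a ha => by
      rw [mean_const _ ha]; simpa using M.g_nonneg s a) b₀ b₀
    simpa using this
  -- values of subsolutions are bounded
  obtain ⟨a₀, ha₀⟩ := M.exists_enabled b₀
  have hVb : ∀ V h, 0 ≤ V → M.IsSub π V h → V ≤ M.g b₀ a₀ + c := by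
    intro V h hV hh
    have h1 := hh b₀ a₀ ha₀
    rw [ind_of_mem _ hb₀] at h1
    have h2 : M.mean b₀ a₀ h ≤ M.mean b₀ a₀ fun _ => h b₀ + c :=
      mean_mono _ _ _ fun y => by linarith [hc V h hV hh y b₀]
    rw [mean_const _ ha₀] at h2
    linarith
  have hcompact : ∀ b : S, IsCompact {p : ℝ × (S → ℝ) | 0 ≤ p.1 ∧ M.IsSub π p.1 p.2 ∧
      p.2 b = 0} := by
    intro b
    refine Metric.isCompact_of_isClosed_isBounded ?_ ?_
    · refine (isClosed_le continuous_const continuous_fst).inter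
        (isClosed_isSub.inter (isClosed_eq ?_ continuous_const))
      fun_prop
    · refine (Metric.isBounded_Icc (0 : ℝ) (M.g b₀ a₀ + c)).prod
        (Metric.isBounded_Icc (fun _ : S => -c) (fun _ => c)) |>.subset ?_
      rintro ⟨V, h⟩ ⟨hV, hh, hb⟩
      refine ⟨⟨hV, hVb V h hV hh⟩, fun s => ?_, fun s => ?_⟩
      · have := hc V h hV hh b s
        simp only at hb ⊢
        linarith
      · have := hc V h hV hh s b
        simp only at hb ⊢
        linarith
  obtain ⟨⟨V, h₁⟩, ⟨hV, hh₁, -⟩, hmax⟩ := (hcompact b₀).exists_isMaxOn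
    ⟨(0, fun _ => 0), le_rfl, fun s a ha => by
      rw [mean_const _ ha]; simpa using M.g_nonneg s a, rfl⟩ continuous_fst.continuousOn
  have hVmax : ∀ V' h', 0 ≤ V' → M.IsSub π V' h' → V' ≤ V := by
    intro V' h' hV' hh'
    exact hmax (a := (V', fun s => h' s + -h' b₀)) ⟨hV', hh'.add_const _, by simp⟩
  simp only at hV hh₁
  -- a surveillance state that has an equality in every optimal subsolution
  obtain ⟨b, hbB, hb⟩ : ∃ b ∈ M.sur π, ∀ h, M.IsSub π V h →
      ∃ a ∈ M.enabled b, h b + V = M.g b a + M.mean b a h := by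
    by_contra hcon
    push Not at hcon
    have hcon' : ∀ b, ∃ h, M.IsSub π V h ∧ (b ∈ M.sur π →
        ∀ a ∈ M.enabled b, h b + V < M.g b a + M.mean b a h) := by
      intro b
      by_cases hbB : b ∈ M.sur π
      · obtain ⟨h, hh, hne⟩ := hcon b hbB
        refine ⟨h, hh, fun _ a ha => lt_of_le_of_ne ?_ (hne a ha)⟩
        have := hh b a ha
        rwa [ind_of_mem _ hbB, mul_one] at this
      · exact ⟨h₁, hh₁, fun h => absurd h hbB⟩
    choose k hk hk' using hcon'
    set n : ℝ := (Fintype.card S : ℝ) with hn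
    have hn0 : 0 < n := by rw [hn]; exact_mod_cast Fintype.card_pos
    set h : S → ℝ := fun s => n⁻¹ * ∑ b, k b s with hh
    have hmean : ∀ s a, M.mean s a h = n⁻¹ * ∑ b, M.mean s a (k b) := by
      intro s a
      rw [hh, mean_mul]
      congr 1
      simp only [mean, Finset.mul_sum]
      exact Finset.sum_comm
    have hhsub : ∀ s, ∀ a ∈ M.enabled s, h s + V * M.ind π s ≤ M.g s a + M.mean s a h ∧
        (s ∈ M.sur π → h s + V < M.g s a + M.mean s a h) := by
      intro s a ha
      have e1 : h s + V * M.ind π s = n⁻¹ * ∑ b, (k b s + V * M.ind π s) := by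
        rw [Finset.sum_add_distrib, Finset.sum_const, Finset.card_univ, nsmul_eq_mul, ← hn, hh]
        field_simp
      have e2 : M.g s a + M.mean s a h = n⁻¹ * ∑ b, (M.g s a + M.mean s a (k b)) := by
        rw [Finset.sum_add_distrib, Finset.sum_const, Finset.card_univ, nsmul_eq_mul, ← hn, hmean]
        field_simp
      refine ⟨?_, fun hs => ?_⟩
      · rw [e1, e2]
        exact mul_le_mul_of_nonneg_left (Finset.sum_le_sum fun b _ => hk b s a ha)
          (inv_pos.2 hn0).le
      · have e3 : h s + V = h s + V * M.ind π s := by rw [ind_of_mem _ hs, mul_one]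
        rw [e3, e1, e2]
        refine mul_lt_mul_of_pos_left (Finset.sum_lt_sum (fun b _ => hk b s a ha)
          ⟨s, Finset.mem_univ s, ?_⟩) (inv_pos.2 hn0)
        rw [ind_of_mem _ hs, mul_one]
        exact hk' s hs a ha
    -- the least gap at the surveillance states
    have : Nonempty {p : S × A // p.1 ∈ M.sur π ∧ p.2 ∈ M.enabled p.1} := ⟨(b₀, a₀), hb₀, ha₀⟩
    obtain ⟨⟨⟨s, a⟩, hs, ha⟩, hmin⟩ := Finite.exists_min
      fun p : {p : S × A // p.1 ∈ M.sur π ∧ p.2 ∈ M.enabled p.1} =>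
        M.g p.1.1 p.1.2 + M.mean p.1.1 p.1.2 h - h p.1.1
    simp only at hs ha hmin
    have hlt := (hhsub s a ha).2 hs
    have := hVmax (M.g s a + M.mean s a h - h s) h (by linarith) (by
      intro x e he
      by_cases hx : x ∈ M.sur π
      · have := hmin ⟨(x, e), hx, he⟩
        simp only at this
        rw [ind_of_mem _ hx]
        linarith
      · have := (hhsub x e he).1
        rw [ind_of_notMem _ hx] at this ⊢
        simpa using this)
    linarith
  -- the largest optimal subsolution vanishing in `b`
  obtain ⟨⟨V', h⟩, ⟨⟨-, hh, hhb⟩, rfl⟩, hsum⟩ :=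
    ((hcompact b).inter_right (isClosed_eq continuous_fst continuous_const :
      IsClosed {p : ℝ × (S → ℝ) | p.1 = V})).exists_isMaxOn
    ⟨(V, fun s => h₁ s + -h₁ b), ⟨hV, hh₁.add_const _, by simp⟩, rfl⟩
    (f := fun p => ∑ s, p.2 s) (by fun_prop)
  simp only at hh hhb hV hVmax hb
  set tight : S → A → Prop := fun s a => a ∈ M.enabled s ∧
    h s + V' * M.ind π s = M.g s a + M.mean s a h with htight
  have hreach : ∀ x, ∃ z ∈ ({b} : Set S),
      Relation.ReflTransGen (fun x y => ∃ a, tight x a ∧ 0 < M.P x a y) x z := by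
    by_contra hcon
    push Not at hcon
    obtain ⟨x₀, hx₀⟩ := hcon
    set U : Set S := {x | ¬ Relation.ReflTransGen
      (fun x y => ∃ a, tight x a ∧ 0 < M.P x a y) x b} with hU
    have hx₀U : x₀ ∈ U := hx₀ b rfl
    have hbU : b ∉ U := fun h => h .refl
    have hUclosed : ∀ x ∈ U, ∀ a, tight x a → ∀ y, 0 < M.P x a y → y ∈ U :=
      fun x hx a hxa y hy hyb => hx (.head ⟨a, hxa, hy⟩ hyb)
    -- all steps that are not equalities have at least the gap `ε`
    obtain ⟨ε, hε, hgap⟩ : ∃ ε > 0, ∀ s, ∀ a ∈ M.enabled s, ¬ tight s a →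
        h s + V' * M.ind π s + ε ≤ M.g s a + M.mean s a h := by
      rcases isEmpty_or_nonempty {p : S × A // p.2 ∈ M.enabled p.1 ∧ ¬ tight p.1 p.2} with he | he
      · exact ⟨1, one_pos, fun s a ha hs => (he.false ⟨(s, a), ha, hs⟩).elim⟩
      · obtain ⟨⟨⟨s, a⟩, ha, hs⟩, hmin⟩ := Finite.exists_min
          fun p : {p : S × A // p.2 ∈ M.enabled p.1 ∧ ¬ tight p.1 p.2} =>
            M.g p.1.1 p.1.2 + M.mean p.1.1 p.1.2 h - (h p.1.1 + V' * M.ind π p.1.1)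
        refine ⟨M.g s a + M.mean s a h - (h s + V' * M.ind π s), ?_, fun x e he hx => ?_⟩
        · have := lt_of_le_of_ne (hh s a ha) fun h => hs ⟨ha, h⟩
          linarith
        · have := hmin ⟨(x, e), he, hx⟩
          simp only at this
          linarith
    set h' : S → ℝ := fun s => h s + U.indicator (fun _ => ε) s with hh'
    have hind : ∀ y, 0 ≤ U.indicator (fun _ => ε) y :=
      fun y => Set.indicator_nonneg (fun _ _ => hε.le) y
    have hh'sub : M.IsSub π V' h' := by
      intro s a ha
      have h1 : M.mean s a h' = M.mean s a h + M.mean s a (U.indicator fun _ => ε) := mean_add ..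
      have h2 : 0 ≤ M.mean s a (U.indicator fun _ => ε) := mean_nonneg _ _ _ hind
      have h3 : U.indicator (fun _ => ε) s ≤ ε := Set.indicator_le_self' (fun _ _ => hε.le) s
      rw [h1]
      by_cases ht : tight s a
      · by_cases hsU : s ∈ U
        · have h4 : M.mean s a (U.indicator fun _ => ε) = M.mean s a fun _ => ε :=
            mean_congr _ fun y hy => Set.indicator_of_mem (hUclosed s hsU a ht y hy) _
          rw [mean_const _ ha] at h4
          have := ht.2
          simp only [hh']
          linarith
        · have := ht.2
          simp only [hh', Set.indicator_of_notMem hsU]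
          linarith
      · have := hgap s a ha ht
        simp only [hh']
        linarith
    have h5 : ∑ s, h' s ≤ ∑ s, h s := hsum (a := (V', h')) ⟨⟨hV, hh'sub, by
      simp only [hh', Set.indicator_of_notMem hbU, hhb, add_zero]⟩, rfl⟩
    have h6 : ∑ s, h s < ∑ s, h' s := Finset.sum_lt_sum (fun s _ => by
      simp only [hh']; linarith [hind s]) ⟨x₀, Finset.mem_univ _, by
      simp only [hh', Set.indicator_of_mem hx₀U]; linarith⟩
    linarith
  obtain ⟨d, hd⟩ := exists_rank hreach
  have hD : ∀ s, ∃ a, tight s a ∧ (s ≠ b → ∃ y, 0 < M.P s a y ∧ d y < d s) := by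
    intro s
    by_cases hs : s = b
    · obtain ⟨a, ha, hab⟩ := hb h hh
      refine ⟨a, ⟨hs ▸ ha, ?_⟩, fun h => absurd hs h⟩
      rw [hs, ind_of_mem _ hbB, mul_one]
      exact hab
    · obtain ⟨y, ⟨a, ha, hp⟩, hlt⟩ := hd s hs
      exact ⟨a, ha, fun _ => ⟨y, hp, hlt⟩⟩
  choose D hD hD' using hD
  refine ⟨V', hV, fun s => h s + c, fun s => ?_, hh.add_const c, ⟨D, fun s => (hD s).1⟩, ?_, ?_⟩
  · have := hc V' h hV hh b s
    linarith
  · intro x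
    refine ⟨b, hbB, ?_⟩
    induction hn : d x using Nat.strong_induction_on generalizing x with
    | _ n ih =>
      by_cases hx : x = b
      · rw [hx]
      · obtain ⟨y, hp, hlt⟩ := hD' x hx
        exact .head hp (ih (d y) (hn ▸ hlt) y rfl)
  · intro s
    have := (hD s).2
    simp only
    rw [mean_add, mean_const _ (hD s).1]
    linarith

end MDP

/-! ### End components without surveillance states -/

/-- A non-empty set of states that is closed under non-empty sets of enabled actions contains an
end component with some of these actions, namely a minimal closed set. -/
theorem Sub.exists_isEC {S A AP : Type*} [Fintype S] {M : MDP S A AP} {E : Finset S}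
    (hE : E.Nonempty) {act : S → Set A} (hne : ∀ s ∈ E, (act s).Nonempty)
    (hen : ∀ s ∈ E, act s ⊆ M.enabled s)
    (hcl : ∀ s ∈ E, ∀ a ∈ act s, ∀ s', 0 < M.P s a s' → s' ∈ E) :
    ∃ N : Sub S A, N.IsEC M ∧ N.states ⊆ E ∧ ∀ s, N.act s ⊆ act s := by
  classical
  set F : Finset (Finset S) := Finset.univ.filter fun W => W.Nonempty ∧ W ⊆ E ∧
    ∀ s ∈ W, ∀ a ∈ act s, ∀ s', 0 < M.P s a s' → s' ∈ W with hF
  obtain ⟨W, hW, hmin⟩ := Finset.exists_min_image F Finset.card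
    ⟨E, Finset.mem_filter.2 ⟨Finset.mem_univ _, hE, subset_rfl, hcl⟩⟩
  obtain ⟨-, hWne, hWE, hWcl⟩ := Finset.mem_filter.1 hW
  refine ⟨⟨W, fun s => {a | s ∈ W ∧ a ∈ act s}⟩, ⟨hWne, ?_, ?_, ?_, ?_, ?_⟩, hWE,
    fun s a ha => ha.2⟩
  · intro s hs
    ext a
    exact ⟨fun h => hs h.1, fun h => h.elim⟩
  · intro s hs
    obtain ⟨a, ha⟩ := hne s (hWE hs)
    exact ⟨a, hs, ha⟩
  · exact fun s a ha => hen s (hWE ha.1) ha.2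
  · exact fun s hs a ha s' h => hWcl s hs a ha.2 s' h
  · intro s hs s' hs'
    set r : S → S → Prop := fun x y => ∃ a ∈ {a | x ∈ W ∧ a ∈ act x}, 0 < M.P x a y
    set Z : Finset S := W.filter fun y => Relation.ReflTransGen r s y with hZ
    have hZF : Z ∈ F := by
      refine Finset.mem_filter.2 ⟨Finset.mem_univ _, ⟨s, Finset.mem_filter.2 ⟨hs, .refl⟩⟩,
        (Finset.filter_subset _ _).trans hWE, fun x hx a ha y hy => ?_⟩
      obtain ⟨hxW, hsx⟩ := Finset.mem_filter.1 hx
      exact Finset.mem_filter.2 ⟨hWcl x hxW a ha y hy, hsx.tail ⟨a, ⟨hxW, ha⟩, hy⟩⟩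
    have hZW : Z = W := Finset.eq_of_subset_of_card_le (Finset.filter_subset _ _) (hmin Z hZF)
    rw [← hZW] at hs'
    exact (Finset.mem_filter.1 hs').2

namespace MDP

variable {S A AP : Type*} [Fintype S] {M : MDP S A AP} {π : AP}

/-- The greatest expectation, over all strategies, of `exp (-(cost + visits))` in the first `n`
stages. -/
noncomputable def survival (M : MDP S A AP) (π : AP) : ℕ → S → ℝ
  | 0, _ => 1
  | n + 1, s => ⨆ a : M.enabled s, Real.exp (-(M.g s a + M.ind π s)) * M.mean s a (survival M π n)

theorem le_survival_succ [Finite A] (n : ℕ) {s : S} {a : A} (ha : a ∈ M.enabled s) :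
    Real.exp (-(M.g s a + M.ind π s)) * M.mean s a (M.survival π n) ≤ M.survival π (n + 1) s :=
  le_ciSup (f := fun a : M.enabled s =>
    Real.exp (-(M.g s a + M.ind π s)) * M.mean s a (M.survival π n))
    (Set.finite_range _).bddAbove ⟨a, ha⟩

theorem exists_survival_succ [Finite A] (n : ℕ) (s : S) : ∃ a ∈ M.enabled s,
    Real.exp (-(M.g s a + M.ind π s)) * M.mean s a (M.survival π n) = M.survival π (n + 1) s := by
  obtain ⟨a₀, ha₀⟩ := M.exists_enabled s
  have : Nonempty (M.enabled s) := ⟨⟨a₀, ha₀⟩⟩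
  obtain ⟨a, ha⟩ := exists_eq_ciSup_of_finite (f := fun a : M.enabled s =>
    Real.exp (-(M.g s a + M.ind π s)) * M.mean s a (M.survival π n))
  exact ⟨a, a.2, ha⟩

theorem survival_nonneg [Finite A] (n : ℕ) (s : S) : 0 ≤ M.survival π n s := by
  induction n generalizing s with
  | zero => exact zero_le_one
  | succ n ih =>
    obtain ⟨a, -, ha⟩ := M.exists_survival_succ (π := π) n s
    rw [← ha]
    exact mul_nonneg (Real.exp_pos _).le (M.mean_nonneg _ _ ih)

theorem survival_succ_le [Finite A] (n : ℕ) (s : S) :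
    M.survival π (n + 1) s ≤ M.survival π n s := by
  induction n generalizing s with
  | zero =>
    obtain ⟨a, ha, has⟩ := M.exists_survival_succ (π := π) 0 s
    rw [← has]
    change _ * M.mean s a (fun _ => 1) ≤ 1
    rw [mean_const _ ha, mul_one]
    refine Real.exp_le_one_iff.2 ?_
    linarith [M.g_nonneg s a, M.ind_nonneg π s]
  | succ n ih =>
    obtain ⟨a, ha, has⟩ := M.exists_survival_succ (π := π) (n + 1) s
    rw [← has]
    exact (mul_le_mul_of_nonneg_left (M.mean_mono s a ih) (Real.exp_pos _).le).trans
      (le_survival_succ n ha)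

/-- If every end component without surveillance states has an action of positive cost, cost and
visits cannot both stay bounded: otherwise the states where the limit of `survival` is maximal
would form a closed set of actions without cost and without visits. -/
theorem tendsto_survival [Finite A]
    (hEC : ∀ E : Sub S A, E.IsEC M → (∀ s ∈ E.states, s ∉ M.sur π) →
      ∃ s ∈ E.states, ∃ a ∈ E.act s, 0 < M.g s a) (s : S) :
    Tendsto (fun n => M.survival π n s) atTop (nhds 0) := by
  classical
  have hanti : ∀ s, Antitone fun n => M.survival π n s :=
    fun s => antitone_nat_of_succ_le fun n => survival_succ_le n s
  have hbdd : ∀ s, BddBelow (Set.range fun n => M.survival π n s) := fun s =>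
    ⟨0, by rintro _ ⟨n, rfl⟩; exact survival_nonneg n s⟩
  set r : S → ℝ := fun s => ⨅ n, M.survival π n s with hr
  have hlim : ∀ s, Tendsto (fun n => M.survival π n s) atTop (nhds (r s)) :=
    fun s => tendsto_atTop_ciInf (hanti s) (hbdd s)
  have hrle : ∀ n s, r s ≤ M.survival π n s := fun n s => ciInf_le (hbdd s) n
  have hr0 : ∀ s, 0 ≤ r s := fun s => le_ciInf fun n => survival_nonneg n s
  have hmeanlim : ∀ s a, Tendsto (fun n => M.mean s a (M.survival π n)) atTop
      (nhds (M.mean s a r)) := fun s a =>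
    tendsto_finsetSum _ fun y _ => (hlim y).const_mul _
  -- `r` is attained by some action
  have hatt : ∀ s, ∃ a ∈ M.enabled s,
      r s ≤ Real.exp (-(M.g s a + M.ind π s)) * M.mean s a r := by
    intro s
    by_contra hcon
    push Not at hcon
    have h1 : ∀ a, ∀ᶠ n in atTop, a ∈ M.enabled s →
        Real.exp (-(M.g s a + M.ind π s)) * M.mean s a (M.survival π n) < r s := by
      intro a
      by_cases ha : a ∈ M.enabled s
      · filter_upwards [((hmeanlim s a).const_mul _).eventually_lt_const (hcon a ha)] with n hn _
        exact hn
      · exact Eventually.of_forall fun n h => absurd h ha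
    obtain ⟨n, hn⟩ := (eventually_all.2 h1).exists
    obtain ⟨a, ha, has⟩ := M.exists_survival_succ (π := π) n s
    have := hn a ha
    rw [has] at this
    exact absurd (hrle (n + 1) s) (not_le.2 this)
  have : Nonempty S := ⟨s⟩
  obtain ⟨x₀, hx₀⟩ := Finite.exists_max r
  suffices h : r x₀ = 0 by
    have h0 : r s = 0 := le_antisymm (h ▸ hx₀ s) (hr0 s)
    rw [← h0]; exact hlim s
  by_contra hne
  have hpos : 0 < r x₀ := lt_of_le_of_ne (hr0 x₀) (Ne.symm hne)
  set act : S → Set A := fun s => {a | a ∈ M.enabled s ∧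
    r x₀ ≤ Real.exp (-(M.g s a + M.ind π s)) * M.mean s a r} with hact
  have hmean_le : ∀ s, ∀ a ∈ M.enabled s, M.mean s a r ≤ r x₀ := fun s a ha => by
    have := M.mean_mono s a (f' := fun _ => r x₀) hx₀
    rwa [mean_const _ ha] at this
  have hzero : ∀ s, ∀ a ∈ act s, M.g s a + M.ind π s = 0 ∧ M.mean s a r = r x₀ := by
    rintro s a ⟨ha, hle⟩
    have h1 := hmean_le s a ha
    have h2 : 0 ≤ M.g s a + M.ind π s := add_nonneg (M.g_nonneg _ _) (M.ind_nonneg _ _)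
    have h3 : Real.exp (-(M.g s a + M.ind π s)) ≤ 1 := Real.exp_le_one_iff.2 (by linarith)
    have h5 : 0 ≤ M.mean s a r := M.mean_nonneg _ _ hr0
    have h4 : M.mean s a r = r x₀ := le_antisymm h1 (hle.trans (mul_le_of_le_one_left h5 h3))
    rw [h4] at hle
    have h6 : 1 ≤ Real.exp (-(M.g s a + M.ind π s)) := by
      by_contra hlt
      have := mul_lt_mul_of_pos_right (not_le.1 hlt) hpos
      linarith
    have h7 := Real.one_le_exp_iff.1 h6
    exact ⟨by linarith, h4⟩
  obtain ⟨N, hN, hNE, hNact⟩ := Sub.exists_isEC (M := M)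
    (E := Finset.univ.filter fun s => r s = r x₀)
    ⟨x₀, by simp⟩ (act := act) (fun s hs => by
      obtain ⟨a, ha, hle⟩ := hatt s
      rw [(Finset.mem_filter.1 hs).2] at hle
      exact ⟨a, ha, hle⟩)
    (fun s _ a ha => ha.1) (by
      intro s hs a ha y hy
      refine Finset.mem_filter.2 ⟨Finset.mem_univ _, ?_⟩
      have h1 := mean_sub_le ha.1 hx₀ y
      rw [(hzero s a ha).2] at h1
      have h2 := hx₀ y
      by_contra hne
      have := mul_pos hy (sub_pos.2 (lt_of_le_of_ne h2 hne))
      linarith)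
  obtain ⟨x, hx, a, ha, hg⟩ := hEC N hN (fun x hx hxB => by
    obtain ⟨a, ha⟩ := hN.act_nonempty x hx
    have h1 := (hzero x a (hNact x ha)).1
    rw [ind_of_mem _ hxB] at h1
    linarith [M.g_nonneg x a])
  have h1 := (hzero x a (hNact x ha)).1
  linarith [M.ind_nonneg π x]

section

variable [MeasurableSpace S] [MeasurableSingletonClass S]

theorem lintegral_survival_le [Finite A] (C : M.Strategy) (s : S) (n k : ℕ) :
    ∫⁻ ρ, ENNReal.ofReal (Real.exp (-(total M.g C n ρ + M.visits π n ρ)) *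
      M.survival π k (ρ n)) ∂M.law C s ≤ ENNReal.ofReal (M.survival π (k + n) s) := by
  induction n generalizing k with
  | zero =>
    have := lintegral_law_zero C s fun x => ENNReal.ofReal (M.survival π k x)
    simp [total, visits, this]
  | succ n ih =>
    rw [lintegral_law_succ C s n (Φ := fun ρ y =>
      Real.exp (-(total M.g C (n + 1) ρ + M.visits π (n + 1) ρ)) * M.survival π k y)]
    · refine (lintegral_mono fun ρ => ENNReal.ofReal_le_ofReal ?_).trans
        ((ih (k + 1)).trans_eq (by rw [add_right_comm, add_assoc]))
      have h1 : total M.g C (n + 1) ρ = total M.g C n ρ + M.g (ρ n) (C.act n fun j => ρ j) :=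
        Finset.sum_range_succ _ _
      have h2 := le_survival_succ (π := π) k (C.mem n fun j => ρ j)
      rw [mean_mul, h1, visits_succ,
        show -(total M.g C n ρ + M.g (ρ n) (C.act n fun j => ρ j) +
          (M.visits π n ρ + M.ind π (ρ n))) = -(total M.g C n ρ + M.visits π n ρ) +
          -(M.g (ρ n) (C.act n fun j => ρ j) + M.ind π (ρ n)) by ring, Real.exp_add, mul_assoc]
      exact mul_le_mul_of_nonneg_left h2 (Real.exp_pos _).le
    · exact fun ρ y => mul_nonneg (Real.exp_pos _).le (survival_nonneg _ _)
    · intro ρ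
      funext y
      rw [total_freeze _ _ le_rfl, visits_freeze _ le_rfl]

/-- If every end component without surveillance states has an action of positive cost, then under
every strategy the number of cycles or the cost diverges in probability. -/
theorem tendsto_visits_total_lt [Finite A]
    (hEC : ∀ E : Sub S A, E.IsEC M → (∀ s ∈ E.states, s ∉ M.sur π) →
      ∃ s ∈ E.states, ∃ a ∈ E.act s, 0 < M.g s a) (C : M.Strategy) (s : S) (m L : ℝ) :
    Tendsto (fun n => M.law C s {ρ | M.visits π n ρ < m ∧ total M.g C n ρ < L}) atTop
      (nhds 0) := by
  have hlim : Tendsto (fun n => ENNReal.ofReal (Real.exp (m + L) * M.survival π n s)) atTop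
      (nhds 0) := by
    rw [← ENNReal.ofReal_zero, ← mul_zero (Real.exp (m + L))]
    exact ENNReal.tendsto_ofReal ((tendsto_survival hEC s).const_mul _)
  refine tendsto_of_tendsto_of_tendsto_of_le_of_le tendsto_const_nhds hlim (fun _ => bot_le)
    fun n => ?_
  have h1 := lintegral_survival_le (π := π) C s n 0
  rw [zero_add] at h1
  have hmeas : Measurable fun ρ => ENNReal.ofReal (Real.exp
      (-(total M.g C n ρ + M.visits π n ρ)) * M.survival π 0 (ρ n)) := by
    have := measurable_total M.g C n
    have := measurable_visits (M := M) π n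
    have : Measurable fun ρ : ℕ → S => M.survival π 0 (ρ n) := measurable_const
    fun_prop
  have h2 := (mul_meas_ge_le_lintegral₀ hmeas.aemeasurable
    (ENNReal.ofReal (Real.exp (-(m + L))))).trans h1
  have h3 : {ρ | M.visits π n ρ < m ∧ total M.g C n ρ < L} ⊆
      {ρ | ENNReal.ofReal (Real.exp (-(m + L))) ≤ ENNReal.ofReal (Real.exp
        (-(total M.g C n ρ + M.visits π n ρ)) * M.survival π 0 (ρ n))} := by
    intro ρ hρ
    refine ENNReal.ofReal_le_ofReal ?_
    change _ ≤ _ * (1 : ℝ)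
    rw [mul_one]
    exact Real.exp_le_exp.2 (by linarith [hρ.1, hρ.2])
  calc M.law C s {ρ | M.visits π n ρ < m ∧ total M.g C n ρ < L}
      = ENNReal.ofReal (Real.exp (m + L)) * (ENNReal.ofReal (Real.exp (-(m + L))) *
          M.law C s {ρ | M.visits π n ρ < m ∧ total M.g C n ρ < L}) := by
        rw [← mul_assoc, ← ENNReal.ofReal_mul (Real.exp_pos _).le, ← Real.exp_add]
        simp
    _ ≤ ENNReal.ofReal (Real.exp (m + L)) * ENNReal.ofReal (M.survival π n s) := by
        gcongr
        exact (mul_le_mul_right (measure_mono h3) _).trans h2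
    _ = _ := (ENNReal.ofReal_mul (Real.exp_pos _).le).symm

end

end MDP

/-! ### The invariant of the reduction -/

section Reduction

theorem merge_eq_some_left {S A : Type*} {ζ ζ' : S → Option A} {s : S} {a : A}
    (h : ζ s = some a) : merge ζ ζ' s = some a := by simp [merge, h]

theorem merge_eq_some_right {S A : Type*} {ζ ζ' : S → Option A} (hc : Compatible ζ ζ') {s : S}
    {a : A} (h : ζ' s = some a) : merge ζ ζ' s = some a := by
  rcases hs : ζ s with _ | b
  · simp [merge, hs, h]
  · simp [merge, hs, hc s b a hs h]

theorem merge_eq_some {S A : Type*} {ζ ζ' : S → Option A} {s : S} {a : A}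
    (h : merge ζ ζ' s = some a) : ζ s = some a ∨ ζ' s = some a := by
  rcases hs : ζ s with _ | b
  · right; simpa [merge, hs] using h
  · left; simpa [merge, hs] using h

/-- Every state can be eliminated. -/
theorem Aux.exists_elim {S A : Type*} {X : Aux S A} {v : S} (hv : v ∈ X.states) :
    ∃ X', X.Elim v X' := by
  classical
  have key : ∀ (u : S) (ξ : S → Option A), ∃ p c, (∃ p c, X.Outcome v u ξ p c) →
      X.Outcome v u ξ p c := by
    intro u ξ
    by_cases h : ∃ p c, X.Outcome v u ξ p c
    · obtain ⟨p, c, h⟩ := h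
      exact ⟨p, c, fun _ => h⟩
    · exact ⟨fun _ => 0, 0, fun h' => absurd h' h⟩
  choose P g hPg using key
  exact ⟨⟨X.states.erase v, fun u => {ξ | ∃ p c, X.Outcome v u ξ p c}, P, g⟩, hv,
    fun u => by rw [Finset.mem_erase, and_comm], fun u _ ξ => Iff.rfl, fun u _ ξ hξ => hPg u ξ hξ⟩

variable {S A AP : Type*} [Fintype S]

/-- `ζ` is a partial stationary strategy that is defined in `u` and otherwise only outside `W`. From
`u` it almost surely returns to `W`, with hitting probabilities `p` and expected cost `c`. The last
two facts are encoded through test functions: `sub` is the optional stopping inequality for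
functions that are subharmonic, with running cost `κ g`, where `ζ` is defined outside `W`. (It is an
equality for harmonic functions, as the signs of `f` and `κ` are arbitrary.) `reach` says that
`ζ` is not defined in states outside `W` that it does not reach from `u`. -/
structure Valid (M : MDP S A AP) (W : Finset S) (u : S) (ζ : S → Option A) (p : S → ℝ) (c : ℝ) :
    Prop where
  isSome : ∃ a, ζ u = some a
  enabled : M.IsPartialStationary ζ
  eq_none : ∀ w ∈ W, w ≠ u → ζ w = none
  p_nonneg : ∀ w ∈ W, 0 ≤ p w
  c_nonneg : 0 ≤ c
  sub : ∀ (κ : ℝ) (f : S → ℝ),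
    (∀ s ∉ W, ∀ a, ζ s = some a → f s ≤ κ * M.g s a + M.mean s a f) →
    ∀ a, ζ u = some a → κ * M.g u a + M.mean u a f ≤ κ * c + ∑ w ∈ W, p w * f w
  reach : ∀ f : S → ℝ, (∀ s, 0 ≤ f s) →
    (∀ s ∉ W, ∀ a, ζ s = some a → M.mean s a f ≤ f s) →
    ∀ a, ζ u = some a → M.mean u a f ≤ 0 → ∀ s ∉ W, ∀ a, ζ s = some a → f s ≤ 0

namespace Valid

variable {M : MDP S A AP} {W : Finset S} {u : S} {ζ : S → Option A} {p : S → ℝ} {c : ℝ}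

/-- The test inequality for `-κ` and `-f`. -/
theorem super (h : Valid M W u ζ p c) (κ : ℝ) (f : S → ℝ)
    (hf : ∀ s ∉ W, ∀ a, ζ s = some a → κ * M.g s a + M.mean s a f ≤ f s)
    {a : A} (ha : ζ u = some a) : κ * c + ∑ w ∈ W, p w * f w ≤ κ * M.g u a + M.mean u a f := by
  have := h.sub (-κ) (fun y => - f y) (fun s hs a ha => by
    rw [MDP.mean_neg]; linarith [hf s hs a ha]) a ha
  rw [MDP.mean_neg] at this
  simp only [mul_neg, Finset.sum_neg_distrib] at this
  linarith

theorem eq (h : Valid M W u ζ p c) (κ : ℝ) (f : S → ℝ)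
    (hf : ∀ s ∉ W, ∀ a, ζ s = some a → f s = κ * M.g s a + M.mean s a f)
    {a : A} (ha : ζ u = some a) : κ * M.g u a + M.mean u a f = κ * c + ∑ w ∈ W, p w * f w :=
  le_antisymm (h.sub κ f (fun s hs a ha => (hf s hs a ha).le) a ha)
    (h.super κ f (fun s hs a ha => (hf s hs a ha).ge) ha)

theorem sum_eq_one (h : Valid M W u ζ p c) : ∑ w ∈ W, p w = 1 := by
  obtain ⟨a, ha⟩ := h.isSome
  have := h.eq 0 (fun _ => 1) (fun s _ a ha => by
    rw [MDP.mean_const _ (h.enabled s a ha)]; ring) ha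
  rw [MDP.mean_const _ (h.enabled u a ha)] at this
  simpa using this.symm

/-- The union of two actions when the state `v` is eliminated. -/
theorem merge [DecidableEq S] {v : S} {ζ' : S → Option A} {p' : S → ℝ} {c' : ℝ}
    (h : Valid M W u ζ p c)
    (h' : Valid M W v ζ' p' c') (hu : u ∈ W) (hv : v ∈ W) (huv : u ≠ v) (hpos : 0 < p v)
    (hlt : p' v < 1) (hc : Compatible ζ ζ') :
    Valid M (W.erase v) u (merge ζ ζ') (fun w => p w + p v * (p' w / (1 - p' v)))
      (c + p v * (c' / (1 - p' v))) := by
  have hlt' : 0 < 1 - p' v := by linarith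
  obtain ⟨b, hb⟩ := h'.isSome
  obtain ⟨b', hb'⟩ := h.isSome
  refine ⟨⟨b', merge_eq_some_left hb'⟩, ?_, ?_, ?_, ?_, ?_, ?_⟩
  · intro s a hs
    rcases merge_eq_some hs with hs | hs
    · exact h.enabled s a hs
    · exact h'.enabled s a hs
  · intro w hw hwu
    obtain ⟨hwv, hwW⟩ := Finset.mem_erase.1 hw
    simp [ACPC.merge, h.eq_none w hwW hwu, h'.eq_none w hwW hwv]
  · intro w hw
    have hwW := Finset.mem_of_mem_erase hw
    exact add_nonneg (h.p_nonneg w hwW)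
      (mul_nonneg hpos.le (div_nonneg (h'.p_nonneg w hwW) hlt'.le))
  · exact add_nonneg h.c_nonneg (mul_nonneg hpos.le (div_nonneg h'.c_nonneg hlt'.le))
  · intro κ f hf a ha
    have hua : ζ u = some a := by
      rcases merge_eq_some ha with h1 | h1
      · exact h1
      · rw [h'.eq_none u hu huv] at h1; cases h1
    have h1 := h.sub κ f (fun s hs a ha =>
      hf s (fun h => hs (Finset.mem_of_mem_erase h)) a (merge_eq_some_left ha)) a hua
    have h2 := h'.sub κ f (fun s hs a ha =>
      hf s (fun h => hs (Finset.mem_of_mem_erase h)) a (merge_eq_some_right hc ha)) b hb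
    have h3 := hf v (Finset.notMem_erase v W) b (merge_eq_some_right hc hb)
    rw [← Finset.add_sum_erase W _ hv] at h1 h2
    have h4 : f v ≤ κ * (c' / (1 - p' v)) +
        ∑ w ∈ W.erase v, p' w / (1 - p' v) * f w := by
      have h5 : κ * (c' / (1 - p' v)) + ∑ w ∈ W.erase v, p' w / (1 - p' v) * f w =
          (κ * c' + ∑ w ∈ W.erase v, p' w * f w) / (1 - p' v) := by
        rw [add_div, Finset.sum_div, mul_div_assoc]
        congr 1
        exact Finset.sum_congr rfl fun w _ => by ring
      rw [h5, le_div_iff₀ hlt']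
      linarith
    have h6 := mul_le_mul_of_nonneg_left h4 hpos.le
    have h7 : ∑ w ∈ W.erase v, (p w + p v * (p' w / (1 - p' v))) * f w =
        ∑ w ∈ W.erase v, p w * f w + p v * ∑ w ∈ W.erase v, p' w / (1 - p' v) * f w := by
      rw [Finset.mul_sum, ← Finset.sum_add_distrib]
      exact Finset.sum_congr rfl fun w _ => by ring
    rw [h7]
    linarith
  · intro f hf0 hf a ha hle s hs e he
    have hua : ζ u = some a := by
      rcases merge_eq_some ha with h1 | h1
      · exact h1
      · rw [h'.eq_none u hu huv] at h1; cases h1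
    have hf1 : ∀ s ∉ W, ∀ a, ζ s = some a → M.mean s a f ≤ f s := fun s hs a ha =>
      hf s (fun h => hs (Finset.mem_of_mem_erase h)) a (merge_eq_some_left ha)
    have hf2 : ∀ s ∉ W, ∀ a, ζ' s = some a → M.mean s a f ≤ f s := fun s hs a ha =>
      hf s (fun h => hs (Finset.mem_of_mem_erase h)) a (merge_eq_some_right hc ha)
    have h1 := h.reach f hf0 hf1 a hua hle
    have h2 := h.super 0 f (fun s hs a ha => by simpa using hf1 s hs a ha) hua
    -- `f` vanishes in `v`, which is reached from `u`
    have h3 : p v * f v ≤ ∑ w ∈ W, p w * f w :=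
      Finset.single_le_sum (f := fun w => p w * f w)
        (fun w hw => mul_nonneg (h.p_nonneg w hw) (hf0 w)) hv
    have h4 : f v ≤ 0 := by
      have : p v * f v ≤ 0 := by linarith
      exact nonpos_of_mul_nonpos_right this hpos
    have h5 := hf v (Finset.notMem_erase v W) b (merge_eq_some_right hc hb)
    have h6 := h'.reach f hf0 hf2 b hb (h5.trans h4)
    by_cases hsv : s = v
    · rwa [hsv]
    · have hsW : s ∉ W := fun h => hs (Finset.mem_erase.2 ⟨hsv, h⟩)
      rcases merge_eq_some he with he | he
      · exact h1 s hsW e he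
      · exact h6 s hsW e he

/-- An action that does not lead to the state `v` is kept when `v` is eliminated. -/
theorem erase [DecidableEq S] {v : S} (h : Valid M W u ζ p c) (hv : v ∈ W) (huv : u ≠ v)
    (hp : ¬ 0 < p v) : Valid M (W.erase v) u ζ p c := by
  have hp0 : p v = 0 := le_antisymm (not_lt.1 hp) (h.p_nonneg v hv)
  have hζv : ζ v = none := h.eq_none v hv huv.symm
  have hW : ∀ s ∉ W, s ∉ W.erase v := fun s hs h => hs (Finset.mem_of_mem_erase h)
  refine ⟨h.isSome, h.enabled, fun w hw => h.eq_none w (Finset.mem_of_mem_erase hw),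
    fun w hw => h.p_nonneg w (Finset.mem_of_mem_erase hw), h.c_nonneg, ?_, ?_⟩
  · intro κ f hf a ha
    have := h.sub κ f (fun s hs => hf s (hW s hs)) a ha
    rw [← Finset.add_sum_erase W _ hv, hp0] at this
    simpa using this
  · intro f hf0 hf a ha hle s hs e he
    refine h.reach f hf0 (fun s hs => hf s (hW s hs)) a ha hle s (fun hsW => ?_) e he
    have hsv : s = v := by
      by_contra hne
      exact hs (Finset.mem_erase.2 ⟨hne, hsW⟩)
    rw [hsv, hζv] at he
    cases he

end Valid

/-- The invariant of the reduction: the probabilities and costs of the auxiliary MDP are hitting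
probabilities and expected costs, and every state has an action that is contained in the given
stationary strategy `D`. -/
structure Aux.Inv (M : MDP S A AP) (π : AP) (D : M.Stationary) (X : Aux S A) : Prop where
  sur : M.sur π ⊆ X.states
  valid : ∀ u ∈ X.states, ∀ ζ ∈ X.act u, Valid M X.states u ζ (X.P u ζ) (X.g u ζ)
  exists_le : ∀ u ∈ X.states, ∃ ζ ∈ X.act u, ∀ s a, ζ s = some a → a = D.act s

namespace Aux

variable {M : MDP S A AP} {π : AP} {D : M.Stationary} {X X' : Aux S A}

theorem Inv.init : Aux.Inv M π D (Aux.init M) := by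
  refine ⟨Finset.subset_univ _, ?_, ?_⟩
  · classical
    rintro u - ζ ⟨a, ha, rfl⟩
    have hout : ∀ s a', (if s = u then some a else none) = some a' → s = u ∧ a' = a := by
      intro s a' h
      split_ifs at h with hs
      exact ⟨hs, (Option.some.inj h).symm⟩
    refine ⟨⟨a, if_pos rfl⟩, ?_, fun w _ hw => if_neg hw, ?_, ?_, ?_, ?_⟩
    · intro s a' hs
      obtain ⟨rfl, rfl⟩ := hout s a' hs
      exact ha
    · intro w _
      simpa [Aux.init] using M.P_nonneg u a w
    · simpa [Aux.init] using M.g_nonneg u a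
    · intro κ f _ a' ha'
      obtain ⟨-, rfl⟩ := hout u a' ha'
      simp [Aux.init, MDP.mean]
    · intro f _ _ _ _ _ s hs
      exact absurd (Finset.mem_univ s) hs
  · intro u _
    refine ⟨_, ⟨D.act u, D.mem u, rfl⟩, fun s a h => ?_⟩
    split_ifs at h with hs
    rw [hs]
    exact (Option.some.inj h).symm

/-- Eliminating a state preserves the invariant. The action contained in `D` survives because
`D`, which reaches the surveillance states, cannot stay surely in the eliminated state. -/
theorem Inv.elim (h : Aux.Inv M π D X) (hD : D.Reaches π) {v : S} (hv : v ∉ M.sur π)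
    (hX : X.Elim v X') : Aux.Inv M π D X' := by
  classical
  have hst : X'.states = X.states.erase v := by
    ext u
    rw [hX.states, Finset.mem_erase, and_comm]
  refine ⟨?_, ?_, ?_⟩
  · intro u hu
    rw [hst]
    exact Finset.mem_erase.2 ⟨fun h => hv (h ▸ hu), h.sur hu⟩
  · intro u hu ζ hζ
    obtain ⟨huX, huv⟩ := (hX.states u).1 hu
    rw [hst]
    rcases hX.val u hu ζ hζ with ⟨hζX, hp, hP, hg⟩ | ⟨ζo, hζo, ζv, hζv, hpos, hlt, hc, rfl, hP, hg⟩
    · rw [hP, hg]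
      exact (h.valid u huX ζ hζX).erase hX.mem huv hp
    · have hP' : X'.P u (merge ζo ζv) = fun w =>
          X.P u ζo w + X.P u ζo v * (X.P v ζv w / (1 - X.P v ζv v)) := funext hP
      rw [hP', hg]
      exact (h.valid u huX ζo hζo).merge (h.valid v hX.mem ζv hζv) huX hX.mem huv hpos hlt hc
  · intro u hu
    obtain ⟨huX, huv⟩ := (hX.states u).1 hu
    obtain ⟨ζo, hζo, hζoD⟩ := h.exists_le u huX
    by_cases hpos : 0 < X.P u ζo v
    · obtain ⟨ζv, hζv, hζvD⟩ := h.exists_le v hX.mem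
      have hval := h.valid v hX.mem ζv hζv
      have hc : Compatible ζo ζv := fun s a b ha hb => (hζoD s a ha).trans (hζvD s b hb).symm
      have hlt : X.P v ζv v < 1 := by
        by_contra hge
        -- otherwise `ζv` stays in `v`, where the expected hitting time `ℓ` of `D` drops by one
        obtain ⟨ℓ, hℓ, -⟩ := exists_harmonic (K := fun x y => M.P x (D.act x) y)
          (G := (↑(M.sur π) : Set S)ᶜ) (fun x y => M.P_nonneg _ _ _) (fun x _ => D.mem x)
          (fun x => by
            obtain ⟨z, hz, hxz⟩ := hD x
            exact ⟨z, by simpa using hz, hxz⟩) (fun _ => 1)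
        obtain ⟨a, ha⟩ := hval.isSome
        have hone := hval.sum_eq_one
        have hv1 : X.P v ζv v = 1 := by
          refine le_antisymm ?_ (not_lt.1 hge)
          rw [← hone]
          exact Finset.single_le_sum (f := fun w => X.P v ζv w)
            (fun w hw => hval.p_nonneg w hw) hX.mem
        have h0 : ∀ w ∈ X.states, w ≠ v → X.P v ζv w = 0 := by
          intro w hw hwv
          rw [← Finset.add_sum_erase _ _ hX.mem, hv1] at hone
          have h1 : ∑ w ∈ X.states.erase v, X.P v ζv w = 0 := by linarith
          exact (Finset.sum_eq_zero_iff_of_nonneg fun w hw =>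
            hval.p_nonneg w (Finset.mem_of_mem_erase hw)).1 h1 w (Finset.mem_erase.2 ⟨hwv, hw⟩)
        have h2 := hval.super 0 ℓ (fun s hs a ha => by
          rw [hζvD s a ha]
          have := hℓ s (fun h' => hs (h.sur h'))
          have h3 : M.mean s (D.act s) ℓ = ∑ y, M.P s (D.act s) y * ℓ y := rfl
          linarith) ha
        have h4 : ∑ w ∈ X.states, X.P v ζv w * ℓ w = ℓ v := by
          rw [Finset.sum_eq_single_of_mem v hX.mem fun w hw hwv => by rw [h0 w hw hwv, zero_mul],
            hv1, one_mul]
        have h5 := hℓ v hv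
        have h6 : M.mean v a ℓ = ∑ y, M.P v (D.act v) y * ℓ y := by rw [hζvD v a ha]; rfl
        rw [h4, h6] at h2
        linarith
      refine ⟨merge ζo ζv, (hX.act u hu _).2 ⟨_, _, Or.inr ⟨ζo, hζo, ζv, hζv, hpos, hlt, hc, rfl,
        fun w => rfl, rfl⟩⟩, fun s a hs => ?_⟩
      rcases merge_eq_some hs with hs | hs
      · exact hζoD s a hs
      · exact hζvD s a hs
    · exact ⟨ζo, (hX.act u hu _).2 ⟨_, _, Or.inl ⟨hζo, hpos, rfl, rfl⟩⟩, hζoD⟩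

theorem IsOutput.inv (hX : IsOutput M π X) (hD : D.Reaches π) : Aux.Inv M π D X := by
  obtain ⟨hred, -⟩ := hX
  induction hred with
  | refl => exact Inv.init
  | tail _ hstep ih =>
    obtain ⟨v, hv, hel⟩ := hstep
    exact ih.elim hD hv hel

theorem exists_isOutput (M : MDP S A AP) (π : AP) : ∃ X, IsOutput M π X := by
  classical
  have key : ∀ Z : Finset S, Z ⊆ Finset.univ \ M.sur π → ∃ X : Aux S A,
      Relation.ReflTransGen (fun Y Y' => ∃ v, v ∉ M.sur π ∧ Y.Elim v Y') (init M) X ∧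
      X.states = Finset.univ \ Z := by
    intro Z
    induction Z using Finset.induction_on with
    | empty => exact fun _ => ⟨init M, .refl, by simp [init]⟩
    | insert v Z hvZ ih =>
      intro hZ
      obtain ⟨X, hX, hXs⟩ := ih ((Finset.subset_insert v Z).trans hZ)
      obtain ⟨X', hX'⟩ := exists_elim (X := X) (v := v) (by simp [hXs, hvZ])
      have hv : v ∉ M.sur π := (Finset.mem_sdiff.1 (hZ (Finset.mem_insert_self v Z))).2
      refine ⟨X', hX.tail ⟨v, hv, hX'⟩, ?_⟩
      ext u
      rw [hX'.states, hXs]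
      simp only [Finset.mem_sdiff, Finset.mem_univ, true_and, Finset.mem_insert, not_or]
      tauto
  obtain ⟨X, hX, hXs⟩ := key _ subset_rfl
  exact ⟨X, hX, by simpa using hXs⟩

end Aux

end Reduction

/-! ### Cycles of partial stationary strategies -/

section Cycles

namespace MDP

variable {S A AP : Type*} [Fintype S] {M : MDP S A AP} {ζ : S → Option A}

theorem sum_partialNext_none (F : Option S → ℝ≥0∞) :
    ∑ y, M.partialNext ζ none y * F y = F none := by
  classical
  simp [partialNext, PMF.pure_apply]

theorem sum_partialNext_of_eq_none {s : S} (h : ζ s = none) (F : Option S → ℝ≥0∞) :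
    ∑ y, M.partialNext ζ (some s) y * F y = F none := by
  classical
  have h' : ¬ ∃ a, ζ s = some a ∧ a ∈ M.enabled s := by simp [h]
  simp [partialNext, h', PMF.pure_apply]

theorem sum_partialNext {s : S} {a : A} (h : ζ s = some a) (ha : a ∈ M.enabled s)
    (F : Option S → ℝ≥0∞) :
    ∑ y, M.partialNext ζ (some s) y * F y = ∑ y, ENNReal.ofReal (M.P s a y) * F (some y) := by
  classical
  have h' : ∃ a, ζ s = some a ∧ a ∈ M.enabled s := ⟨a, h, ha⟩
  have hch : h'.choose = a := Option.some.inj (h'.choose_spec.1.symm.trans h)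
  have hnext : ∀ y, M.next s h'.choose h'.choose_spec.2 y = ENNReal.ofReal (M.P s a y) := by
    intro y
    rw [← hch]
    rfl
  rw [Fintype.sum_option]
  have h0 : M.partialNext ζ (some s) none = 0 := by
    simp [partialNext, h', PMF.map_apply]
  have h1 : ∀ y, M.partialNext ζ (some s) (some y) = ENNReal.ofReal (M.P s a y) := by
    intro y
    rw [← hnext]
    simp only [partialNext, h', dif_pos, PMF.map_apply, Option.some.injEq]
    rw [tsum_eq_single y (fun z hz => if_neg hz.symm), if_pos rfl]
  rw [h0, zero_mul, zero_add]
  exact Finset.sum_congr rfl fun y _ => by rw [h1]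

theorem ofReal_mean (s : S) (a : A) {f : S → ℝ} (hf : ∀ y, 0 ≤ f y) :
    ENNReal.ofReal (M.mean s a f) = ∑ y, ENNReal.ofReal (M.P s a y) * ENNReal.ofReal (f y) := by
  rw [mean, ENNReal.ofReal_sum_of_nonneg fun y _ => mul_nonneg (M.P_nonneg _ _ _) (hf _)]
  exact Finset.sum_congr rfl fun y _ => ENNReal.ofReal_mul (M.P_nonneg _ _ _)

end MDP

variable {S A AP : Type*} [Fintype S] {M : MDP S A AP}

namespace Valid

variable {W : Finset S} {v : S} {ζ : S → Option A} {p : S → ℝ} {c : ℝ}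

/-- The set `Q` of the states where all non-negative functions vanish that vanish on `W` and are
subharmonic where `ζ` is defined outside `W`. It contains the successors of `v` and is closed under
the steps of `ζ` outside `W`, so by `Valid.reach` it contains all states where `ζ` is defined. -/
theorem subharmonic_nonpos (h : Valid M W v ζ p c) :
    ∃ Q : Set S, (∀ s ∈ Q, ∀ f : S → ℝ, (∀ s, 0 ≤ f s) → (∀ s ∈ W, f s = 0) →
        (∀ s ∉ W, ∀ a, ζ s = some a → f s ≤ M.mean s a f) → f s ≤ 0) ∧
      (∀ s ∉ W, ∀ a, ζ s = some a → s ∈ Q) ∧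
      ∀ s a y, s = v ∨ s ∉ W → ζ s = some a → 0 < M.P s a y → y ∈ Q := by
  classical
  set good : (S → ℝ) → Prop := fun f => (∀ s, 0 ≤ f s) ∧ (∀ s ∈ W, f s = 0) ∧
    ∀ s ∉ W, ∀ a, ζ s = some a → f s ≤ M.mean s a f with hgood
  set Q : Set S := {s | ∀ f, good f → f s ≤ 0} with hQ
  have hsingle : ∀ s a y (f : S → ℝ), (∀ s, 0 ≤ f s) → M.mean s a f ≤ 0 → 0 < M.P s a y →
      f y ≤ 0 := by
    intro s a y f hf hle hy
    have h1 : M.P s a y * f y ≤ M.mean s a f :=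
      Finset.single_le_sum (f := fun y => M.P s a y * f y)
        (fun y _ => mul_nonneg (M.P_nonneg _ _ _) (hf y)) (Finset.mem_univ y)
    exact nonpos_of_mul_nonpos_right (h1.trans hle) hy
  have hstart : ∀ a y, ζ v = some a → 0 < M.P v a y → y ∈ Q := by
    intro a y ha hy f hf
    refine hsingle v a y f hf.1 ?_ hy
    have h1 := h.sub 0 f (fun s hs a ha => by simpa using hf.2.2 s hs a ha) a ha
    have h2 : ∑ w ∈ W, p w * f w = 0 :=
      Finset.sum_eq_zero fun w hw => by rw [hf.2.1 w hw, mul_zero]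
    rw [h2] at h1
    simpa using h1
  have hstep : ∀ s ∈ Q, s ∉ W → ∀ a y, ζ s = some a → 0 < M.P s a y → y ∈ Q := by
    intro s hs hsW a y ha hy f hf
    set f₁ : S → ℝ := fun x => if x ∈ W then 0 else
      match ζ x with
      | some b => M.mean x b f
      | none => f x with hf₁
    have hf₁W : ∀ x ∈ W, f₁ x = 0 := fun x hx => by simp [hf₁, hx]
    have hf₁s : ∀ x ∉ W, ∀ b, ζ x = some b → f₁ x = M.mean x b f := fun x hx b hb => by
      simp [hf₁, hx, hb]
    have hle : ∀ x, f x ≤ f₁ x := by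
      intro x
      by_cases hx : x ∈ W
      · rw [hf₁W x hx, hf.2.1 x hx]
      · rcases hb : ζ x with _ | b
        · simp [hf₁, hx, hb]
        · rw [hf₁s x hx b hb]
          exact hf.2.2 x hx b hb
    have hgood₁ : good f₁ := ⟨fun x => (hf.1 x).trans (hle x), hf₁W, fun x hx b hb => by
      rw [hf₁s x hx b hb]
      exact M.mean_mono x b hle⟩
    have h1 := hs f₁ hgood₁
    rw [hf₁s s hsW a ha] at h1
    exact hsingle s a y f hf.1 h1 hy
  have hdom : ∀ s ∉ W, ∀ a, ζ s = some a → s ∈ Q := by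
    set g : S → ℝ := Qᶜ.indicator fun _ => 1 with hg
    have hg0 : ∀ s, 0 ≤ g s := fun s => Set.indicator_nonneg (fun _ _ => zero_le_one) s
    have hvanish : ∀ s a, (∀ y, 0 < M.P s a y → y ∈ Q) → M.mean s a g = 0 := by
      intro s a hs
      rw [M.mean_congr (f' := fun _ => 0) fun y hy =>
        Set.indicator_of_notMem (by simpa using hs y hy) _]
      simp [MDP.mean]
    intro s hs a ha
    obtain ⟨b, hb⟩ := h.isSome
    have h1 := h.reach g hg0 (fun x hx e he => by
      by_cases hxQ : x ∈ Q
      · rw [hvanish x e fun y hy => hstep x hxQ hx e y he hy]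
        exact hg0 x
      · rw [hg, Set.indicator_of_mem hxQ]
        exact (M.mean_mono _ _ fun y => Set.indicator_le_self' (fun _ _ => zero_le_one) y).trans_eq
          (M.mean_const (h.enabled x e he) 1))
      b hb (hvanish v b fun y hy => hstart b y hb hy).le s hs a ha
    by_contra hsQ
    rw [hg, Set.indicator_of_mem hsQ] at h1
    linarith
  refine ⟨Q, fun s hs f h0 h1 h2 => hs f ⟨h0, h1, h2⟩, hdom, ?_⟩
  rintro s a y (rfl | hs) ha hy
  · exact hstart a y ha hy
  · exact hstep s (hdom s hs a ha) hs a y ha hy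

/-- From every state where it is defined, `ζ` reaches `W` with positive probability. -/
theorem exists_reach (h : Valid M W v ζ p c) {s : S} (hs : s ∉ W) {a : A} (ha : ζ s = some a) :
    ∃ z ∈ W, Relation.ReflTransGen (fun x y => ∃ a, ζ x = some a ∧ 0 < M.P x a y) s z := by
  classical
  obtain ⟨Q, hQ, hdom, -⟩ := h.subharmonic_nonpos
  set r : S → S → Prop := fun x y => ∃ a, ζ x = some a ∧ 0 < M.P x a y
  by_contra hcon
  set f : S → ℝ := fun x => if ∃ z ∈ W, Relation.ReflTransGen r x z then 0 else 1 with hf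
  have h1 := hQ s (hdom s hs a ha) f (fun x => by simp only [hf]; split_ifs <;> norm_num)
    (fun x hx => if_pos ⟨x, hx, .refl⟩) (fun x hx b hb => by
      by_cases hxz : ∃ z ∈ W, Relation.ReflTransGen r x z
      · simp only [hf, hxz, if_true]
        exact M.mean_nonneg _ _ fun y => by split_ifs <;> norm_num
      · have h2 : M.mean x b f = M.mean x b fun _ => 1 := M.mean_congr fun y hy =>
          if_neg fun ⟨z, hz, hyz⟩ => hxz ⟨z, hz, .head ⟨b, hb, hy⟩ hyz⟩
        rw [h2, M.mean_const (h.enabled x b hb)]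
        simp only [hf, hxz, if_false]
        exact le_rfl)
  simp only [hf, hcon, if_false] at h1
  linarith

/-- The expected sum of `q` along the states outside `W` until `ζ` reaches `W`. -/
theorem exists_potential (h : Valid M W v ζ p c) {q : S → ℝ} (hq : ∀ s, 0 ≤ q s) :
    ∃ f : S → ℝ, (∀ s, 0 ≤ f s) ∧ (∀ s ∈ W, f s = 0) ∧ (∀ s, ζ s = none → f s = 0) ∧
      ∀ s ∉ W, ∀ a, ζ s = some a → f s = q s + M.mean s a f := by
  classical
  set G : Set S := {s | s ∉ W ∧ ζ s ≠ none} with hG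
  set K : S → S → ℝ := fun x y => match ζ x with
    | some a => M.P x a y
    | none => 0 with hK
  have hKs : ∀ x a, ζ x = some a → ∀ y, K x y = M.P x a y := fun x a ha y => by simp [hK, ha]
  have hK0 : ∀ x y, 0 ≤ K x y := by
    intro x y
    rcases hx : ζ x with _ | a
    · simp [hK, hx]
    · rw [hKs x a hx]; exact M.P_nonneg _ _ _
  have hK1 : ∀ x ∈ G, ∑ y, K x y = 1 := by
    rintro x ⟨-, hx⟩
    obtain ⟨a, ha⟩ := Option.ne_none_iff_exists'.1 hx
    simp only [hKs x a ha]
    exact h.enabled x a ha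
  have hreach : ∀ x, ∃ z ∈ Gᶜ, Relation.ReflTransGen (fun x y => 0 < K x y) x z := by
    intro x
    by_cases hx : x ∈ G
    · obtain ⟨a, ha⟩ := Option.ne_none_iff_exists'.1 hx.2
      obtain ⟨z, hz, hxz⟩ := h.exists_reach hx.1 ha
      refine ⟨z, fun hzG => hzG.1 hz, hxz.lift id fun y w hyw => ?_⟩
      obtain ⟨b, hb, hw⟩ := hyw
      change 0 < K y w
      rwa [hKs y b hb]
    · exact ⟨x, hx, .refl⟩
  obtain ⟨f, hf, hf'⟩ := exists_harmonic hK0 hK1 hreach (fun s => if s ∈ G then q s else 0)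
  have hf0 : ∀ s ∉ G, f s = 0 := fun s hs => by rw [hf' s hs, if_neg hs]
  refine ⟨f, fun s => ?_, fun s hs => hf0 s fun hsG => hsG.1 hs, fun s hs => hf0 s fun hsG =>
    hsG.2 hs, fun s hs a ha => ?_⟩
  · refine nonneg_of_superharmonic hK0 hK1 hreach (fun x hx => ?_) (fun x hx => (hf0 x hx).ge) s
    have := hf x hx
    rw [if_pos hx] at this
    linarith [hq x]
  · have hsG : s ∈ G := ⟨hs, by simp [ha]⟩
    rw [hf s hsG, if_pos hsG]
    simp only [hKs s a ha]
    rfl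

open Classical in
/-- The extension of `q` to the states of the chain of `ζ`; it vanishes where `ζ` ends. -/
noncomputable def lift (ζ : S → Option A) (q : S → ℝ) : Option S → ℝ≥0∞
  | none => 0
  | some s => if ζ s = none then 0 else ENNReal.ofReal (q s)

/-- The expected sum of `q` along `ζ` until the next visit to `W`. -/
theorem tsum_eq (h : Valid M W v ζ p c) {q : S → ℝ} (hq : ∀ s, 0 ≤ q s) {f : S → ℝ}
    (hf0 : ∀ s, 0 ≤ f s) (hfW : ∀ s ∈ W, f s = 0) (hfn : ∀ s, ζ s = none → f s = 0)
    (hf : ∀ s ∉ W, ∀ a, ζ s = some a → f s = q s + M.mean s a f) {a : A} (ha : ζ v = some a) :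
    ∑' i, ∫⁻ ρ, avoid (some '' (W : Set S)) i (fun j => ρ j) * lift ζ q (ρ i) ∂M.partialLaw ζ v =
      ENNReal.ofReal (q v + M.mean v a f) := by
  have hF : ∀ {q f : S → ℝ}, (∀ s, 0 ≤ q s) → (∀ s, 0 ≤ f s) → (∀ s, ζ s = none → f s = 0) →
      (∀ s ∉ W, ∀ a, ζ s = some a → f s = q s + M.mean s a f) →
      ∀ x ∉ some '' (W : Set S), lift ζ f x =
        lift ζ q x + ∑ y, M.partialNext ζ x y * lift ζ f y := by
    intro q f hq hf0 hfn hf x hx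
    have hlf : ∀ s, lift ζ f (some s) = ENNReal.ofReal (f s) := fun s => by
      by_cases hs : ζ s = none
      · simp [lift, hs, hfn s hs]
      · simp [lift, hs]
    rcases x with _ | s
    · rw [MDP.sum_partialNext_none]; simp [lift]
    · have hs : s ∉ W := fun h => hx ⟨s, h, rfl⟩
      rcases hb : ζ s with _ | b
      · rw [MDP.sum_partialNext_of_eq_none hb]
        simp [lift, hb]
      · rw [MDP.sum_partialNext hb (h.enabled s b hb)]
        simp only [hlf]
        rw [← MDP.ofReal_mean s b hf0]
        have : lift ζ q (some s) = ENNReal.ofReal (q s) := by simp [lift, hb]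
        rw [this, ← ENNReal.ofReal_add (hq s) (M.mean_nonneg _ _ hf0), hf s hs b hb]
  have hfin : ∀ q : S → ℝ, ∀ x, lift ζ q x ≠ ∞ := by
    intro q x
    rcases x with _ | s
    · simp [lift]
    · simp only [lift]
      split_ifs <;> simp
  have hzero : ∀ f : S → ℝ, (∀ s ∈ W, f s = 0) → ∀ x ∈ some '' (W : Set S), lift ζ f x = 0 := by
    rintro f hfW _ ⟨s, hs, rfl⟩
    simp [lift, hfW s hs]
  obtain ⟨ℓ, hℓ0, hℓW, hℓn, hℓ⟩ := h.exists_potential (q := fun _ => 1) fun _ => zero_le_one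
  have key := tsum_dynkin (some '' (W : Set S)) (M.partialNext ζ) (some v) (r := lift ζ q)
    (f := lift ζ f) (ℓ := lift ζ ℓ) (e := lift ζ fun _ => 1) (hzero f hfW)
    (hF hq hf0 hfn hf) (fun x hx => by
      rcases x with _ | s
      · simp [lift] at hx
      · by_cases hs : ζ s = none
        · simp [lift, hs] at hx
        · simp [lift, hs]) (hfin f) (hzero ℓ hℓW) (hF (fun _ => zero_le_one) hℓ0 hℓn hℓ) (hfin ℓ)
    (hfin _ _)
  refine key.trans ?_
  have hlf : ∀ s, lift ζ f (some s) = ENNReal.ofReal (f s) := fun s => by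
    by_cases hs : ζ s = none
    · simp [lift, hs, hfn s hs]
    · simp [lift, hs]
  rw [MDP.sum_partialNext ha (h.enabled v a ha)]
  simp only [hlf]
  rw [← MDP.ofReal_mean v a hf0, ENNReal.ofReal_add (hq v) (M.mean_nonneg _ _ hf0)]
  simp [lift, ha]

end Valid

variable {π : AP} {v : S} {ζ : S → Option A}
  {p : S → ℝ} {c : ℝ}

open Classical in
theorem avoid_sur_eq (n : ℕ) (ρ : ℕ → Option S) :
    avoid (some '' (M.sur π : Set S)) n (fun j => ρ j) =
      if ∀ j, 1 ≤ j → j ≤ n → ∀ s ∈ M.sur π, ρ j ≠ some s then 1 else 0 := by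
  unfold avoid
  congr 1
  refine propext ⟨fun H j hj hjn s hs hρ => ?_, fun H j hj => ?_⟩
  · exact H ⟨j, Finset.mem_Iic.2 hjn⟩ hj ⟨s, hs, hρ.symm⟩
  · rintro ⟨s, hs, hρ⟩
    exact H j.1 hj (Finset.mem_Iic.1 j.2) s hs hρ.symm

theorem Valid.cycleCost_eq (h : Valid M (M.sur π) v ζ p c) :
    M.cycleCost π ζ v = ENNReal.ofReal c := by
  classical
  obtain ⟨a, ha⟩ := h.isSome
  set q : S → ℝ := fun s => match ζ s with
    | some a => M.g s a
    | none => 0 with hq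
  have hqs : ∀ s a, ζ s = some a → q s = M.g s a := fun s a hs => by simp [hq, hs]
  have hq0 : ∀ s, 0 ≤ q s := by
    intro s
    rcases hs : ζ s with _ | b
    · simp [hq, hs]
    · rw [hqs s b hs]; exact M.g_nonneg _ _
  obtain ⟨f, hf0, hfW, hfn, hf⟩ := h.exists_potential hq0
  have h1 := h.tsum_eq hq0 hf0 hfW hfn hf ha
  have h2 := h.eq 1 f (fun s hs b hb => by rw [hf s hs b hb, hqs s b hb, one_mul]) ha
  rw [Finset.sum_eq_zero fun w hw => by rw [hfW w hw, mul_zero], one_mul, one_mul, add_zero,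
    ← hqs v a ha] at h2
  rw [h2] at h1
  rw [← h1]
  have hstage : ∀ x, M.partialStageCost ζ x = Valid.lift ζ q x := by
    rintro (_ | s)
    · rfl
    · rcases hs : ζ s with _ | b
      · simp [MDP.partialStageCost, Valid.lift, hs]
      · simp [MDP.partialStageCost, Valid.lift, hs, hqs s b hs]
  unfold MDP.cycleCost
  rw [← lintegral_tsum]
  · refine lintegral_congr fun ρ => tsum_congr fun i => ?_
    rw [avoid_sur_eq, Set.indicator_apply, hstage]
    simp only [Set.mem_ofPred_eq]
    split_ifs <;> simp
  · exact fun i => (measurable_of_history (fun k : Finset.Iic i → Option S =>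
      avoid (some '' (M.sur π : Set S)) i k * Valid.lift ζ q (last k))).aemeasurable

theorem Valid.nextSurProb_eq (h : Valid M (M.sur π) v ζ p c) {v' : S} (hv' : v' ∈ M.sur π) :
    M.nextSurProb π ζ v v' = ENNReal.ofReal (p v') := by
  classical
  obtain ⟨a, ha⟩ := h.isSome
  set q : S → ℝ := fun s => match ζ s with
    | some a => M.P s a v'
    | none => 0 with hq
  have hqs : ∀ s a, ζ s = some a → q s = M.P s a v' := fun s a hs => by simp [hq, hs]
  have hq0 : ∀ s, 0 ≤ q s := by
    intro s
    rcases hs : ζ s with _ | b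
    · simp [hq, hs]
    · rw [hqs s b hs]; exact M.P_nonneg _ _ _
  obtain ⟨f, hf0, hfW, hfn, hf⟩ := h.exists_potential hq0
  have h1 := h.tsum_eq hq0 hf0 hfW hfn hf ha
  -- with the boundary values `1` in `v'` and `0` elsewhere, `f` becomes harmonic
  set f' : S → ℝ := fun s => f s + if s = v' then 1 else 0 with hf'
  have hmean : ∀ s b, M.mean s b f' = M.P s b v' + M.mean s b f := by
    intro s b
    rw [hf', MDP.mean_add, add_comm]
    simp [MDP.mean]
  have h2 := h.eq 0 f' (fun s hs b hb => by
    have hsv : s ≠ v' := fun h => hs (h ▸ hv')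
    rw [hmean]
    simp only [hf', hsv, if_false]
    rw [hf s hs b hb, hqs s b hb]
    ring) ha
  have h3 : ∑ w ∈ M.sur π, p w * f' w = p v' := by
    rw [Finset.sum_eq_single_of_mem v' hv' fun w hw hne => by
      simp [hf', hfW w hw, hne]]
    simp [hf', hfW v' hv']
  rw [h3, hmean, zero_mul, zero_mul, zero_add, zero_add, ← hqs v a ha] at h2
  rw [h2] at h1
  rw [← h1]
  set E : ℕ → Set (ℕ → Option S) := fun i => {ρ | ρ (i + 1) = some v' ∧
    ∀ j, 1 ≤ j → j ≤ i → ∀ s ∈ M.sur π, ρ j ≠ some s} with hE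
  have hEind : ∀ i ρ, (E i).indicator 1 ρ = avoid (some '' (M.sur π : Set S)) i (fun j => ρ j) *
      (if ρ (i + 1) = some v' then 1 else 0 : ℝ≥0∞) := by
    intro i ρ
    rw [avoid_sur_eq, Set.indicator_apply]
    simp only [hE, Set.mem_ofPred_eq]
    split_ifs <;> simp_all
  have hEmeas : ∀ i, MeasurableSet (E i) := by
    intro i
    have h4 := measurable_of_history (fun k : Finset.Iic (i + 1) → Option S =>
      avoid (some '' (M.sur π : Set S)) i (fun j => k ⟨j, Finset.mem_Iic.2
        ((Finset.mem_Iic.1 j.2).trans i.le_succ)⟩) *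
        (if last k = some v' then 1 else 0 : ℝ≥0∞))
    have h5 : E i = (fun ρ : ℕ → Option S =>
        avoid (some '' (M.sur π : Set S)) i (fun j => ρ j) *
        (if ρ (i + 1) = some v' then 1 else 0 : ℝ≥0∞)) ⁻¹' {1} := by
      ext ρ
      rw [Set.mem_preimage, ← hEind, Set.mem_singleton_iff, Set.indicator_apply]
      by_cases hρ : ρ ∈ E i <;> simp [hρ]
    rw [h5]
    exact h4 (measurableSet_singleton 1)
  have hset : {ρ : ℕ → Option S | ∃ k, 1 ≤ k ∧ ρ k = some v' ∧
      ∀ j, 1 ≤ j → j < k → ∀ s ∈ M.sur π, ρ j ≠ some s} = ⋃ i, E i := by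
    ext ρ
    simp only [Set.mem_iUnion, hE, Set.mem_ofPred_eq]
    constructor
    · rintro ⟨k, hk, hρ, H⟩
      obtain ⟨i, rfl⟩ := Nat.exists_eq_add_of_le' hk
      exact ⟨i, hρ, fun j hj hji => H j hj (by lia)⟩
    · rintro ⟨i, hρ, H⟩
      exact ⟨i + 1, by lia, hρ, fun j hj hji => H j hj (by lia)⟩
  have hdisj : Pairwise fun i j => Disjoint (E i) (E j) := by
    have key : ∀ i j, i < j → Disjoint (E i) (E j) := fun i j hij =>
      Set.disjoint_left.2 fun ρ hi hj => hj.2 (i + 1) (by lia) hij v' hv' hi.1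
    intro i j hij
    rcases lt_or_gt_of_ne hij with h | h
    · exact key i j h
    · exact (key j i h).symm
  unfold MDP.nextSurProb
  rw [hset, measure_iUnion hdisj hEmeas]
  refine tsum_congr fun i => ?_
  rw [← lintegral_indicator_one (hEmeas i), lintegral_congr (hEind i)]
  unfold MDP.partialLaw
  rw [lintegral_pathLaw_succ (fun _ h => M.partialNext ζ (last h)) (some v) i
    (fun k y => avoid (some '' (M.sur π : Set S)) i k * (if y = some v' then 1 else 0 : ℝ≥0∞))]
  refine lintegral_congr fun ρ => ?_
  have h6 : ∀ x, ∑ y, M.partialNext ζ x y * (if y = some v' then 1 else 0 : ℝ≥0∞) =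
      Valid.lift ζ q x := by
    rintro (_ | s)
    · rw [MDP.sum_partialNext_none]; simp [Valid.lift]
    · rcases hs : ζ s with _ | b
      · rw [MDP.sum_partialNext_of_eq_none hs]; simp [Valid.lift, hs]
      · rw [MDP.sum_partialNext hs (h.enabled s b hs)]
        simp [Valid.lift, hs, hqs s b hs]
  rw [← h6, Finset.mul_sum]
  refine Finset.sum_congr rfl fun y _ => ?_
  change M.partialNext ζ (ρ i) y * _ = _
  ring

end Cycles

namespace MDP

/-! ### MDPs with surveillance states only -/

section AllSur

variable {S A AP : Type*} [Fintype S] {M : MDP S A AP} {π : AP}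

theorem visits_eq (hS : ∀ s, s ∈ M.sur π) (n : ℕ) (ρ : ℕ → S) : M.visits π n ρ = n := by
  simp [visits, ind_of_mem _ (hS _)]

variable [MeasurableSpace S] [MeasurableSingletonClass S]

theorem surveils_of_forall_mem (hS : ∀ s, s ∈ M.sur π) (C : M.Strategy) (s : S) :
    M.Surveils π C s :=
  Eventually.of_forall fun _ => (Eventually.of_forall fun _ => hS _).frequently

/-- Here `♯ₙ = n + 2`, and the costs are bounded, so replacing `n + 2` by `n + 1` makes no
difference in the limit. -/
theorem acpc_eq_acps [Finite A] (hS : ∀ s, s ∈ M.sur π) (C : M.Strategy) (s : S) :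
    M.acpc π C s = M.acps C s := by
  have : Nonempty S := ⟨s⟩
  have : Nonempty A := ⟨(M.exists_enabled s).choose⟩
  obtain ⟨q, hq⟩ := Finite.exists_max fun q : S × A => M.g q.1 q.2
  set c := M.g q.1 q.2 with hc
  have hc0 : 0 ≤ c := M.g_nonneg _ _
  have hcost0 : ∀ n ρ, 0 ≤ M.cost C n ρ := fun n ρ =>
    Finset.sum_nonneg fun i _ => M.g_nonneg _ _
  have hcost : ∀ (n : ℕ) ρ, M.cost C n ρ ≤ ((n : ℝ) + 1) * c := fun n ρ => by
    have := Finset.sum_le_card_nsmul (Finset.range (n + 1))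
      (fun i => M.g (ρ i) (C.act i fun j => ρ j)) c fun i _ => hq (ρ i, _)
    rw [Finset.card_range, nsmul_eq_mul] at this
    push_cast at this
    exact this
  have hcyc : ∀ n ρ, (M.cycles π n ρ : ℝ) = n + 2 := fun n ρ => by
    rw [cycles_eq_visits, visits_eq hS]; push_cast; ring
  unfold acpc acps
  simp only [hcyc]
  refine le_antisymm (limsup_le_limsup (Eventually.of_forall fun n =>
    lintegral_mono fun ρ => ENNReal.ofReal_le_ofReal ?_)) ?_
  · have := hcost0 n ρ
    gcongr
    norm_num
  · have h1 : ∀ n : ℕ, ∫⁻ ρ, ENNReal.ofReal (M.cost C n ρ / ((n : ℝ) + 1)) ∂M.law C s ≤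
        ∫⁻ ρ, ENNReal.ofReal (M.cost C n ρ / ((n : ℝ) + 2)) ∂M.law C s +
          ENNReal.ofReal (c * ((n : ℝ) + 2)⁻¹) := by
      intro n
      calc _ ≤ ∫⁻ ρ, (ENNReal.ofReal (M.cost C n ρ / ((n : ℝ) + 2)) +
            ENNReal.ofReal (c * ((n : ℝ) + 2)⁻¹)) ∂M.law C s := by
            refine lintegral_mono fun ρ => ?_
            rw [← ENNReal.ofReal_add (div_nonneg (hcost0 n ρ) (by positivity)) (by positivity)]
            refine ENNReal.ofReal_le_ofReal ?_
            have h2 := hcost n ρ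
            have h3 : M.cost C n ρ / ((n : ℝ) + 2) + c * ((n : ℝ) + 2)⁻¹ -
                M.cost C n ρ / ((n : ℝ) + 1) =
                (((n : ℝ) + 1) * c - M.cost C n ρ) / (((n : ℝ) + 1) * ((n : ℝ) + 2)) := by
              field_simp; ring
            have h4 : 0 ≤ (((n : ℝ) + 1) * c - M.cost C n ρ) / (((n : ℝ) + 1) * ((n : ℝ) + 2)) :=
              div_nonneg (by linarith) (by positivity)
            linarith
        _ = _ := by rw [lintegral_add_right _ measurable_const]; simp
    have h5 : Tendsto (fun n : ℕ => ENNReal.ofReal (c * ((n : ℝ) + 2)⁻¹)) atTop (nhds 0) := by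
      rw [← ENNReal.ofReal_zero, ← mul_zero c]
      refine ENNReal.tendsto_ofReal (Tendsto.const_mul c (tendsto_inv_atTop_zero.comp ?_))
      exact tendsto_atTop_add_const_right _ _ tendsto_natCast_atTop_atTop
    exact (limsup_le_limsup (Eventually.of_forall h1)).trans_eq
      (ENNReal.limsup_add_of_right_tendsto_zero h5 _)

end AllSur

/-! ### The evaluation equation of a stationary strategy -/

section Poisson

variable {S A AP : Type*} [Fintype S] {M : MDP S A AP} (D : M.Stationary)

/-- The transition operator of a stationary strategy. -/
noncomputable def Stationary.op : (S → ℝ) →ₗ[ℝ] (S → ℝ) where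
  toFun f s := M.mean s (D.act s) f
  map_add' f f' := funext fun _ => mean_add _ _ _ f f'
  map_smul' c f := funext fun _ => mean_mul _ _ _ c f

theorem Stationary.op_apply (f : S → ℝ) (s : S) : D.op f s = M.mean s (D.act s) f := rfl

theorem Stationary.op_mono {f f' : S → ℝ} (h : ∀ s, f s ≤ f' s) (s : S) : D.op f s ≤ D.op f' s :=
  M.mean_mono _ _ h

theorem Stationary.op_pow_le {f : S → ℝ} {c : ℝ} (h : ∀ s, f s ≤ c) (n : ℕ) (s : S) :
    (D.op ^ n) f s ≤ c := by
  induction n generalizing s with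
  | zero => simpa using h s
  | succ n ih =>
    rw [pow_succ', Module.End.mul_apply]
    refine (D.op_mono (f' := fun _ => c) ih s).trans_eq ?_
    rw [D.op_apply, mean_const _ (D.mem s)]

theorem Stationary.op_pow_nonneg {f : S → ℝ} (h : ∀ s, 0 ≤ f s) (n : ℕ) (s : S) :
    0 ≤ (D.op ^ n) f s := by
  have := D.op_pow_le (f := -f) (c := 0) (fun s => by simpa using h s) n s
  rw [map_neg] at this
  simpa using this

variable [MeasurableSpace S] [MeasurableSingletonClass S]

theorem Stationary.lintegral_op_pow {f : S → ℝ} (h : ∀ s, 0 ≤ f s) (n : ℕ) (s : S) :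
    ∫⁻ ρ, ENNReal.ofReal (f (ρ n)) ∂M.law D.toStrategy s = ENNReal.ofReal ((D.op ^ n) f s) := by
  induction n generalizing f with
  | zero =>
    rw [lintegral_law_zero _ _ fun x => ENNReal.ofReal (f x)]
    rfl
  | succ n ih =>
    rw [lintegral_law_succ D.toStrategy s n (Φ := fun _ => f) (fun _ => h) (fun _ => rfl)]
    rw [pow_succ, Module.End.mul_apply, ← ih (f := D.op f) fun s => M.mean_nonneg _ _ h]
    rfl

/-- The evaluation equation of a stationary strategy whose expected average cost is the same number
`V` from all states. The Cesàro means of `Dⁿ g` converge to `V`, so `g - V` is in the closure of the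
range of `1 - D`, which is finite-dimensional and hence closed. -/
theorem Stationary.exists_poisson {V : ℝ} (hV : 0 ≤ V) {π : AP} (hS : ∀ s, s ∈ M.sur π) {h : S → ℝ}
    (h0 : ∀ s, 0 ≤ h s) (hh : M.IsSub π V h)
    (hD : ∀ s, M.acps D.toStrategy s ≤ ENNReal.ofReal V) :
    ∃ k : S → ℝ, (∀ s, 0 ≤ k s) ∧
      ∀ s, M.g s (D.act s) + M.mean s (D.act s) k = k s + V := by
  set g : S → ℝ := fun s => M.g s (D.act s) with hg
  have hg0 : ∀ s, 0 ≤ g s := fun s => M.g_nonneg _ _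
  set avg : ℕ → S → ℝ := fun n => ((n : ℝ) + 1)⁻¹ • ∑ i ∈ Finset.range (n + 1), (D.op ^ i) g
    with havg
  have havg0 : ∀ n s, avg n s = ((n : ℝ) + 1)⁻¹ * ∑ i ∈ Finset.range (n + 1), (D.op ^ i) g s := by
    intro n s
    simp [havg]
  have hint : ∀ n s, ∫⁻ ρ, ENNReal.ofReal (M.cost D.toStrategy n ρ / ((n : ℝ) + 1))
      ∂M.law D.toStrategy s = ENNReal.ofReal (avg n s) := by
    intro n s
    have e1 : ∀ ρ, ENNReal.ofReal (M.cost D.toStrategy n ρ / ((n : ℝ) + 1)) =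
        ENNReal.ofReal (((n : ℝ) + 1)⁻¹) *
          ∑ i ∈ Finset.range (n + 1), ENNReal.ofReal (g (ρ i)) := by
      intro ρ
      rw [← ENNReal.ofReal_sum_of_nonneg fun i _ => hg0 _, ← ENNReal.ofReal_mul (by positivity),
        div_eq_inv_mul]
      rfl
    have hmeas : ∀ i, Measurable fun ρ : ℕ → S => ENNReal.ofReal (g (ρ i)) := fun i =>
      (measurable_of_countable fun s => ENNReal.ofReal (g s)).comp (measurable_pi_apply i)
    rw [lintegral_congr e1, lintegral_const_mul _ (Finset.measurable_fun_sum _ fun i _ => hmeas i),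
      lintegral_finsetSum _ fun i _ => hmeas i]
    simp only [D.lintegral_op_pow hg0]
    rw [← ENNReal.ofReal_sum_of_nonneg fun i _ => D.op_pow_nonneg hg0 i s,
      ← ENNReal.ofReal_mul (by positivity), havg0]
  have hlow : ∀ (n : ℕ) s, n * V + h s - (D.op ^ n) h s ≤
      ∑ i ∈ Finset.range n, (D.op ^ i) g s := by
    intro n
    induction n with
    | zero => intro s; simp
    | succ n ih =>
      intro s
      have e1 : ∑ i ∈ Finset.range (n + 1), (D.op ^ i) g s =
          g s + D.op (fun s => ∑ i ∈ Finset.range n, (D.op ^ i) g s) s := by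
        have e2 : (fun s => ∑ i ∈ Finset.range n, (D.op ^ i) g s) =
            ∑ i ∈ Finset.range n, (D.op ^ i) g := by
          funext s; simp
        rw [Finset.sum_range_succ', e2, map_sum, Finset.sum_apply, add_comm]
        congr 1
        exact Finset.sum_congr rfl fun i _ => by rw [pow_succ', Module.End.mul_apply]
      have e3 : D.op (fun s => n * V + h s - (D.op ^ n) h s) s =
          n * V + D.op h s - (D.op ^ (n + 1)) h s := by
        rw [pow_succ', Module.End.mul_apply, D.op_apply, D.op_apply, D.op_apply]
        simp only [sub_eq_add_neg]
        rw [mean_add, mean_add, mean_neg, mean_const _ (D.mem s)]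
      have e4 := hh s (D.act s) (D.mem s)
      rw [ind_of_mem _ (hS s)] at e4
      have e5 := D.op_mono ih s
      rw [e3] at e5
      rw [e1]
      have e6 : D.op h s = M.mean s (D.act s) h := rfl
      push_cast
      simp only [hg]
      linarith
  have hlim : ∀ s, Tendsto (fun n => avg n s) atTop (nhds V) := by
    intro s
    obtain ⟨c, hc⟩ : ∃ c : ℝ, ∀ s, h s ≤ c := ⟨∑ s, h s, fun s =>
      Finset.single_le_sum (fun s _ => h0 s) (Finset.mem_univ s)⟩
    have hinv : Tendsto (fun n : ℕ => ((n : ℝ) + 1)⁻¹) atTop (nhds 0) :=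
      tendsto_inv_atTop_zero.comp
        (tendsto_atTop_add_const_right _ _ tendsto_natCast_atTop_atTop)
    have hlowlim : Tendsto (fun n : ℕ => V + -c * ((n : ℝ) + 1)⁻¹) atTop (nhds V) := by
      simpa using (hinv.const_mul (-c)).const_add V
    rw [tendsto_order]
    refine ⟨fun x hx => ?_, fun x hx => ?_⟩
    · filter_upwards [hlowlim.eventually_const_lt hx] with n hn
      refine hn.trans_le ?_
      have e1 := hlow (n + 1) s
      have e2 := D.op_pow_le hc (n + 1) s
      have e3 : 0 < (n : ℝ) + 1 := by positivity
      rw [havg0, ← div_eq_inv_mul, le_div_iff₀ e3, add_mul, mul_assoc, inv_mul_cancel₀ e3.ne']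
      push_cast at e1
      linarith [h0 s]
    · have hlt : M.acps D.toStrategy s < ENNReal.ofReal x :=
        (hD s).trans_lt ((ENNReal.ofReal_lt_ofReal_iff_of_nonneg hV).2 hx)
      unfold acps at hlt
      simp only [hint] at hlt
      filter_upwards [eventually_lt_of_limsup_lt hlt] with n hn
      exact lt_of_not_ge fun hge => not_lt.2 (ENNReal.ofReal_le_ofReal hge) hn
  set Q : Submodule ℝ (S → ℝ) := LinearMap.range (LinearMap.id - D.op) with hQ
  have hpow : ∀ i, g - (D.op ^ i) g ∈ Q := by
    intro i
    induction i with
    | zero => simp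
    | succ i ih =>
      have e1 : (D.op ^ i) g - (D.op ^ (i + 1)) g ∈ Q := by
        refine ⟨(D.op ^ i) g, ?_⟩
        rw [pow_succ', Module.End.mul_apply]
        rfl
      have e2 := Q.add_mem ih e1
      rwa [sub_add_sub_cancel] at e2
  have hmem : ∀ n, g - avg n ∈ Q := by
    intro n
    have e1 : g - avg n = ((n : ℝ) + 1)⁻¹ • ∑ i ∈ Finset.range (n + 1), (g - (D.op ^ i) g) := by
      rw [Finset.sum_sub_distrib, smul_sub, Finset.sum_const, Finset.card_range, havg,
        ← Nat.cast_smul_eq_nsmul ℝ, smul_smul]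
      push_cast
      rw [inv_mul_cancel₀ (by positivity), one_smul]
    rw [e1]
    exact Q.smul_mem _ (Q.sum_mem fun i _ => hpow i)
  have hclosed : IsClosed (Q : Set (S → ℝ)) := Q.closed_of_finiteDimensional
  obtain ⟨k, hk⟩ : (fun s => g s - V) ∈ Q := by
    refine hclosed.mem_of_tendsto (f := fun n => g - avg n) (b := atTop) ?_
      (Eventually.of_forall hmem)
    exact tendsto_pi_nhds.2 fun s => (hlim s).const_sub (g s)
  rcases isEmpty_or_nonempty S with hE | hE
  · exact ⟨fun _ => 0, fun s => hE.elim s, fun s => hE.elim s⟩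
  obtain ⟨x₀, hx₀⟩ := Finite.exists_min k
  refine ⟨fun s => k s + -k x₀, fun s => by linarith [hx₀ s], fun s => ?_⟩
  have e1 : k s - M.mean s (D.act s) k = M.g s (D.act s) - V := congrFun hk s
  rw [mean_add, mean_const _ (D.mem s)]
  linarith

end Poisson

/-! ### Unwrapping a stationary strategy of the reduced MDP -/

section Unwrap

variable {S A AP : Type*} [Fintype S] {M : MDP S A AP} {π : AP}

open Classical in
/-- The finite-memory strategy that follows `ζ v` after the surveillance state `v` and `D` where
`ζ v` is not defined and before the first surveillance state. -/
noncomputable def unwrap (D : M.Stationary) (ζ : M.sur π → S → Option A)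
    (hζ : ∀ v, M.IsPartialStationary (ζ v)) : M.FiniteMemory (Option (M.sur π)) where
  start s := if h : s ∈ M.sur π then some ⟨s, h⟩ else none
  Δ m s := if h : s ∈ M.sur π then some ⟨s, h⟩ else m
  act m s := match m with
    | none => D.act s
    | some v => (ζ v s).getD (D.act s)
  mem m s := by
    rcases m with _ | v
    · exact D.mem s
    · rcases h : ζ v s with _ | a
      · simpa [h] using D.mem s
      · simpa [h] using hζ v s a h

variable {D : M.Stationary} {ζ : M.sur π → S → Option A} {hζ : ∀ v, M.IsPartialStationary (ζ v)}

theorem unwrap_act {v : M.sur π} {s : S} {a : A} (h : ζ v s = some a) :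
    (unwrap D ζ hζ).act (some v) s = a := by simp [unwrap, h]

theorem unwrap_Δ_of_notMem (m : Option (M.sur π)) {s : S} (h : s ∉ M.sur π) :
    (unwrap D ζ hζ).Δ m s = m := by simp [unwrap, h]

theorem unwrap_mode {n : ℕ} {h : Finset.Iic n → S} (hs : last h ∈ M.sur π) :
    (unwrap D ζ hζ).mode n h = some ⟨last h, hs⟩ := by
  cases n <;> simp [FiniteMemory.mode, unwrap, hs]

variable {p : M.sur π → S → ℝ} {c : M.sur π → ℝ}

/-- In every mode the surveillance states are reached. -/
theorem unwrap_reaches (hD : D.Reaches π)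
    (hval : ∀ v : M.sur π, Valid M (M.sur π) v (ζ v) (p v) (c v))
    (m : Option (M.sur π)) (x : S) : ∃ z ∈ ((↑(M.sur π) : Set S)ᶜ)ᶜ,
      Relation.ReflTransGen (fun x y => 0 < M.P x ((unwrap D ζ hζ).act m x) y) x z := by
  simp only [compl_compl, Finset.mem_coe]
  rcases m with _ | v
  · exact hD x
  · obtain ⟨z, hz, hxz⟩ := hD x
    induction hxz using Relation.ReflTransGen.head_induction_on with
    | refl => exact ⟨z, hz, .refl⟩
    | @head x y hxy _ ih =>
      by_cases hx : x ∈ M.sur π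
      · exact ⟨x, hx, .refl⟩
      rcases ha : ζ v x with _ | a
      · obtain ⟨w, hw, hyw⟩ := ih
        refine ⟨w, hw, .head ?_ hyw⟩
        simpa [unwrap, ha] using hxy
      · obtain ⟨w, hw, hxw⟩ := (hval v).exists_reach hx ha
        refine ⟨w, hw, hxw.lift id fun x y hxy => ?_⟩
        obtain ⟨b, hb, hp⟩ := hxy
        change 0 < M.P x ((unwrap D ζ hζ).act (some v) x) y
        rwa [unwrap_act hb]

/-- In every mode, the equation `f = r + P f` outside the surveillance states has a solution with
prescribed values in these states. -/
theorem unwrap_exists_potential (hD : D.Reaches π)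
    (hval : ∀ v : M.sur π, Valid M (M.sur π) v (ζ v) (p v) (c v)) {r : S → A → ℝ}
    (hr : ∀ s a, 0 ≤ r s a)
    {k : M.sur π → ℝ} (hk : ∀ v, 0 ≤ k v) :
    ∃ H : Option (M.sur π) → S → ℝ, (∀ m s, 0 ≤ H m s) ∧ (∃ K, ∀ m s, H m s ≤ K) ∧
      (∀ m (v : M.sur π), H m v = k v) ∧
      (∀ m s, s ∉ M.sur π → H m s = r s ((unwrap D ζ hζ).act m s) +
        M.mean s ((unwrap D ζ hζ).act m s) (H m)) ∧
      ∀ m y, H ((unwrap D ζ hζ).Δ m y) y = H m y := by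
  classical
  have key : ∀ m : Option (M.sur π), ∃ f : S → ℝ, (∀ s, 0 ≤ f s) ∧ (∀ v : M.sur π, f v = k v) ∧
      ∀ s ∉ M.sur π, f s = r s ((unwrap D ζ hζ).act m s) +
        M.mean s ((unwrap D ζ hζ).act m s) f := by
    intro m
    have hK0 : ∀ x y, 0 ≤ M.P x ((unwrap D ζ hζ).act m x) y := fun x y => M.P_nonneg _ _ _
    have hK1 : ∀ x ∈ (↑(M.sur π) : Set S)ᶜ, ∑ y, M.P x ((unwrap D ζ hζ).act m x) y = 1 :=
      fun x _ => (unwrap D ζ hζ).mem m x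
    obtain ⟨f, hf, hf'⟩ := exists_harmonic hK0 hK1 (unwrap_reaches hD hval m)
      (fun s => if h : s ∈ M.sur π then k ⟨s, h⟩ else r s ((unwrap D ζ hζ).act m s))
    have hfv : ∀ v : M.sur π, f v = k v := fun v => by
      rw [hf' v (by simp), dif_pos v.2]
    refine ⟨f, fun s => ?_, hfv, fun s hs => ?_⟩
    · refine nonneg_of_superharmonic hK0 hK1 (unwrap_reaches hD hval m) (fun x hx => ?_)
        (fun x hx => ?_) s
      · have := hf x hx
        rw [dif_neg (by simpa using hx)] at this
        linarith [hr x ((unwrap D ζ hζ).act m x)]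
      · have hx' : x ∈ M.sur π := by simpa using hx
        exact (hk ⟨x, hx'⟩).trans_eq (hfv ⟨x, hx'⟩).symm
    · rw [hf s (by simpa using hs), dif_neg hs]
      rfl
  choose H hH0 hHv hH using key
  refine ⟨H, hH0, ⟨∑ m, ∑ s, H m s, fun m s => ?_⟩, hHv, hH, fun m y => ?_⟩
  · exact (Finset.single_le_sum (fun s _ => hH0 m s) (Finset.mem_univ s)).trans
      (Finset.single_le_sum (f := fun m => ∑ s, H m s)
        (fun m _ => Finset.sum_nonneg fun s _ => hH0 m s) (Finset.mem_univ m))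
  · by_cases hy : y ∈ M.sur π
    · exact (hHv _ ⟨y, hy⟩).trans (hHv _ ⟨y, hy⟩).symm
    · rw [unwrap_Δ_of_notMem _ hy]

variable [MeasurableSpace S] [MeasurableSingletonClass S]

/-- In every mode the hitting times of the surveillance states have finite expectations, which are a
potential for `surveils_of_bound`. -/
theorem unwrap_surveils (hD : D.Reaches π)
    (hval : ∀ v : M.sur π, Valid M (M.sur π) v (ζ v) (p v) (c v)) (s : S) :
    M.Surveils π (unwrap D ζ hζ).toStrategy s := by
  obtain ⟨H, hH0, ⟨K, hK⟩, hHv, hH, hΔ⟩ := unwrap_exists_potential (hζ := hζ) hD hval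
    (r := fun _ _ => 1) (fun _ _ => zero_le_one) (k := fun _ => 0) fun _ => le_rfl
  have hK0 : 0 ≤ K := (hH0 none s).trans (hK none s)
  refine surveils_of_bound (V := 1 + K) (by linarith) (m := (unwrap D ζ hζ).mode)
    (Δ := (unwrap D ζ hζ).Δ) (fun _ _ => rfl) hH0 hK (fun n h => ?_) s
  simp only [hΔ]
  change 1 + M.mean (last h) ((unwrap D ζ hζ).act ((unwrap D ζ hζ).mode n h) (last h))
    (H ((unwrap D ζ hζ).mode n h)) ≤ _
  by_cases hs : last h ∈ M.sur π
  · rw [ind_of_mem _ hs]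
    have h1 := M.mean_mono (last h) ((unwrap D ζ hζ).act ((unwrap D ζ hζ).mode n h) (last h))
      (hK ((unwrap D ζ hζ).mode n h))
    rw [mean_const _ ((unwrap D ζ hζ).mem _ _)] at h1
    linarith [hH0 ((unwrap D ζ hζ).mode n h) (last h)]
  · rw [ind_of_notMem _ hs, hH _ _ hs]
    linarith

/-- If the cycles of the unwrapped strategy satisfy the evaluation inequality with value `V`, then
its ACPC value is at most `V`. -/
theorem unwrap_acpc_le (hD : D.Reaches π)
    (hval : ∀ v : M.sur π, Valid M (M.sur π) v (ζ v) (p v) (c v)) {V : ℝ} (hV : 0 ≤ V) {k : S → ℝ}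
    (hk : ∀ s, 0 ≤ k s)
    (hkV : ∀ v : M.sur π, c v + ∑ w ∈ M.sur π, p v w * k w ≤ k v + V) (s : S) :
    M.acpc π (unwrap D ζ hζ).toStrategy s ≤ ENNReal.ofReal V := by
  obtain ⟨H, hH0, ⟨K, hK⟩, hHv, hH, hΔ⟩ := unwrap_exists_potential (hζ := hζ) hD hval
    (r := M.g) M.g_nonneg (k := fun v => k v) fun v => hk v
  refine acpc_le hV (m := (unwrap D ζ hζ).mode)
    (Δ := (unwrap D ζ hζ).Δ) (fun _ _ => rfl) hH0 hK (fun n h => ?_) (unwrap_surveils hD hval s)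
  simp only [hΔ]
  change M.g (last h) ((unwrap D ζ hζ).act ((unwrap D ζ hζ).mode n h) (last h)) +
    M.mean (last h) ((unwrap D ζ hζ).act ((unwrap D ζ hζ).mode n h) (last h))
    (H ((unwrap D ζ hζ).mode n h)) ≤ _
  by_cases hs : last h ∈ M.sur π
  · rw [ind_of_mem _ hs, unwrap_mode hs]
    set v : M.sur π := ⟨last h, hs⟩ with hv
    have hlast : last h = v := rfl
    rw [hlast]
    obtain ⟨a, ha⟩ := (hval v).isSome
    rw [unwrap_act ha, hHv]
    have h1 := (hval v).eq 1 (H (some v)) (fun x hx b hb => by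
      rw [hH _ x hx, unwrap_act hb, one_mul]) ha
    have h2 : ∑ w ∈ M.sur π, p v w * H (some v) w = ∑ w ∈ M.sur π, p v w * k w :=
      Finset.sum_congr rfl fun w hw => by rw [hHv (some v) ⟨w, hw⟩]
    have h3 := hkV v
    rw [h2, one_mul, one_mul] at h1
    linarith
  · rw [ind_of_notMem _ hs, hH _ _ hs]
    linarith

end Unwrap

end MDP

/-! ### Correctness of the reduction -/

section Reduced

variable {S A AP : Type*} [Fintype S] {M : MDP S A AP} {π : AP}

open Classical in
/-- The MDP on the surveillance states that is described by an output of the algorithm. -/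
noncomputable def Aux.toReduced {D : M.Stationary} {X : Aux S A} (hI : Aux.Inv M π D X)
    (hX : X.states = M.sur π) : MDP (M.sur π) (S → Option A) AP where
  P v ζ w := if ζ ∈ X.act v then X.P v ζ w else 0
  P_nonneg v ζ w := by
    split_ifs with h
    · exact (hI.valid v (by rw [hX]; exact v.2) ζ h).p_nonneg w (by rw [hX]; exact w.2)
    · exact le_rfl
  P_sum v ζ := by
    by_cases h : ζ ∈ X.act v
    · right
      simp only [h, if_true]
      exact aux hI hX v ζ h
    · left
      simp [h]
  exists_enabled v := by
    obtain ⟨ζ, h, -⟩ := hI.exists_le v (by rw [hX]; exact v.2)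
    refine ⟨ζ, ?_⟩
    simp only [h, if_true]
    exact aux hI hX v ζ h
  L v := M.L v
  g v ζ := if ζ ∈ X.act v then X.g v ζ else 0
  g_nonneg v ζ := by
    split_ifs with h
    · exact (hI.valid v (by rw [hX]; exact v.2) ζ h).c_nonneg
    · exact le_rfl
where
  aux {D : M.Stationary} {X : Aux S A} (hI : Aux.Inv M π D X)
      (hX : X.states = M.sur π) (v : M.sur π) (ζ : S → Option A) (h : ζ ∈ X.act v) :
      ∑ w : M.sur π, X.P v ζ w = 1 := by
    have h1 := (hI.valid v (by rw [hX]; exact v.2) ζ h).sum_eq_one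
    rw [hX] at h1
    rw [← h1, Finset.sum_coe_sort (M.sur π) fun w => X.P v ζ w]

variable {D : M.Stationary} {X : Aux S A}

theorem Aux.yields_toReduced (hI : Aux.Inv M π D X) (hX : X.states = M.sur π) :
    Aux.Yields M π X (Aux.toReduced hI hX) := by
  classical
  refine ⟨fun v => ?_, fun v ζ h w => if_pos h, fun v ζ h => if_pos h, fun v => rfl⟩
  ext ζ
  constructor
  · intro h
    by_contra hζ
    have h' : ∑ w : M.sur π, (if ζ ∈ X.act v then X.P v ζ w else 0) = 1 := h
    simp [hζ] at h'
  · intro h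
    change ∑ w : M.sur π, (if ζ ∈ X.act v then X.P v ζ w else 0) = 1
    simp only [h, if_true]
    exact Aux.toReduced.aux hI hX v ζ h

variable {R : MDP (M.sur π) (S → Option A) AP}

theorem Aux.Yields.mem_sur (h : Aux.Yields M π X R) (v : M.sur π) : v ∈ R.sur π := by
  refine MDP.mem_sur.2 ?_
  rw [h.L v]
  exact MDP.mem_sur.1 v.2

theorem Aux.Yields.mean (h : Aux.Yields M π X R) {v : M.sur π} {ζ : S → Option A}
    (hζ : ζ ∈ R.enabled v) (f : S → ℝ) :
    R.mean v ζ (fun w => f w) = ∑ w ∈ M.sur π, X.P v ζ w * f w := by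
  rw [← Finset.sum_coe_sort (M.sur π) fun w => X.P v ζ w * f w]
  exact Finset.sum_congr rfl fun w _ => by rw [h.P v ζ (h.enabled v ▸ hζ) w]

theorem Aux.Yields.valid (h : Aux.Yields M π X R) (hI : Aux.Inv M π D X)
    (hX : X.states = M.sur π) {v : M.sur π} {ζ : S → Option A} (hζ : ζ ∈ R.enabled v) :
    Valid M (M.sur π) v ζ (X.P v ζ) (R.g v ζ) := by
  have hζ' : ζ ∈ X.act v := h.enabled v ▸ hζ
  have := hI.valid v (by rw [hX]; exact v.2) ζ hζ'
  rwa [hX, ← h.g v ζ hζ'] at this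

/-- A subsolution of the optimality equation of `M` restricts to one of the reduced MDP. -/
theorem Aux.Yields.isSub (h : Aux.Yields M π X R) (hI : Aux.Inv M π D X)
    (hX : X.states = M.sur π) {V : ℝ} {k : S → ℝ} (hk : M.IsSub π V k) :
    R.IsSub π V fun v => k v := by
  intro v ζ hζ
  have hval := h.valid hI hX hζ
  obtain ⟨a, ha⟩ := hval.isSome
  have h1 := hval.sub 1 k (fun s hs b hb => by
    have := hk s b (hval.enabled s b hb)
    rw [M.ind_of_notMem hs] at this
    linarith) a ha
  have h2 := hk v a (hval.enabled v a ha)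
  rw [M.ind_of_mem v.2] at h2
  rw [R.ind_of_mem (h.mem_sur v), h.mean hζ]
  linarith

/-- A solution of the evaluation equation of `D` restricts to a solution of the evaluation equation
of a stationary strategy of the reduced MDP, which follows `D` in every cycle. -/
theorem Aux.Yields.exists_stationary (h : Aux.Yields M π X R) (hI : Aux.Inv M π D X)
    (hX : X.states = M.sur π) {V : ℝ} {k : S → ℝ}
    (hk : ∀ s, k s + V * M.ind π s = M.g s (D.act s) + M.mean s (D.act s) k) :
    ∃ E : R.Stationary, ∀ v, R.g v (E.act v) + R.mean v (E.act v) (fun w => k w) = k v + V := by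
  have key : ∀ v : M.sur π, ∃ ζ ∈ R.enabled v, R.g v ζ + R.mean v ζ (fun w => k w) = k v + V := by
    intro v
    obtain ⟨ζ, hζ, hζD⟩ := hI.exists_le v (by rw [hX]; exact v.2)
    have hζR : ζ ∈ R.enabled v := by rw [h.enabled]; exact hζ
    refine ⟨ζ, hζR, ?_⟩
    have hval := h.valid hI hX hζR
    obtain ⟨a, ha⟩ := hval.isSome
    have h1 := hval.eq 1 k (fun s hs b hb => by
      have := hk s
      rw [M.ind_of_notMem hs] at this
      rw [hζD s b hb]
      linarith) ha
    have h2 := hk v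
    rw [M.ind_of_mem v.2] at h2
    rw [hζD v a ha] at h1
    rw [h.mean hζR]
    linarith
  choose E hE hEV using key
  exact ⟨⟨E, hE⟩, hEV⟩

variable [MeasurableSpace S] [MeasurableSingletonClass S]

/-- The correctness of the reduction of a communicating MDP to its surveillance states. -/
theorem exists_reduction [Finite A] (hM : M.Communicating) (hB : (M.sur π).Nonempty)
    (hX : Aux.IsOutput M π X) :
    ∃ R : MDP (M.sur π) (S → Option A) AP, Aux.Yields M π X R ∧
      (∀ v, ∀ ζ ∈ R.enabled v,
        M.IsPartialStationary ζ ∧ (ζ v).isSome ∧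
        (∀ v' : M.sur π, M.nextSurProb π ζ v v' = ENNReal.ofReal (R.P v ζ v')) ∧
        M.cycleCost π ζ v = ENNReal.ofReal (R.g v ζ)) ∧
      ∃ V : ℝ≥0,
        (∀ v, IsLeast {x | ∃ C, x = R.acpc π C v} (V : ℝ≥0∞)) ∧
        (∀ C v, R.acpc π C v = R.acps C v) ∧
        (∀ v, IsLeast {x | ∃ C, x = R.acps C v} (V : ℝ≥0∞)) ∧
        (∀ s, IsLeast {x | ∃ C, M.Surveils π C s ∧ x = M.acpc π C s} (V : ℝ≥0∞)) ∧
        ((∀ E : Sub S A, E.IsEC M → (∀ s ∈ E.states, s ∉ M.sur π) →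
            ∃ s ∈ E.states, ∃ a ∈ E.act s, 0 < M.g s a) →
          ∀ s, IsLeast {x | ∃ C, x = M.acpc π C s} (V : ℝ≥0∞)) ∧
        (∃ D : R.Stationary, ∀ v C, R.acps D.toStrategy v ≤ R.acps C v) ∧
        ∀ D : R.Stationary, (∀ v C, R.acps D.toStrategy v ≤ R.acps C v) →
          (∀ v, R.acpc π D.toStrategy v = V) ∧
          ∃ F : M.FiniteMemory (Option (M.sur π)), Unwraps M π R D F ∧
            ∀ s, M.Surveils π F.toStrategy s ∧ M.acpc π F.toStrategy s = V := by
  obtain ⟨V, hV, k, hk0, hk, D, hD, hDk⟩ := MDP.exists_optimal hM hB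
  have hI := hX.inv hD
  have hXs := hX.2
  obtain ⟨R, hR⟩ : ∃ R, Aux.Yields M π X R := ⟨_, Aux.yields_toReduced hI hXs⟩
  have hRsur := hR.mem_sur
  have hVeq : ENNReal.ofNNReal ⟨V, hV⟩ = ENNReal.ofReal V := (ENNReal.ofReal_eq_coe_nnreal hV).symm
  have hval : ∀ (E : R.Stationary) (v : M.sur π), Valid M (M.sur π) v (E.act v)
      (X.P v (E.act v)) (R.g v (E.act v)) := fun E v => hR.valid hI hXs (E.mem v)
  have hRsub := hR.isSub hI hXs hk
  -- lower bounds
  have hRlow : ∀ C v, ENNReal.ofReal V ≤ R.acpc π C v := fun C v =>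
    MDP.le_acpc (M := R) (h := fun v => k v) hV (fun w => hk0 w) hRsub fun m L => by
      refine tendsto_of_tendsto_of_tendsto_of_le_of_le tendsto_const_nhds
        ((MDP.surveils_of_forall_mem hRsur C v).tendsto m) (fun _ => bot_le) fun n => ?_
      exact measure_mono fun ρ hρ => hρ.1
  have hMlow : ∀ C s, M.Surveils π C s → ENNReal.ofReal V ≤ M.acpc π C s := fun C s hC =>
    MDP.le_acpc (M := M) hV hk0 hk fun m L => by
      refine tendsto_of_tendsto_of_tendsto_of_le_of_le tendsto_const_nhds
        (hC.tendsto m) (fun _ => bot_le) fun n => ?_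
      exact measure_mono fun ρ hρ => hρ.1
  have hMlow' : (∀ E : Sub S A, E.IsEC M → (∀ s ∈ E.states, s ∉ M.sur π) →
      ∃ s ∈ E.states, ∃ a ∈ E.act s, 0 < M.g s a) → ∀ C s,
      ENNReal.ofReal V ≤ M.acpc π C s := fun hEC C s =>
    MDP.le_acpc (M := M) hV hk0 hk fun m L => MDP.tendsto_visits_total_lt hEC C s m L
  -- the optimal stationary strategy of the reduced MDP that follows `D`
  have hacpc : ∀ C v, R.acpc π C v = R.acps C v := fun C v => MDP.acpc_eq_acps hRsur C v
  obtain ⟨E₀, hE₀⟩ := hR.exists_stationary hI hXs hDk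
  have hkK : ∀ s, k s ≤ ∑ s, k s := fun s =>
    Finset.single_le_sum (fun s _ => hk0 s) (Finset.mem_univ s)
  have hE₀V : ∀ v, R.acpc π E₀.toStrategy v = ENNReal.ofReal V := fun v => by
    refine le_antisymm ?_ (hRlow _ v)
    refine MDP.acpc_le (M := R) (C := E₀.toStrategy) hV (X := Unit) (m := fun _ _ => ())
      (Δ := fun _ _ => ()) (fun _ _ => rfl) (H := fun _ w => k w) (fun _ w => hk0 w)
      (K := ∑ s, k s) (fun _ w => hkK w) (fun n h => ?_) (MDP.surveils_of_forall_mem hRsur _ v)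
    rw [R.ind_of_mem (hRsur _), mul_one]
    exact (hE₀ (last h)).le
  have hE₀opt : ∀ v C, R.acps E₀.toStrategy v ≤ R.acps C v := fun v C => by
    rw [← hacpc, ← hacpc, hE₀V]
    exact hRlow C v
  have hopt : ∀ E : R.Stationary, (∀ v C, R.acps E.toStrategy v ≤ R.acps C v) →
      (∀ v, R.acpc π E.toStrategy v = ENNReal.ofReal V) ∧
      ∃ F : M.FiniteMemory (Option (M.sur π)), Unwraps M π R E F ∧
        ∀ s, M.Surveils π F.toStrategy s ∧ M.acpc π F.toStrategy s = ENNReal.ofReal V := by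
    intro E hE
    have hEV : ∀ v, R.acps E.toStrategy v ≤ ENNReal.ofReal V := fun v => by
      rw [← hE₀V v, hacpc]
      exact hE v _
    refine ⟨fun v => le_antisymm (by rw [hacpc]; exact hEV v) (hRlow _ v), ?_⟩
    obtain ⟨q, hq0, hq⟩ := E.exists_poisson hV hRsur (fun w => hk0 w) hRsub hEV
    classical
    set q' : S → ℝ := fun s => if h : s ∈ M.sur π then q ⟨s, h⟩ else 0 with hq'
    have hq'v : ∀ v : M.sur π, q' v = q v := fun v => by simp [hq']
    set F := MDP.unwrap D E.act fun v => (hval E v).enabled with hF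
    refine ⟨F, ⟨fun v => ?_, fun m v => ?_, fun m v hv => MDP.unwrap_Δ_of_notMem m hv,
      fun m v a ha => MDP.unwrap_act ha⟩, fun s => ?_⟩
    · simp [hF, MDP.unwrap]
    · simp [hF, MDP.unwrap]
    · have hsur : M.Surveils π F.toStrategy s := MDP.unwrap_surveils hD (hval E) s
      refine ⟨hsur, le_antisymm ?_ (hMlow _ s hsur)⟩
      refine MDP.unwrap_acpc_le hD (hval E) hV (k := q') (fun s => ?_) (fun v => ?_) s
      · simp only [hq']
        split_ifs with h
        · exact hq0 _
        · exact le_rfl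
      · rw [← hR.mean (E.mem v) q', hq'v]
        simp only [hq'v]
        exact (hq v).le
  obtain ⟨F₀, -, hF₀⟩ := (hopt E₀ hE₀opt).2
  refine ⟨R, hR, fun v ζ hζ => ?_, ⟨V, hV⟩, ?_⟩
  · have hv := hR.valid hI hXs hζ
    have hζX : ζ ∈ X.act v := hR.enabled v ▸ hζ
    refine ⟨hv.enabled, Option.isSome_iff_exists.2 hv.isSome, fun v' => ?_, hv.cycleCost_eq⟩
    rw [hv.nextSurProb_eq v'.2, hR.P v ζ hζX]
  · rw [hVeq]
    refine ⟨fun v => ⟨⟨_, (hE₀V v).symm⟩, ?_⟩, hacpc, fun v => ⟨⟨E₀.toStrategy, ?_⟩, ?_⟩,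
      fun s => ⟨⟨_, (hF₀ s).1, (hF₀ s).2.symm⟩, ?_⟩,
      fun hEC s => ⟨⟨_, (hF₀ s).2.symm⟩, ?_⟩, ⟨E₀, hE₀opt⟩, hopt⟩
    · rintro _ ⟨C, rfl⟩
      exact hRlow C v
    · rw [← hacpc, hE₀V]
    · rintro _ ⟨C, rfl⟩
      rw [← hacpc]
      exact hRlow C v
    · rintro _ ⟨C, hC, rfl⟩
      exact hMlow C s hC
    · rintro _ ⟨C, rfl⟩
      exact hMlow' hEC C s

end Reduced

/-! ### Surveillance states of accepting end components -/

section MAEC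

variable {S A AP Q : Type*} [Fintype S]

theorem Sub.mem_enabled_toMDP {M : MDP S A AP} {N : Sub S A} (hN : N.IsEC M) (s : N.states)
    {a : A} (ha : a ∈ N.act s) : a ∈ (Sub.toMDP hN).enabled s := by
  classical
  change ∑ s' : N.states, (if a ∈ N.act s then M.P s a s' else 0) = 1
  simp only [ha, if_true]
  exact Sub.toMDP.aux hN s a ha

theorem Sub.communicating_toMDP {M : MDP S A AP} {N : Sub S A} (hN : N.IsEC M) :
    (Sub.toMDP hN).Communicating := by
  rintro ⟨s, hs⟩ ⟨s', hs'⟩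
  have key := hN.connected s hs s' hs'
  induction key with
  | refl => exact .refl
  | @tail y z _ hyz ih =>
    obtain ⟨a, ha, hp⟩ := hyz
    have hy : y ∈ N.states := by
      by_contra hy
      rw [hN.act_of_notMem y hy] at ha
      exact ha
    refine (ih hy).tail ⟨a, Sub.mem_enabled_toMDP hN ⟨y, hy⟩ ha, ?_⟩
    simpa [Sub.toMDP, ha] using hp

variable [Fintype Q]

/-- An accepting end component with a reachable automaton state has a surveillance state: a word
that leads to this automaton state and then follows a path through the component that returns to
a state of `G` infinitely often is accepted. -/
theorem exists_sur_of_isAECFor {M : MDP S A AP} {π : AP} {R : DRA AP Q}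
    (hR : ∀ w : ℕ → Set AP, R.Accepts w → ∃ᶠ n in atTop, π ∈ w n) {p : Set Q × Set Q}
    {N : Sub (S × Q) A} (hN : IsAECFor M R π p N)
    (hreach : ∃ x ∈ N.states, ∃ u : List (Set AP), u.foldl R.δ R.q₀ = x.2) :
    ∃ x ∈ N.states, π ∈ M.L x.1 := by
  obtain ⟨hEC, hp, hBad, t, ht, htG⟩ := hN
  obtain ⟨x₀, hx₀, u, hu⟩ := hreach
  let r : N.states → N.states → Prop := fun x y => ∃ a, 0 < (M.product R π).P x a y
  have hr : ∀ x y : N.states, r x y → (y : S × Q).2 = R.δ (x : S × Q).2 (M.L (x : S × Q).1) := by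
    rintro x y ⟨a, ha⟩
    by_contra hne
    simp [MDP.product, hne] at ha
  obtain ⟨d, hd⟩ := exists_rank (r := r) (Z := {⟨t, ht⟩}) fun x =>
    ⟨⟨t, ht⟩, rfl, by
      refine (Sub.communicating_toMDP hEC x ⟨t, ht⟩).lift id fun x y hxy => ?_
      obtain ⟨a, -, hp⟩ := hxy
      refine ⟨a, ?_⟩
      simp only [Sub.toMDP] at hp
      split_ifs at hp with ha
      · exact hp
      · exact absurd hp (lt_irrefl _)⟩
  have hnext : ∀ x : N.states, ∃ y, r x y ∧ (x ≠ ⟨t, ht⟩ → d y < d x) := by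
    intro x
    by_cases hx : x = ⟨t, ht⟩
    · obtain ⟨a, ha⟩ := hEC.act_nonempty x x.2
      have h1 := Sub.toMDP.aux hEC x a ha
      have h2 : ∃ y : N.states, (M.product R π).P x a y ≠ 0 := by
        by_contra hcon
        push Not at hcon
        rw [Finset.sum_eq_zero fun y _ => hcon y] at h1
        norm_num at h1
      obtain ⟨y, hy⟩ := h2
      exact ⟨y, ⟨a, lt_of_le_of_ne ((M.product R π).P_nonneg _ _ _) hy.symm⟩,
        fun h => absurd hx h⟩
    · obtain ⟨y, hxy, hlt⟩ := hd x hx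
      exact ⟨y, hxy, fun _ => hlt⟩
  choose next hnext hlt using hnext
  -- the path through the component, and the word that it reads
  let z : ℕ → N.states := fun n => next^[n] ⟨x₀, hx₀⟩
  have hz : ∀ n, z (n + 1) = next (z n) := fun n => Function.iterate_succ_apply' _ _ _
  have hzt : ∃ᶠ n in atTop, z n = ⟨t, ht⟩ := by
    rw [frequently_atTop]
    intro n₀
    have key : ∀ k n, n₀ ≤ n → d (z n) ≤ k → ∃ m ≥ n₀, z m = ⟨t, ht⟩ := by
      intro k
      induction k with
      | zero =>
        intro n hn hdn
        by_cases h : z n = ⟨t, ht⟩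
        · exact ⟨n, hn, h⟩
        · have := hlt (z n) h
          lia
      | succ k ih =>
        intro n hn hdn
        by_cases h : z n = ⟨t, ht⟩
        · exact ⟨n, hn, h⟩
        · have := hlt (z n) h
          exact ih (n + 1) (by lia) (by rw [hz]; lia)
    exact key _ n₀ le_rfl le_rfl
  let w : ℕ → Set AP := fun n =>
    if h : n < u.length then u[n] else M.L (z (n - u.length) : S × Q).1
  have hrun1 : ∀ n ≤ u.length, R.run w n = (u.take n).foldl R.δ R.q₀ := by
    intro n
    induction n with
    | zero => intro _; rfl
    | succ n ih =>
      intro hn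
      have hn' : n < u.length := hn
      rw [DRA.run, ih hn'.le, List.take_add_one, List.foldl_append]
      simp [w, hn']
  have hrun2 : ∀ n, R.run w (u.length + n) = (z n : S × Q).2 := by
    intro n
    induction n with
    | zero =>
      rw [add_zero, hrun1 _ le_rfl, List.take_length, hu]
      rfl
    | succ n ih =>
      rw [← add_assoc, DRA.run, ih, hz, hr _ _ (hnext (z n))]
      simp [w]
  have hacc : R.Accepts w := by
    refine ⟨p, hp, fun b hb hfreq => ?_, t.2, htG, ?_⟩
    · obtain ⟨n, hn, hnb⟩ := frequently_atTop.1 hfreq u.length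
      obtain ⟨m, rfl⟩ := Nat.exists_eq_add_of_le hn
      rw [hrun2] at hnb
      exact hBad _ (z m).2 (hnb ▸ hb)
    · rw [frequently_atTop] at hzt ⊢
      intro n₀
      obtain ⟨m, hm, hmt⟩ := hzt n₀
      refine ⟨u.length + m, by lia, ?_⟩
      rw [hrun2, hmt]
  obtain ⟨n, hn, hπ⟩ := frequently_atTop.1 (hR w hacc) u.length
  refine ⟨z (n - u.length), (z _).2, ?_⟩
  have hn' : ¬ n < u.length := not_lt.2 hn
  simpa only [w, dif_neg hn'] using hπ

end MAEC

end ACPC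

open ACPC in
theorem mainTheorem2 {S A AP Q : Type*} [Fintype S] [Finite A] [Finite AP] [Fintype Q]
    [MeasurableSpace S] [MeasurableSingletonClass S]
    [MeasurableSpace Q] [MeasurableSingletonClass Q]
    (M : MDP S A AP) (π : AP) (R : DRA AP Q)
    -- every word accepted by the automaton satisfies `G F π`
    (hR : ∀ w : ℕ → Set AP, R.Accepts w → ∃ᶠ n in atTop, π ∈ w n)
    (N₀ : Sub (S × Q) A) (hN : IsMAEC M R π N₀)
    -- some automaton component of a state of the component is reachable in the automaton
    (hreach : ∃ x ∈ N₀.states, ∃ u : List (Set AP), u.foldl R.δ R.q₀ = x.2)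
    (N : MDP N₀.states A (Option Q)) (hN_eq : N = Sub.toMDP hN.isEC) :
    -- the algorithm has an output
    (∃ X, Aux.IsOutput N none X) ∧
    -- and every output is an MDP `Nsur` on the (non-empty) set of surveillance states
    (N.sur none).Nonempty ∧
    ∀ X, Aux.IsOutput N none X →
      ∃ Nsur : MDP (N.sur none) (N₀.states → Option A) (Option Q),
        Aux.Yields N none X Nsur ∧
        -- the actions, transition probabilities and costs of `Nsur`
        (∀ v, ∀ ζ ∈ Nsur.enabled v,
          N.IsPartialStationary ζ ∧ (ζ v).isSome ∧
          (∀ v' : N.sur none,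
            N.nextSurProb none ζ v v' = ENNReal.ofReal (Nsur.P v ζ v')) ∧
          N.cycleCost none ζ v = ENNReal.ofReal (Nsur.g v ζ)) ∧
        ∃ V : ℝ≥0,
          -- `V` is the minimum ACPC value of `Nsur` from every state
          (∀ v, IsLeast {x | ∃ C, x = Nsur.acpc none C v} (V : ℝ≥0∞)) ∧
          -- the ACPC problem for `Nsur` is the ACPS problem for `Nsur`
          (∀ C v, Nsur.acpc none C v = Nsur.acps C v) ∧
          (∀ v, IsLeast {x | ∃ C, x = Nsur.acps C v} (V : ℝ≥0∞)) ∧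
          -- `V` is the minimum ACPC value of `N` from every state
          (∀ s, IsLeast {x | ∃ C, N.Surveils none C s ∧ x = N.acpc none C s} (V : ℝ≥0∞)) ∧
          ((∀ E : Sub N₀.states A, E.IsEC N → (∀ s ∈ E.states, s ∉ N.sur none) →
              ∃ s ∈ E.states, ∃ a ∈ E.act s, 0 < N.g s a) →
            ∀ s, IsLeast {x | ∃ C, x = N.acpc none C s} (V : ℝ≥0∞)) ∧
          -- a stationary solution of the ACPS problem exists
          (∃ D : Nsur.Stationary, ∀ v C, Nsur.acps D.toStrategy v ≤ Nsur.acps C v) ∧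
          -- every such solution attains `V` and unwraps to an optimal finite-memory strategy
          ∀ D : Nsur.Stationary, (∀ v C, Nsur.acps D.toStrategy v ≤ Nsur.acps C v) →
            (∀ v, Nsur.acpc none D.toStrategy v = V) ∧
            ∃ F : N.FiniteMemory (Option (N.sur none)), Unwraps N none Nsur D F ∧
              ∀ s, N.Surveils none F.toStrategy s ∧ N.acpc none F.toStrategy s = V := by
  subst hN_eq
  have hB : ((Sub.toMDP hN.isEC).sur none).Nonempty := by
    obtain ⟨p, hp⟩ := hN.1
    obtain ⟨x, hx, hπ⟩ := exists_sur_of_isAECFor hR hp hreach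
    exact ⟨⟨x, hx⟩, MDP.mem_sur.2 (Or.inr ⟨rfl, hπ⟩)⟩
  exact ⟨Aux.exists_isOutput _ _, hB, fun X hX =>
    exists_reduction (Sub.communicating_toMDP hN.isEC) hB hX⟩
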